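/- For $k\ge 1$, let $k$-DFA-INT be the following decision problem: given $k$ deterministic finite automata $D_1,\dots,D_k$ over a common finite alphabet $\Sigma$, is there a word $w\in\Sigma^*$ with $w\in L(D_1)\cap\dots\cap L(D_k)$? The input is encoded as a bit string of length $n$: the size of $\Sigma$ in unary, followed, for each automaton, by its number of states $s$ in unary, its initial state, one bit per state marking the accepting states, and its transition table, where states are written in binary with as many digits as $s-1$ has. $\mathrm{DTIME}(t(n))$ is the class of languages over $\{0,1\}$ decided by deterministic multitape Turing machines in $O(t(n))$ steps. The alphabet may be an unrestricted part of the input or may have a fixed size; more generally, fix any set $A\subseteq\{0,1,2,\dots\}$ of sizes that $|\Sigma|$ may take (the same set in all the problems below). Let $c\ge 0$ be an integer. If $(k+c)$-DFA-INT $\notin \mathrm{DTIME}(n^{k-\varepsilon})$ for all integers $k\ge 1$ and all real $\varepsilon>0$, then $k$-DFA-INT $\notin \mathrm{DTIME}(n^{k-\varepsilon})$ for all integers $k\ge 1$ and all real $\varepsilon>0$. -/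

import Mathlib

open Asymptotics Filter

/-- A deterministic multitape Turing machine over the input alphabet `Bool`.  It has finitely many
two-way infinite tapes (all of them can be read and written; `inp` is the one that initially holds
the input), a finite tape alphabet whose blank symbol is `default`, and finitely many states.
In one step it reads the symbols under all heads and then, on every tape, writes a symbol
and moves the head by at most one cell (`none` means that the head stays).  It halts when the
transition function is undefined. -/
structure MultiTM where
  /-- indices of the tapes -/
  ι : Type
  [finι : Finite ι]
  [decι : DecidableEq ι]
  /-- the input tape -/
  inp : ι
  /-- tape alphabet, with `default` as the blank symbol -/
  Γ : Type
  [finΓ : Finite Γ]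
  [inhΓ : Inhabited Γ]
  /-- the input symbols, as symbols of the tape alphabet -/
  bit : Bool → Γ
  bit_injective : Function.Injective bit
  bit_ne_blank : ∀ b, bit b ≠ default
  /-- control states -/
  Q : Type
  [finQ : Finite Q]
  start : Q
  /-- accepting states -/
  accept : Set Q
  /-- transition function -/
  δ : Q → (ι → Γ) → Option (Q × (ι → Γ × Option Turing.Dir))

namespace MultiTM

attribute [instance] finι decι finΓ inhΓ finQ

/-- A configuration: the state and, for each tape, its contents and head position. -/
structure Cfg (M : MultiTM) where
  state : M.Q
  tape : M.ι → Turing.Tape M.Γ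

/-- Write a symbol, then move the head. -/
def act {Γ : Type} [Inhabited Γ] (T : Turing.Tape Γ) (a : Γ × Option Turing.Dir) :
    Turing.Tape Γ :=
  match a.2 with
  | none => T.write a.1
  | some d => (T.write a.1).move d

/-- One step of the machine; `none` if the machine has halted. -/
def step (M : MultiTM) (C : M.Cfg) : Option M.Cfg :=
  (M.δ C.state (fun i => (C.tape i).head)).map
    (fun r => ⟨r.1, fun i => act (C.tape i) (r.2 i)⟩)

/-- The initial configuration: the head of the input tape is on the first letter of the input,
and all other cells are blank. -/
def init (M : MultiTM) (x : List Bool) : M.Cfg :=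
  ⟨M.start, fun i => Turing.Tape.mk₁ (if i = M.inp then x.map M.bit else [])⟩

/-- The configuration after `t` steps; a halted configuration does not change any more. -/
def run (M : MultiTM) (t : ℕ) (C : M.Cfg) : M.Cfg :=
  (fun C' => (M.step C').getD C')^[t] C

/-- `M` decides `L` and halts on every input `x` after at most `T |x|` steps. -/
def DecidesInTime (M : MultiTM) (L : Language Bool) (T : ℕ → ℕ) : Prop :=
  ∀ x : List Bool,
    M.step (M.run (T x.length) (M.init x)) = none ∧
    ((M.run (T x.length) (M.init x)).state ∈ M.accept ↔ x ∈ L)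

end MultiTM

/-- `DTIME(t)`: the languages decided by a deterministic multitape Turing machine in
`O(t(n))` steps, where `n` is the length of the input. -/
def DTIME (t : ℕ → ℝ) : Set (Language Bool) :=
  {L | ∃ (M : MultiTM) (T : ℕ → ℕ),
    (fun n => (T n : ℝ)) =O[atTop] t ∧ M.DecidesInTime L T}

namespace DFAInt

/-- `1ⁿ0`. -/
def unary (n : ℕ) : List Bool := List.replicate n true ++ [false]

/-- The `w` lowest binary digits of `n`, lowest digit first. -/
def bits (w n : ℕ) : List Bool := (List.range w).map n.testBit

open Classical in
/-- The bit string for a DFA with states `0, …, s - 1` over the letters `0, …, m - 1`: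
the number of states in unary, the initial state, one bit per state that tells whether the state
is accepting, and the transition table row by row.  States are written in binary, with as many
digits as `s - 1` has. -/
noncomputable def encodeDFA {m s : ℕ} (D : DFA (Fin m) (Fin s)) : List Bool :=
  unary s ++ bits (Nat.size (s - 1)) D.start ++
    List.ofFn (fun q : Fin s => decide (q ∈ D.accept)) ++
    (List.ofFn (fun q : Fin s =>
      (List.ofFn (fun a : Fin m => bits (Nat.size (s - 1)) (D.step q a))).flatten)).flatten

/-- The bit string for a list of `k` DFA's over the common alphabet `0, …, m - 1`: the size of the
alphabet in unary, followed by the DFA's. -/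
noncomputable def encode {k m : ℕ} (s : Fin k → ℕ) (D : (i : Fin k) → DFA (Fin m) (Fin (s i))) :
    List Bool :=
  unary m ++ (List.ofFn (fun i => encodeDFA (D i))).flatten

end DFAInt

/-- `k`-DFA-INT: the bit strings that encode `k` DFA's over a common alphabet whose languages have
a word in common.  The size of the alphabet may be any element of `A`: the alphabet is an
unrestricted part of the input for `A = Set.univ`, and fixed for a singleton `A`. -/
def kDFAInt (A : Set ℕ) (k : ℕ) : Language Bool :=
  {x | ∃ m ∈ A, ∃ (s : Fin k → ℕ) (D : (i : Fin k) → DFA (Fin m) (Fin (s i))),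
    x = DFAInt.encode s D ∧ ∃ w : List (Fin m), ∀ i, w ∈ (D i).accepts}

/-!
The proof is by contraposition: a machine for `k`-DFA-INT that runs in time `O(n^(k - ε))` gives
machines that are too fast for larger numbers of automata.

Let `k ≥ 2`, and let `g` be large. Given `k * g` automata, form `k` groups of `g` automata and
replace each group by its product automaton. The products accept a common word if and only if the
given automata do. If the given instance has length `n`, then each product has `O(n^g)` states, so
the new instance has length `O(n^(g + 2))`, and it can be written down in time `O(n^(g + 3))`. Thus
`k * g`-DFA-INT is solved in time `O(n^(g + 3) + n^((g + 2) * (k - ε)))` (`kDFAInt_mul_mem_DTIME`).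
Both exponents are at most `k * g - c - 1` if `g` is large enough, because the difference of `k * g`
and `(g + 2) * (k - ε)` is `(g + 2) * ε - 2 * k`, which grows with `g`. So `(k' + c)`-DFA-INT
belongs to `DTIME(n^(k' - 1))` for `k' = k * g - c`, contrary to the hypothesis.

For `k = 1` the conclusion holds unconditionally if some size of the alphabet is allowed: a machine
that runs in sublinear time does not reach the end of its input, but `1ᵐ01ᴺ` is not an instance
whereas it has a continuation that is a solvable instance (`kDFAInt_one_notMem_DTIME`). If no size
of the alphabet is allowed, then all the problems are the empty language, and the hypothesis fails.

Most of the file is the construction of a multitape machine for the reduction. Programs are composed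
of fragments (`Frag`), with a rule for each way to compose them that bounds the time and says what
the tapes contain in the end (`Frag.Ends`). The machine reads the automata and pads the number of
states of each one to a power of two (`Red.Ends.parse`); the states of a product are then exactly
the bit strings of a certain length, in their numerical order, and a row of its transition table
consists of interleaved rows of the tables of its factors. So a product is written by nested loops
over the rows of these tables (`Red.emits_putProd`), without any arithmetic on state numbers.
Membership of the size of the alphabet in `A` need not be tested, since the reduction does not
change the alphabet.
-/

/-! ### Program fragments -/

/-- A piece of a Turing machine program on tapes indexed by `ι` with alphabet `Γ`.  In a given
state and with given symbols under the heads it either makes a step, or exits (`inr true`), or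
aborts (`inr false`). Exiting hands the tapes over to the next fragment, aborting ends the whole
computation. -/
structure Frag (ι Γ : Type) where
  /-- control states -/
  Q : Type
  [finQ : Finite Q]
  /-- initial state -/
  start : Q
  /-- transition function -/
  δ : Q → (ι → Γ) → (Q × (ι → Γ × Option Turing.Dir)) ⊕ Bool

namespace Frag

attribute [instance] Frag.finQ

variable {ι Γ : Type} [Inhabited Γ]

/-- The symbols under the heads. -/
def heads (σ : ι → Turing.Tape Γ) : ι → Γ := fun i => (σ i).head

/-- The action on all tapes: writing and moving. -/
def acts (a : ι → Γ × Option Turing.Dir) (σ : ι → Turing.Tape Γ) : ι → Turing.Tape Γ :=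
  fun i => MultiTM.act (σ i) (a i)

/-- The action that changes nothing. -/
def stay (h : ι → Γ) : ι → Γ × Option Turing.Dir := fun i => (h i, none)

@[simp] lemma act_head_none (T : Turing.Tape Γ) : MultiTM.act T (T.head, none) = T := by
  simp [MultiTM.act]

@[simp] lemma acts_stay (σ : ι → Turing.Tape Γ) : acts (stay (heads σ)) σ = σ := by
  funext i; simp [acts, stay, heads]

/-- `F.Halts n q σ b σ'`: from state `q` and tapes `σ`, after exactly `n` steps, the fragment exits
(`b = true`) or aborts (`b = false`) with tapes `σ'`. -/
inductive Halts (F : Frag ι Γ) :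
    ℕ → F.Q → (ι → Turing.Tape Γ) → Bool → (ι → Turing.Tape Γ) → Prop
  | halt {q σ b} : F.δ q (heads σ) = .inr b → Halts F 0 q σ b σ
  | step {n q σ b σ' q' a} : F.δ q (heads σ) = .inl (q', a) → Halts F n q' (acts a σ) b σ' →
      Halts F (n + 1) q σ b σ'

/-- `F.Ends σ t Q A`: started on the tapes `σ`, the fragment ends within `t` steps; it exits with
tapes that satisfy `Q`, or it aborts and `A` holds. -/
def Ends (F : Frag ι Γ) (σ : ι → Turing.Tape Γ) (t : ℕ) (Q : (ι → Turing.Tape Γ) → Prop)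
    (A : Prop) : Prop :=
  ∃ n ≤ t, ∃ b σ', F.Halts n F.start σ b σ' ∧ if b then Q σ' else A

section rules

variable {F G : Frag ι Γ} {σ σ' : ι → Turing.Tape Γ} {t t' n m : ℕ}
  {Q Q' : (ι → Turing.Tape Γ) → Prop} {A A' : Prop} {b : Bool}

lemma Ends.imp (h : F.Ends σ t Q A) (ht : t ≤ t') (hQ : ∀ σ', Q σ' → Q' σ') (hA : A → A') :
    F.Ends σ t' Q' A' := by
  obtain ⟨n, hn, b, σ', hF, hb⟩ := h
  refine ⟨n, hn.trans ht, b, σ', hF, ?_⟩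
  cases b
  · exact hA (by simpa using hb)
  · exact hQ _ (by simpa using hb)

lemma Ends.mono (h : F.Ends σ t Q A) (ht : t ≤ t') : F.Ends σ t' Q A := h.imp ht (fun _ h => h) id

/-- Run `F`, then `G`. -/
def seq (F G : Frag ι Γ) : Frag ι Γ where
  Q := F.Q ⊕ G.Q
  start := .inl F.start
  δ q h := match q with
    | .inl q => match F.δ q h with
      | .inl (q', a) => .inl (.inl q', a)
      | .inr true => .inl (.inr G.start, stay h)
      | .inr false => .inr false
    | .inr q => match G.δ q h with
      | .inl (q', a) => .inl (.inr q', a)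
      | .inr b => .inr b

lemma Halts.seq_right {q : G.Q} (h : G.Halts n q σ b σ') : (seq F G).Halts n (.inr q) σ b σ' := by
  induction h with
  | halt h => exact .halt (by simp [seq, h])
  | step h _ ih => exact .step (by simp only [seq, h]) ih

lemma Halts.seq_abort {q : F.Q} (h : F.Halts n q σ b σ') (hb : b = false) :
    (seq F G).Halts n (.inl q) σ false σ' := by
  induction h with
  | halt h => exact .halt (by simp [seq, h, hb])
  | step h _ ih => exact .step (by simp only [seq, h]) (ih hb)

lemma Halts.seq {σ₁ : ι → Turing.Tape Γ} {q : F.Q} {c : Bool} (h : F.Halts n q σ c σ₁)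
    (hc : c = true) (h' : G.Halts m G.start σ₁ b σ') :
    (seq F G).Halts (n + 1 + m) (.inl q) σ b σ' := by
  induction h with
  | @halt q σ₀ c h =>
    rw [show 0 + 1 + m = m + 1 by omega]
    refine .step (q' := .inr G.start) (a := stay (heads σ₀)) (by simp [Frag.seq, h, hc]) ?_
    rw [acts_stay]
    exact h'.seq_right
  | @step n q σ₀ c σ₂ q' a h _ ih =>
    rw [show n + 1 + 1 + m = n + 1 + m + 1 by omega]
    exact .step (by simp only [Frag.seq, h]) (ih hc h')

lemma Ends.seq (h : F.Ends σ t (fun σ₁ => G.Ends σ₁ t' Q A) A) :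
    (seq F G).Ends σ (t + 1 + t') Q A := by
  obtain ⟨n, hn, b, σ₁, hF, hb⟩ := h
  cases b
  · exact ⟨n, by omega, false, σ₁, hF.seq_abort rfl, by simpa using hb⟩
  · obtain ⟨m, hm, c, σ₂, hG, hc⟩ := by simpa using hb
    exact ⟨n + 1 + m, by omega, c, σ₂, hF.seq rfl hG, hc⟩

/-- Do nothing. -/
def skip : Frag ι Γ := ⟨Unit, (), fun _ _ => .inr true⟩

lemma Ends.skip (h : Q σ) : skip.Ends σ t Q A := ⟨0, Nat.zero_le _, true, σ, .halt rfl, by simpa⟩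

/-- Abort the whole computation. -/
def abort : Frag ι Γ := ⟨Unit, (), fun _ _ => .inr false⟩

lemma Ends.abort (h : A) : abort.Ends σ t Q A := ⟨0, Nat.zero_le _, false, σ, .halt rfl, by simpa⟩

/-- A single step. -/
def basic (a : (ι → Γ) → ι → Γ × Option Turing.Dir) : Frag ι Γ where
  Q := Bool
  start := false
  δ q h := if q then .inr true else .inl (true, a h)

lemma Ends.basic {a : (ι → Γ) → ι → Γ × Option Turing.Dir} (h : Q (acts (a (heads σ)) σ)) :
    (basic a).Ends σ 1 Q A :=
  ⟨1, le_rfl, true, _, .step rfl (.halt rfl), by simpa⟩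

/-- Run `F` or `G`, according to a test of the symbols under the heads. -/
def ite (c : (ι → Γ) → Bool) (F G : Frag ι Γ) : Frag ι Γ where
  Q := Option (F.Q ⊕ G.Q)
  start := none
  δ q h := match q with
    | none => .inl (some (if c h then .inl F.start else .inr G.start), stay h)
    | some (.inl q) => match F.δ q h with
      | .inl (q', a) => .inl (some (.inl q'), a)
      | .inr b => .inr b
    | some (.inr q) => match G.δ q h with
      | .inl (q', a) => .inl (some (.inr q'), a)
      | .inr b => .inr b

lemma Halts.ite_left {c : (ι → Γ) → Bool} {q : F.Q} (h : F.Halts n q σ b σ') :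
    (ite c F G).Halts n (some (.inl q)) σ b σ' := by
  induction h with
  | halt h => exact .halt (by simp [ite, h])
  | step h _ ih => exact .step (by simp only [ite, h]) ih

lemma Halts.ite_right {c : (ι → Γ) → Bool} {q : G.Q} (h : G.Halts n q σ b σ') :
    (ite c F G).Halts n (some (.inr q)) σ b σ' := by
  induction h with
  | halt h => exact .halt (by simp [ite, h])
  | step h _ ih => exact .step (by simp only [ite, h]) ih

lemma Ends.ite {c : (ι → Γ) → Bool} (hF : c (heads σ) = true → F.Ends σ t Q A)
    (hG : c (heads σ) = false → G.Ends σ t Q A) : (ite c F G).Ends σ (t + 1) Q A := by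
  rcases hc : c (heads σ)
  · obtain ⟨n, hn, b, σ₁, h, hb⟩ := hG hc
    refine ⟨n + 1, by omega, b, σ₁, .step (q' := some (.inr G.start)) (a := stay (heads σ))
      (by simp [Frag.ite, hc]) ?_, hb⟩
    rw [acts_stay]
    exact h.ite_right
  · obtain ⟨n, hn, b, σ₁, h, hb⟩ := hF hc
    refine ⟨n + 1, by omega, b, σ₁, .step (q' := some (.inl F.start)) (a := stay (heads σ))
      (by simp [Frag.ite, hc]) ?_, hb⟩
    rw [acts_stay]
    exact h.ite_left

/-- Run `F` as long as a test of the symbols under the heads succeeds. -/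
def loop (c : (ι → Γ) → Bool) (F : Frag ι Γ) : Frag ι Γ where
  Q := Option F.Q
  start := none
  δ q h := match q with
    | none => if c h then .inl (some F.start, stay h) else .inr true
    | some q => match F.δ q h with
      | .inl (q', a) => .inl (some q', a)
      | .inr true => .inl (none, stay h)
      | .inr false => .inr false

lemma Halts.loop_abort {c : (ι → Γ) → Bool} {q : F.Q} (h : F.Halts n q σ b σ') (hb : b = false) :
    (loop c F).Halts n (some q) σ false σ' := by
  induction h with
  | halt h => exact .halt (by simp [loop, h, hb])
  | step h _ ih => exact .step (by simp only [loop, h]) (ih hb)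

lemma Halts.loop {c : (ι → Γ) → Bool} {σ₁ : ι → Turing.Tape Γ} {q : F.Q} {e : Bool}
    (h : F.Halts n q σ e σ₁) (he : e = true) (h' : (loop c F).Halts m none σ₁ b σ') :
    (loop c F).Halts (n + 1 + m) (some q) σ b σ' := by
  induction h with
  | @halt q σ₀ e h =>
    rw [show 0 + 1 + m = m + 1 by omega]
    refine .step (q' := none) (a := stay (heads σ₀)) (by simp [Frag.loop, h, he]) ?_
    rw [acts_stay]
    exact h'
  | @step n q σ₀ e σ₂ q' a h _ ih =>
    rw [show n + 1 + 1 + m = n + 1 + m + 1 by omega]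
    exact .step (by simp only [Frag.loop, h]) (ih he h')

lemma Ends.loop_false {c : (ι → Γ) → Bool} (hc : c (heads σ) = false) (h : Q σ) :
    (loop c F).Ends σ t Q A := ⟨0, Nat.zero_le _, true, σ, .halt (by simp [loop, hc]), by simpa⟩

lemma Ends.loop_true {c : (ι → Γ) → Bool} (hc : c (heads σ) = true)
    (h : F.Ends σ t (fun σ₁ => (loop c F).Ends σ₁ t' Q A) A) :
    (loop c F).Ends σ (t + 2 + t') Q A := by
  obtain ⟨n, hn, b, σ₁, hF, hb⟩ := h
  have key : ∀ k b σ₂, (loop c F).Halts k (some F.start) σ b σ₂ →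
      (loop c F).Halts (k + 1) none σ b σ₂ := fun k b σ₂ h => by
    refine .step (q' := some F.start) (a := stay (heads σ)) (by simp [Frag.loop, hc]) ?_
    rwa [acts_stay]
  cases b
  · exact ⟨n + 1, by omega, false, σ₁, key _ _ _ (hF.loop_abort rfl), by simpa using hb⟩
  · obtain ⟨m, hm, e, σ₂, hG, he⟩ := by simpa using hb
    exact ⟨n + 1 + m + 1, by omega, e, σ₂, key _ _ _ (hF.loop rfl hG), he⟩

/-- Run the fragments `F i` for the members `i` of a list, in order. -/
def forEach {I : Type} (F : I → Frag ι Γ) : List I → Frag ι Γ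
  | [] => skip
  | i :: is => seq (F i) (forEach F is)

lemma Ends.forEach_cons {I : Type} {F : I → Frag ι Γ} {i : I} {is : List I}
    (h : (F i).Ends σ t (fun σ₁ => (forEach F is).Ends σ₁ t' Q A) A) :
    (forEach F (i :: is)).Ends σ (t + 1 + t') Q A := h.seq

end rules

/-! ### From fragments to machines and back -/

/-- The fragment that runs a machine and exits if it accepts and aborts if it rejects. -/
noncomputable def ofMachine (M : MultiTM) : Frag M.ι M.Γ := by
  classical
  exact {
    Q := M.Q
    start := M.start
    δ := fun q h => match M.δ q h with
      | some r => .inl r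
      | none => .inr (decide (q ∈ M.accept)) }

lemma run_of_step_none {M : MultiTM} {C : M.Cfg} (h : M.step C = none) (t : ℕ) :
    M.run t C = C := by
  induction t with
  | zero => rfl
  | succ t ih => rw [MultiTM.run, Function.iterate_succ_apply, h]; exact ih

lemma run_succ (M : MultiTM) (C : M.Cfg) (t : ℕ) :
    M.run (t + 1) C = M.run t ((M.step C).getD C) := rfl

/-- A machine that has halted after `t` steps yields a halting run of its fragment. -/
lemma ofMachine_halts {M : MultiTM} {t : ℕ} {C : M.Cfg} (h : M.step (M.run t C) = none) :
    ∃ n ≤ t, ∃ b σ', (ofMachine M).Halts n C.state C.tape b σ' ∧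
      (b = true ↔ (M.run t C).state ∈ M.accept) := by
  induction t generalizing C with
  | zero =>
    have h' : M.δ C.state (heads C.tape) = none := by
      simp only [MultiTM.run, MultiTM.step, Function.iterate_zero, id, Option.map_eq_none_iff] at h
      exact h
    classical
    refine ⟨0, le_rfl, decide (C.state ∈ M.accept), _, .halt ?_, ?_⟩
    · simp [ofMachine, h']
    · simp [MultiTM.run]
  | succ t ih =>
    rw [run_succ] at h ⊢
    rcases hC : M.δ C.state (heads C.tape) with _ | r
    · have hs : M.step C = none := by
        simp only [MultiTM.step, Option.map_eq_none_iff]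
        exact hC
      rw [hs] at h ⊢
      obtain ⟨n, hn, b, σ', hb⟩ := ih h
      exact ⟨n, by omega, b, σ', hb⟩
    · have hs : M.step C = some ⟨r.1, acts r.2 C.tape⟩ := by
        have hC' : M.δ C.state (fun i => (C.tape i).head) = some r := hC
        simp only [MultiTM.step, hC', Option.map_some]
        rfl
      rw [hs] at h ⊢
      obtain ⟨n, hn, b, σ', hF, hb⟩ := ih h
      refine ⟨n + 1, by omega, b, σ', .step (q' := r.1) (a := r.2) ?_ hF, hb⟩
      simp [ofMachine, hC]

/-- The machine that runs a fragment; the additional state `none` is reached when the fragment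
exits, and it is the accepting state. -/
def toMachine [Finite ι] [DecidableEq ι] [Finite Γ] (F : Frag ι Γ) (inp : ι) (bit : Bool → Γ)
    (h1 : Function.Injective bit) (h2 : ∀ b, bit b ≠ default) : MultiTM where
  ι := ι
  inp := inp
  Γ := Γ
  bit := bit
  bit_injective := h1
  bit_ne_blank := h2
  Q := Option F.Q
  start := some F.start
  accept := {none}
  δ q h := match q with
    | none => none
    | some q => match F.δ q h with
      | .inl (q', a) => some (some q', a)
      | .inr true => some (none, stay h)
      | .inr false => none

/-- A halting run of a fragment yields a run of its machine, which halts after at most one further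
step and accepts if and only if the fragment exits. -/
lemma toMachine_run [Finite ι] [DecidableEq ι] [Finite Γ] {F : Frag ι Γ} {inp : ι}
    {bit : Bool → Γ} {h1 : Function.Injective bit} {h2 : ∀ b, bit b ≠ default} {n : ℕ} {q : F.Q}
    {σ σ' : ι → Turing.Tape Γ} {b : Bool} (h : F.Halts n q σ b σ') {t : ℕ} (ht : n + 1 ≤ t) :
    let M := F.toMachine inp bit h1 h2
    M.step (M.run t ⟨some q, σ⟩) = none ∧
      ((M.run t ⟨some q, σ⟩).state ∈ M.accept ↔ b = true) := by
  intro M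
  induction h generalizing t with
  | @halt q σ b h =>
    obtain ⟨t, rfl⟩ := Nat.exists_eq_add_of_le' ht
    have h' : F.δ q (fun i => (σ i).head) = .inr b := h
    cases b
    · have hs : M.step ⟨some q, σ⟩ = none := by
        simp [M, toMachine, MultiTM.step, h']
      rw [run_of_step_none hs]
      exact ⟨hs, by simp only [M, toMachine]; exact ⟨nofun, nofun⟩⟩
    · have hs : M.step ⟨some q, σ⟩ = some ⟨none, acts (stay (heads σ)) σ⟩ := by
        simp [M, toMachine, MultiTM.step, h']
        rfl
      have hs' : M.step ⟨none, acts (stay (heads σ)) σ⟩ = none := by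
        simp [M, toMachine, MultiTM.step]
      rw [run_succ, hs, Option.getD_some, run_of_step_none hs']
      exact ⟨hs', by simp only [M, toMachine]; exact ⟨fun _ => trivial, fun _ => rfl⟩⟩
  | @step n q σ b σ' q' a h _ ih =>
    obtain ⟨t, rfl⟩ := Nat.exists_eq_add_of_le' ht
    have h' : F.δ q (fun i => (σ i).head) = .inl (q', a) := h
    have hs : M.step ⟨some q, σ⟩ = some ⟨some q', acts a σ⟩ := by
      simp [M, toMachine, MultiTM.step, h']
      rfl
    rw [show t + (n + 1 + 1) = t + (n + 1) + 1 by omega, run_succ, hs, Option.getD_some]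
    exact ih (by omega)

/-! ### Changing tapes and alphabet -/

section lift

variable {ι₁ Γ₁ : Type} [Inhabited Γ₁]

/-- A fragment as a fragment on more tapes and with a larger alphabet: `er` is a partial inverse of
the embedding `e` of the index sets of the tapes, and `dec` is a left inverse of the embedding `enc`
of the alphabets. -/
def lift (F : Frag ι₁ Γ₁) (e : ι₁ → ι) (er : ι → Option ι₁) (enc : Γ₁ → Γ) (dec : Γ → Γ₁) :
    Frag ι Γ where
  Q := F.Q
  start := F.start
  δ q h := match F.δ q (fun i => dec (h (e i))) with
    | .inl (q', a) => .inl (q', fun j => match er j with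
      | some i => (enc (a i).1, (a i).2)
      | none => (h j, none))
    | .inr b => .inr b

lemma map_act (f : Turing.PointedMap Γ₁ Γ) (T : Turing.Tape Γ₁) (a : Γ₁ × Option Turing.Dir) :
    (MultiTM.act T a).map f = MultiTM.act (T.map f) (f a.1, a.2) := by
  rcases a with ⟨a, _ | d⟩ <;> simp [MultiTM.act, Turing.Tape.map_move]

/-- A run of a fragment is also a run of the lifted fragment, which does not change the additional
tapes. -/
lemma Halts.lift {F : Frag ι₁ Γ₁} {e : ι₁ → ι} {er : ι → Option ι₁} {enc : Turing.PointedMap Γ₁ Γ}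
    {dec : Γ → Γ₁} (he : ∀ i j, er j = some i ↔ j = e i) (hd : ∀ a, dec (enc a) = a)
    {n : ℕ} {q : F.Q} {τ τ' : ι₁ → Turing.Tape Γ₁} {b : Bool} (h : F.Halts n q τ b τ')
    {σ : ι → Turing.Tape Γ} (hσ : ∀ i, σ (e i) = (τ i).map enc) :
    ∃ σ', (F.lift e er enc dec).Halts n q σ b σ' ∧ (∀ i, σ' (e i) = (τ' i).map enc) ∧
      ∀ j, er j = none → σ' j = σ j := by
  have key : ∀ τ : ι₁ → Turing.Tape Γ₁, ∀ σ : ι → Turing.Tape Γ,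
      (∀ i, σ (e i) = (τ i).map enc) → (fun i => dec (heads σ (e i))) = heads τ := by
    intro τ σ hσ
    funext i
    simp [heads, hσ, hd]
  induction h generalizing σ with
  | @halt q τ b h =>
    refine ⟨σ, .halt ?_, hσ, fun _ _ => rfl⟩
    simp only [Frag.lift, key τ σ hσ, h]
  | @step n q τ b τ' q' a h _ ih =>
    have := ih (σ := acts (fun j => match er j with
      | some i => (enc (a i).1, (a i).2)
      | none => (heads σ j, none)) σ) (fun i => by
        simp only [acts, (he i (e i)).2 rfl, hσ, map_act])
    obtain ⟨σ', h1, h2, h3⟩ := this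
    refine ⟨σ', .step ?_ h1, h2, fun j hj => ?_⟩
    · simp only [Frag.lift, key τ σ hσ, h]
    · rw [h3 j hj]
      simp [acts, hj, heads]

end lift

end Frag

/-! ### Elementary programs -/

namespace Frag

open Turing (Tape)

variable {ι Γ : Type} [Inhabited Γ] {σ : ι → Tape Γ} {i j : ι}
  {Q : (ι → Tape Γ) → Prop} {A : Prop} {a : Γ} {l l' r r' s : List Γ}

@[simp] lemma head_mk₂_cons : (Tape.mk₂ l (a :: r)).head = a := rfl

@[simp] lemma head_mk₂_nil : (Tape.mk₂ l ([] : List Γ)).head = default := rfl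

@[simp] lemma heads_apply : heads σ i = (σ i).head := rfl

/-- A blank at the left end of the contents makes no difference. -/
lemma mk₂_left_blank : Tape.mk₂ (l ++ [default]) r = Tape.mk₂ l r := by
  have h : Turing.ListBlank.mk (l ++ [default]) = Turing.ListBlank.mk l := by
    refine Turing.ListBlank.ext fun n => ?_
    simp only [Turing.ListBlank.nth_mk, List.getI_eq_getElem?_getD]
    rcases lt_trichotomy n l.length with h | h | h
    · simp [h, List.getElem?_append_left]
    · simp [h]
    · rw [List.getElem?_eq_none (by simpa using h), List.getElem?_eq_none h.le]
  simp [Tape.mk₂, h]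

variable [DecidableEq ι]

/-- One step on a single tape, which may depend on the symbols under all heads. -/
def one (i : ι) (g : (ι → Γ) → Γ × Option Turing.Dir) : Frag ι Γ :=
  basic fun h j => if j = i then g h else (h j, none)

lemma Ends.one {g : (ι → Γ) → Γ × Option Turing.Dir}
    (h : Q (Function.update σ i (MultiTM.act (σ i) (g (heads σ))))) : (one i g).Ends σ 1 Q A := by
  refine Ends.basic ?_
  convert h using 1
  funext j
  by_cases hj : j = i
  · subst hj; simp [acts]
  · simp [acts, hj]

/-- Write a symbol and move right. -/
def put (i : ι) (g : (ι → Γ) → Γ) : Frag ι Γ := one i fun h => (g h, some .right)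

/-- Write a symbol without moving. -/
def write (i : ι) (g : (ι → Γ) → Γ) : Frag ι Γ := one i fun h => (g h, none)

/-- Move right. -/
def right (i : ι) : Frag ι Γ := one i fun h => (h i, some .right)

/-- Move left. -/
def left (i : ι) : Frag ι Γ := one i fun h => (h i, some .left)

lemma Ends.put {g : (ι → Γ) → Γ} (hi : σ i = Tape.mk₂ l r)
    (h : Q (Function.update σ i (Tape.mk₂ (g (heads σ) :: l) r.tail))) :
    (put i g).Ends σ 1 Q A := by
  refine Ends.one ?_
  rw [hi]
  convert h using 2
  simp [MultiTM.act, Tape.mk₂]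

lemma Ends.write {g : (ι → Γ) → Γ} (hi : σ i = Tape.mk₂ l r)
    (h : Q (Function.update σ i (Tape.mk₂ l (g (heads σ) :: r.tail)))) :
    (write i g).Ends σ 1 Q A := by
  refine Ends.one ?_
  rw [hi]
  convert h using 2
  simp [MultiTM.act, Tape.mk₂]

lemma Ends.right (hi : σ i = Tape.mk₂ l (a :: r))
    (h : Q (Function.update σ i (Tape.mk₂ (a :: l) r))) : (right i).Ends σ 1 Q A := by
  refine Ends.one ?_
  rw [heads_apply, hi]
  convert h using 2
  simp [MultiTM.act, Tape.mk₂]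

lemma Ends.left (hi : σ i = Tape.mk₂ (a :: l) r)
    (h : Q (Function.update σ i (Tape.mk₂ l (a :: r)))) : (left i).Ends σ 1 Q A := by
  refine Ends.one ?_
  rw [heads_apply, hi]
  convert h using 2
  change Tape.move .left ((Tape.mk₂ (a :: l) r).write (Tape.mk₂ (a :: l) r).head) = _
  rw [Tape.write_self]
  simp [Tape.mk₂]

lemma Ends.left_nil (hi : σ i = Tape.mk₂ [] r)
    (h : Q (Function.update σ i (Tape.mk₂ [] (default :: r)))) : (Frag.left i).Ends σ 1 Q A := by
  refine Ends.left (a := default) (l := []) ?_ h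
  rw [hi, ← mk₂_left_blank]; rfl

/-- The test whether the symbol on tape `i` satisfies `p`. -/
def on (i : ι) (p : Γ → Bool) : (ι → Γ) → Bool := fun h => p (h i)

omit [DecidableEq ι] in
@[simp] lemma on_heads {p : Γ → Bool} : on i p (heads σ) = p (σ i).head := rfl

/-- Move right over a segment of symbols with the property `p`. -/
def skipSeg (p : Γ → Bool) (i : ι) : Frag ι Γ := loop (on i p) (right i)

lemma Ends.skipSeg {p : Γ → Bool} (hi : σ i = Tape.mk₂ l (s ++ r)) (hs : ∀ a ∈ s, p a = true)
    (hr : p (r.head?.getD default) = false)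
    (h : Q (Function.update σ i (Tape.mk₂ (s.reverse ++ l) r))) {t : ℕ} (ht : 3 * s.length ≤ t) :
    (skipSeg p i).Ends σ t Q A := by
  refine Ends.mono ?_ ht
  clear ht
  induction s generalizing σ l with
  | nil =>
    refine Ends.loop_false ?_ ?_
    · cases r <;> simpa [hi] using hr
    · simpa [← show σ i = Tape.mk₂ l r from hi] using h
  | cons a s ih =>
    refine (Ends.loop_true (t' := 3 * s.length) ?_ (Ends.right (by simpa using hi)
      (ih (l := a :: l) (by simp) (fun b hb => hs b (by simp [hb])) ?_))).mono ?_
    · simpa [hi] using hs a (by simp)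
    · simpa using h
    · simp; omega

/-- Move left over a segment of symbols with the property `p`. -/
def backSeg (p : Γ → Bool) (i : ι) : Frag ι Γ := loop (on i p) (left i)

/-- Moving left over `s`, which is followed by a symbol with the property, up to a symbol `a`
without it. -/
lemma Ends.backSeg {p : Γ → Bool} {b : Γ} (hi : σ i = Tape.mk₂ (s.reverse ++ a :: l) (b :: r))
    (hs : ∀ a ∈ s, p a = true) (hb : p b = true) (ha : p a = false)
    (h : Q (Function.update σ i (Tape.mk₂ l (a :: s ++ b :: r)))) {t : ℕ}
    (ht : 3 * s.length + 3 ≤ t) : (backSeg p i).Ends σ t Q A := by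
  refine Ends.mono ?_ ht
  clear ht
  induction s using List.reverseRecOn generalizing σ b r with
  | nil =>
    refine Ends.loop_true (t' := 0) (t := 1) (by simpa [hi] using hb)
      (Ends.left (by simpa using hi) (Ends.loop_false (by simpa using ha) ?_))
    simpa using h
  | append_singleton s c ih =>
    refine (Ends.loop_true (t' := 3 * s.length + 3) (by simpa [hi] using hb)
      (Ends.left (by simpa using hi)
        (ih (b := c) (by simp; rfl) (fun b hb => hs b (by simp [hb])) (hs c (by simp)) ?_))).mono ?_
    · simpa using h
    · simp; omega

/-- Copy a segment of symbols with the property `p` from tape `i` to tape `j`, with a change of the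
symbols. -/
def copySeg (p : Γ → Bool) (i j : ι) (f : Γ → Γ) : Frag ι Γ :=
  loop (on i p) (seq (put j fun h => f (h i)) (right i))

lemma Ends.copySeg {p : Γ → Bool} {f : Γ → Γ} (hij : i ≠ j) (hi : σ i = Tape.mk₂ l (s ++ r))
    (hj : σ j = Tape.mk₂ l' []) (hs : ∀ a ∈ s, p a = true) (hr : p (r.head?.getD default) = false)
    (h : Q (Function.update (Function.update σ i (Tape.mk₂ (s.reverse ++ l) r)) j
      (Tape.mk₂ ((s.map f).reverse ++ l') []))) {t : ℕ} (ht : 5 * s.length ≤ t) :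
    (copySeg p i j f).Ends σ t Q A := by
  refine Ends.mono ?_ ht
  clear ht
  induction s generalizing σ l l' with
  | nil =>
    refine Ends.loop_false ?_ ?_
    · cases r <;> simpa [hi] using hr
    · simpa [← hj, ← show σ i = Tape.mk₂ l r from hi] using h
  | cons a s ih =>
    refine (Ends.loop_true (t' := 5 * s.length) ?_ (Ends.seq (Ends.put hj
      (Ends.right (a := a) (r := s ++ r) (l := l) (by simp [hij, hi])
      (ih (l := a :: l) (l' := f a :: l') (by simp) (by simp [hij.symm, hi])
        (fun b hb => hs b (by simp [hb])) ?_))))).mono ?_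
    · simpa [hi] using hs a (by simp)
    · convert h using 1
      funext k
      by_cases hk : k = j
      · subst hk; simp
      · by_cases hk' : k = i
        · subst hk'; simp [hk]
        · simp [hk, hk']
    · simp; omega

section blank

open scoped Classical in
/-- The test for a nonblank symbol. -/
noncomputable def nonblank (a : Γ) : Bool := decide (a ≠ default)

@[simp] lemma nonblank_eq_true : nonblank a = true ↔ a ≠ default := by simp [nonblank]

@[simp] lemma nonblank_eq_false : nonblank a = false ↔ a = default := by simp [nonblank]

/-- Go back to the first nonblank symbol of the tape. -/
noncomputable def rewind (i : ι) : Frag ι Γ :=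
  seq (left i) (seq (backSeg nonblank i) (right i))

/-- The contents to the left of the head must not contain blanks, since the head stops at the first
blank there. -/
lemma Ends.rewind (hi : σ i = Tape.mk₂ l r) (hl : ∀ a ∈ l, a ≠ default)
    (h : Q (Function.update σ i (Tape.mk₂ [] (l.reverse ++ r)))) {t : ℕ}
    (ht : 3 * l.length + 7 ≤ t) : (rewind i).Ends σ t Q A := by
  have key : ∀ r : List Γ, Tape.mk₂ [default] r = Tape.mk₂ [] r := fun r => mk₂_left_blank (l := [])
  refine Ends.mono ?_ ht
  rcases l with _ | ⟨a, l⟩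
  · refine (Ends.seq (Ends.left_nil hi (Ends.seq (t := 0) (t' := 1)
      (Ends.loop_false (by rw [on_heads]; simp)
      (Ends.right (a := default) (l := []) (r := r) (by rw [Function.update_self]) ?_))))).mono
      (by simp)
    simpa [key] using h
  · refine (Ends.seq (Ends.left hi (Ends.seq (t := 3 * l.length + 3) (t' := 1)
      (Ends.backSeg (l := []) (s := l.reverse) (a := default) (b := a) (r := r) ?_ ?_ ?_ ?_
        (Ends.right (a := default) (l := []) (r := l.reverse ++ a :: r) (by simp) ?_)
        (by simp))))).mono (by simp; omega)
    · simp [mk₂_left_blank]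
    · intro b hb; simpa using hl b (by simp_all)
    · simpa using hl a (by simp)
    · simp
    · simpa [key] using h

/-- Append the contents of tape `i` to tape `j`, with a change of the symbols. -/
noncomputable def copy (i j : ι) (f : Γ → Γ) : Frag ι Γ := seq (copySeg nonblank i j f) (rewind i)

lemma Ends.copy {f : Γ → Γ} (hij : i ≠ j) (hi : σ i = Tape.mk₂ [] r) (hj : σ j = Tape.mk₂ l [])
    (hr : ∀ a ∈ r, a ≠ default)
    (h : Q (Function.update σ j (Tape.mk₂ ((r.map f).reverse ++ l) []))) {t : ℕ}
    (ht : 8 * r.length + 8 ≤ t) : (copy i j f).Ends σ t Q A := by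
  refine Ends.mono ?_ ht
  refine (Ends.seq (t := 5 * r.length) (t' := 3 * r.length + 7)
    (Ends.copySeg (l := []) (r := []) hij (by simpa using hi) hj (by simpa using hr) (by simp)
    (Ends.rewind (l := r.reverse) (r := []) (by simp [hij]) (by simpa using hr) ?_ (by simp))
    le_rfl)).mono (by omega)
  convert h using 1
  funext k
  by_cases hk : k = i
  · subst hk; simp [hij, hi]
  · by_cases hk' : k = j
    · subst hk'; simp [hk]
    · simp [hk, hk']

end blank

end Frag

/-! ### Binary numbers -/

namespace DFAInt

@[simp] lemma length_bits (w n : ℕ) : (bits w n).length = w := by simp [bits]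

lemma bits_succ (w n : ℕ) : bits (w + 1) n = n.testBit 0 :: bits w (n / 2) := by
  simp [bits, List.range_succ_eq_map, Nat.testBit_succ]

@[simp] lemma bits_zero_left (n : ℕ) : bits 0 n = [] := rfl

lemma testBit_zero_add_two_mul (x : Bool) (n : ℕ) : (x.toNat + 2 * n).testBit 0 = x := by
  cases x <;> simp [Nat.testBit_zero]

lemma add_two_mul_div_two (x : Bool) (n : ℕ) : (x.toNat + 2 * n) / 2 = n := by
  cases x
  · simp
  · simp; omega

lemma testBit_zero_add_two_mul_div_two (n : ℕ) : (n.testBit 0).toNat + 2 * (n / 2) = n := by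
  rcases Nat.mod_two_eq_zero_or_one n with h | h <;> simp [Nat.testBit_zero, h] <;> omega

/-- Every bit string is the binary representation of a number. -/
lemma exists_bits_eq (v : List Bool) : ∃ n < 2 ^ v.length, v = bits v.length n := by
  induction v with
  | nil => exact ⟨0, by simp, rfl⟩
  | cons x v ih =>
    obtain ⟨n, hn, hv⟩ := ih
    refine ⟨x.toNat + 2 * n, ?_, ?_⟩
    · have : x.toNat < 2 := Bool.toNat_lt x
      rw [List.length_cons, pow_succ]
      omega
    · rw [List.length_cons, bits_succ, testBit_zero_add_two_mul, add_two_mul_div_two, ← hv]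

lemma bits_injOn {w a b : ℕ} (ha : a < 2 ^ w) (hb : b < 2 ^ w) (h : bits w a = bits w b) :
    a = b := by
  induction w generalizing a b with
  | zero => simp at ha hb; omega
  | succ w ih =>
    rw [bits_succ, bits_succ, List.cons.injEq] at h
    have := ih (a := a / 2) (b := b / 2) (by rw [pow_succ] at ha; omega)
      (by rw [pow_succ] at hb; omega) h.2
    rw [← testBit_zero_add_two_mul_div_two a, ← testBit_zero_add_two_mul_div_two b, h.1, this]

/-- Adding one in binary: a block of ones is turned into zeros, and the zero after it, if it
exists, is turned into a one. -/
lemma bits_carry {w q : ℕ} (hq : q < 2 ^ w) : ∃ j rest, bits w q = List.replicate j true ++ rest ∧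
    ((rest = [] ∧ j = w ∧ q + 1 = 2 ^ w) ∨ ∃ rest', rest = false :: rest' ∧ q + 1 < 2 ^ w ∧
      bits w (q + 1) = List.replicate j false ++ true :: rest') := by
  induction w generalizing q with
  | zero => exact ⟨0, [], rfl, .inl ⟨rfl, rfl, by simp at hq; simp [hq]⟩⟩
  | succ w ih =>
    rw [pow_succ] at *
    rcases Nat.mod_two_eq_zero_or_one q with h | h
    · refine ⟨0, bits (w + 1) q, rfl, .inr ⟨bits w (q / 2), ?_, by omega, ?_⟩⟩
      · simp [bits_succ, Nat.testBit_zero, h]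
      · rw [bits_succ, Nat.testBit_zero, show (q + 1) / 2 = q / 2 by omega]
        simp [show (q + 1) % 2 = 1 by omega]
    · obtain ⟨j, rest, h1, h2⟩ := ih (q := q / 2) (by omega)
      refine ⟨j + 1, rest, ?_, ?_⟩
      · simp [bits_succ, Nat.testBit_zero, h, h1, List.replicate_succ]
      · rcases h2 with ⟨h2, h3, h4⟩ | ⟨rest', h2, h3, h4⟩
        · exact .inl ⟨h2, by omega, by omega⟩
        · refine .inr ⟨rest', h2, by omega, ?_⟩
          rw [bits_succ, Nat.testBit_zero, show (q + 1) / 2 = q / 2 + 1 by omega, h4]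
          simp [show (q + 1) % 2 = 0 by omega, List.replicate_succ]

lemma size_of_two_pow_le {w q : ℕ} (h1 : 2 ^ w ≤ q) (h2 : q < 2 ^ (w + 1)) : q.size = w + 1 :=
  le_antisymm (Nat.size_le.2 h2) (Nat.lt_size.2 h1)

lemma bits_two_pow (w : ℕ) : bits (w + 1) (2 ^ w) = List.replicate w false ++ [true] := by
  induction w with
  | zero => rfl
  | succ w ih =>
    rw [bits_succ, pow_succ, Nat.mul_div_cancel _ (by norm_num), ih]
    simp [Nat.testBit_zero, List.replicate_succ]

/-- Adding one in binary, without leading zeros. -/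
lemma bits_size_carry (q : ℕ) : ∃ j rest, bits q.size q = List.replicate j true ++ rest ∧
    rest.head? ≠ some true ∧
    bits (q + 1).size (q + 1) = List.replicate j false ++ true :: rest.tail := by
  obtain ⟨j, rest, h1, h2⟩ := bits_carry (Nat.lt_size_self q)
  refine ⟨j, rest, h1, ?_⟩
  rcases h2 with ⟨rfl, rfl, h2⟩ | ⟨rest', rfl, h2, h3⟩
  · rw [h2, size_of_two_pow_le le_rfl (Nat.pow_lt_pow_right one_lt_two (Nat.lt_succ_self _)),
      bits_two_pow]
    simp
  · have : (q + 1).size = q.size :=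
      le_antisymm (Nat.size_le.2 h2) (Nat.size_le_size (Nat.le_succ q))
    rw [this, h3]
    simp

/-- The comparison `v ≤ u` of two binary numbers of the same length, lowest digit first; `le` is the
result for the digits before. -/
def leFold : Bool → List Bool → List Bool → Bool
  | le, x :: v, y :: u => leFold (if x = y then le else y) v u
  | le, _, _ => le

lemma leFold_bits (le : Bool) (w a b : ℕ) (ha : a < 2 ^ w) (hb : b < 2 ^ w) :
    leFold le (bits w a) (bits w b) = true ↔ a < b ∨ a = b ∧ le = true := by
  induction w generalizing a b le with
  | zero =>
    simp at ha hb
    simp [leFold, ha, hb]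
  | succ w ih =>
    rw [pow_succ] at ha hb
    rw [bits_succ, bits_succ, leFold, ih _ _ _ (by omega) (by omega), Nat.testBit_zero,
      Nat.testBit_zero]
    rcases Nat.mod_two_eq_zero_or_one a with h | h <;>
      rcases Nat.mod_two_eq_zero_or_one b with h' | h' <;> cases le <;> simp [h, h'] <;> omega

lemma bits_add (v w a b : ℕ) (ha : a < 2 ^ v) : bits (v + w) (a + 2 ^ v * b) =
    bits v a ++ bits w b := by
  induction v generalizing a with
  | zero => simp at ha; simp [ha]
  | succ v ih =>
    have h : (a + 2 ^ (v + 1) * b) / 2 = a / 2 + 2 ^ v * b := by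
      rw [pow_succ, show a + 2 ^ v * 2 * b = a + 2 * (2 ^ v * b) by ring]; omega
    have h' : (a + 2 ^ (v + 1) * b) % 2 = a % 2 := by
      rw [pow_succ, show a + 2 ^ v * 2 * b = a + 2 * (2 ^ v * b) by ring]; omega
    rw [show v + 1 + w = v + w + 1 by omega, bits_succ, bits_succ, h,
        ih _ (by rw [pow_succ] at ha; omega),
      Nat.testBit_zero, Nat.testBit_zero, h']
    rfl

/-! ### Formats that determine where a word ends -/

lemma unary_append_inj {n n' : ℕ} {r r' : List Bool} (h : unary n ++ r = unary n' ++ r') :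
    n = n' ∧ r = r' := by
  induction n generalizing n' with
  | zero => cases n' <;> simp_all [unary, List.replicate_succ]
  | succ n ih =>
    cases n' with
    | zero => simp [unary, List.replicate_succ] at h
    | succ n' =>
      have := ih (n' := n') (by simpa [unary, List.replicate_succ] using h)
      exact ⟨by omega, this.2⟩

/-- A bit string starts with a number in unary unless it consists of ones. -/
lemma unary_or_replicate (r : List Bool) :
    (∃ n r', r = unary n ++ r') ∨ r = List.replicate r.length true := by
  induction r with
  | nil => exact .inr rfl
  | cons x r ih =>
    cases x
    · exact .inl ⟨0, r, rfl⟩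
    · rcases ih with ⟨n, r', h⟩ | h
      · exact .inl ⟨n + 1, r', by rw [h]; simp [unary, List.replicate_succ]⟩
      · refine .inr ?_
        rw [List.length_cons, List.replicate_succ, ← h]

lemma replicate_ne_unary (k n : ℕ) (r : List Bool) : List.replicate k true ≠ unary n ++ r := by
  intro h
  have : false ∈ List.replicate k true := h ▸ by simp [unary]
  simp at this

end DFAInt

/-! ### Tapes and symbols of the reduction -/

namespace Red

/-- The tape alphabet of the reduction: a blank, the two bits, a mark for the beginning of the row
of a transition table that also tells whether the state is accepting, and a mark for the end of an
entry of a transition table. -/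
inductive Cell
  | blank | b (x : Bool) | row (x : Bool) | sep
  deriving DecidableEq

instance : Inhabited Cell := ⟨.blank⟩

instance : Finite Cell :=
  Finite.of_surjective (Sum.elim (Sum.elim .b .row) ![.blank, .sep] : (Bool ⊕ Bool) ⊕ Fin 2 → Cell)
    fun c => match c with
      | .blank => ⟨.inr 0, rfl⟩
      | .sep => ⟨.inr 1, rfl⟩
      | .b x => ⟨.inl (.inl x), rfl⟩
      | .row x => ⟨.inl (.inr x), rfl⟩

lemma Cell.default_eq : (default : Cell) = .blank := rfl

/-- The tapes that are common to all automata: input, size of the alphabet in unary, a flag, and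
output. -/
inductive Com
  | inp | mt | fl | out
  deriving DecidableEq

/-- The tapes that belong to one of the automata: the number `s` of states in unary, `s - 1` in
binary, the initial state, the accepting bits, and the transition table. -/
inductive Loc
  | U | B | St | Ac | Tb
  deriving DecidableEq

/-- The index set of the tapes; `I` is the index set of the automata. -/
abbrev Tp (I : Type) := Com ⊕ (I × Loc)

open Cell Com Loc Frag Turing

instance : Finite Com := Finite.of_surjective ![inp, mt, fl, out] fun c => match c with
  | .inp => ⟨0, rfl⟩
  | .mt => ⟨1, rfl⟩
  | .fl => ⟨2, rfl⟩
  | .out => ⟨3, rfl⟩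

instance : Finite Loc := Finite.of_surjective ![U, B, St, Ac, Tb] fun c => match c with
  | .U => ⟨0, rfl⟩
  | .B => ⟨1, rfl⟩
  | .St => ⟨2, rfl⟩
  | .Ac => ⟨3, rfl⟩
  | .Tb => ⟨4, rfl⟩

/-! ### Reading numbers -/

section basic

variable {ι : Type} [DecidableEq ι] {σ : ι → Tape Cell} {i j : ι}
  {Q : (ι → Tape Cell) → Prop} {A : Prop} {l l' r r' : List Cell} {t : ℕ}

/-- The symbol is the bit `x`. -/
def isBit (x : Bool) (a : Cell) : Bool := decide (a = b x)

@[simp] lemma isBit_b (x y : Bool) : isBit x (b y) = decide (y = x) := by simp [isBit]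

@[simp] lemma isBit_default (x : Bool) : isBit x default = false := by
  simp [isBit, Cell.default_eq]

@[simp] lemma isBit_blank (x : Bool) : isBit x blank = false := by simp [isBit]

@[simp] lemma b_ne_default (x : Bool) : b x ≠ default := by simp [Cell.default_eq]

@[simp] lemma row_ne_default (x : Bool) : row x ≠ default := by simp [Cell.default_eq]

@[simp] lemma sep_ne_default : sep ≠ default := by simp [Cell.default_eq]

lemma ne_default_of_mem_map_b {v : List Bool} {a : Cell} (h : a ∈ v.map b) : a ≠ default := by
  obtain ⟨x, -, rfl⟩ := List.mem_map.1 h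
  simp

/-- Read a number in unary. -/
def readUnary (i j : ι) : Frag ι Cell :=
  seq (copySeg (isBit true) i j id) (ite (on i (isBit false)) (right i) abort)

/-- The fragment aborts exactly if the remaining input `x` does not begin with a number in unary.
The lemmas on the other reading programs have the same form: `h` is about all ways to split off a
part of the remaining input that has the expected format, and `hA` about the case that there is
none. -/
lemma Ends.readUnary {x : List Bool} (hij : i ≠ j) (hi : σ i = Tape.mk₂ l (x.map b))
    (hj : σ j = Tape.mk₂ [] [])
    (h : ∀ n r', x = DFAInt.unary n ++ r' → ∀ l', Q (Function.update (Function.update σ i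
      (Tape.mk₂ l' (r'.map b))) j (Tape.mk₂ (List.replicate n (b true)) [])))
    (hA : (∀ n r', x ≠ DFAInt.unary n ++ r') → A) (ht : 5 * x.length + 3 ≤ t) :
    (readUnary i j).Ends σ t Q A := by
  rcases DFAInt.unary_or_replicate x with ⟨n, r', hx⟩ | hx
  · refine (Ends.seq (t' := 2) (Ends.copySeg (l := l) (l' := []) (s := List.replicate n (b true))
      (r := b false :: r'.map b) hij ?_ hj (by simp) (by simp)
      (Ends.ite (fun _ => Ends.right (a := b false) (l := List.replicate n (b true) ++ l)
        (r := r'.map b) ?_ ?_) (fun hc => ?_)) le_rfl)).mono ?_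
    · simp [hi, hx, DFAInt.unary]
    · simp [hij]
    · convert h n r' hx (b false :: (List.replicate n (b true) ++ l)) using 1
      funext k
      by_cases hk : k = i
      · subst hk; simp [hij]
      · by_cases hk' : k = j
        · subst hk'; simp [hk]
        · simp [hk, hk']
    · simp [hij] at hc
    · simp [hx, DFAInt.unary] at ht ⊢
      omega
  · refine (Ends.seq (t' := 2) (Ends.copySeg (l := l) (l' := []) (s := x.map b)
      (r := []) hij (by simp [hi]) hj ?_ (by simp)
      (Ends.ite (fun hc => ?_) (fun _ => Ends.abort (hA ?_))) le_rfl)).mono ?_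
    · intro a ha
      rw [hx] at ha
      simp at ha
      simp [ha]
    · simp [hij] at hc
    · intro n r' h
      exact DFAInt.replicate_ne_unary _ n r' (hx.symm.trans h)
    · simp; omega

/-- Turn the block of ones at the head into zeros. -/
def carry (i : ι) : Frag ι Cell := loop (on i (isBit true)) (put i fun _ => b false)

lemma Ends.carry {n : ℕ} (hi : σ i = Tape.mk₂ l (List.replicate n (b true) ++ r))
    (hr : isBit true (r.head?.getD default) = false)
    (h : Q (Function.update σ i (Tape.mk₂ (List.replicate n (b false) ++ l) r)))
    (ht : 3 * n ≤ t) : (carry i).Ends σ t Q A := by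
  refine Ends.mono ?_ ht
  clear ht
  induction n generalizing σ l with
  | zero =>
    refine Ends.loop_false ?_ ?_
    · cases r with
      | nil => simp [hi]
      | cons a r => simpa [hi] using hr
    · simpa [← show σ i = Tape.mk₂ l r from hi] using h
  | succ n ih =>
    refine (Ends.loop_true (t' := 3 * n) (by simp [hi, List.replicate_succ]) (Ends.put hi
      (ih (l := b false :: l) (by simp [List.replicate_succ]) ?_))).mono (by omega)
    simpa [List.replicate_succ'] using h

/-- Write a one and go back to the lowest digit. -/
noncomputable def bump (i : ι) : Frag ι Cell := seq (write i fun _ => b true) (rewind i)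

lemma Ends.bump (hi : σ i = Tape.mk₂ l r) (hl : ∀ a ∈ l, a ≠ default)
    (h : Q (Function.update σ i (Tape.mk₂ [] (l.reverse ++ b true :: r.tail))))
    (ht : 3 * l.length + 9 ≤ t) : (bump i).Ends σ t Q A := by
  refine (Ends.seq (t' := 3 * l.length + 7) (Ends.write hi
    (Ends.rewind (l := l) (r := b true :: r.tail) (by simp) hl ?_ le_rfl))).mono (by omega)
  simpa using h

/-- Count the ones on tape `i` in binary on tape `j`. -/
noncomputable def toBinary (i j : ι) : Frag ι Cell :=
  loop (on i (isBit true)) (seq (carry j) (seq (bump j) (right i)))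

lemma Ends.toBinary {n q N : ℕ} (hij : i ≠ j) (hi : σ i = Tape.mk₂ l (List.replicate n (b true)))
    (hj : σ j = Tape.mk₂ [] ((DFAInt.bits q.size q).map b))
    (h : Q (Function.update (Function.update σ i (Tape.mk₂ (List.replicate n (b true) ++ l) [])) j
      (Tape.mk₂ [] ((DFAInt.bits (q + n).size (q + n)).map b))))
    (hN : q + n ≤ N) (ht : n * (6 * N + 14) ≤ t) : (toBinary i j).Ends σ t Q A := by
  refine Ends.mono ?_ ht
  clear ht
  induction n generalizing σ l q with
  | zero =>
    refine Ends.loop_false ?_ ?_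
    · simp [hi]
    · convert h using 1
      funext k
      by_cases hk : k = j
      · subst hk; simp [hj]
      · by_cases hk' : k = i
        · subst hk'; simp [hk, hi]
        · simp [hk, hk']
  | succ n ih =>
    obtain ⟨c, rest, h1, h2, h3⟩ := DFAInt.bits_size_carry q
    have hc : c ≤ N := by
      have := congrArg List.length h1
      have h4 : q.size ≤ q := Nat.size_le.2 q.lt_two_pow_self
      simp at this
      omega
    refine (Ends.loop_true (t := 6 * N + 12) (t' := n * (6 * N + 14)) ?_ (Ends.mono
      (Ends.seq (t := 3 * N) (t' := 3 * N + 11)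
      (Ends.carry (l := []) (n := c) (r := rest.map b) ?_ ?_
      (Ends.seq (t := 3 * N + 9) (t' := 1)
      (Ends.bump (l := List.replicate c (b false)) (r := rest.map b) ?_ (by simp)
      (Ends.right (a := b true) (l := l) (r := List.replicate n (b true)) ?_
      (ih (q := q + 1) (l := b true :: l) ?_ ?_ ?_ (by omega))) (by simpa using hc))) (by omega)))
      (by omega))).mono
      (by ring_nf; omega)
    · simp [hi, List.replicate_succ]
    · simp [hj, h1]
    · rcases rest with _ | ⟨_ | _, _⟩ <;> simp at h2 ⊢
    · simp
    · simp [hij, hi, List.replicate_succ]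
    · simp
    · simp [hij.symm, h3]
    · convert h using 1
      funext k
      by_cases hk : k = j
      · subst hk; simp [show q + 1 + n = q + (n + 1) by omega]
      · by_cases hk' : k = i
        · subst hk'; rw [List.replicate_succ']; simp [hk]
        · simp [hk, hk']

end basic

section parse

variable {I : Type} [DecidableEq I] {σ : Tp I → Tape Cell} {i : I} {d : Loc}
  {Q : (Tp I → Tape Cell) → Prop} {A : Prop} {l l' r r' f : List Cell} {t N s : ℕ} {x : List Bool}

/-! ### Reading the numbers of an automaton -/

/-- The update of the flag in a comparison of binary numbers, as in `DFAInt.leFold`. -/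
def cmp (i : I) (h : Tp I → Cell) : Cell :=
  if h (.inl inp) = h (.inr (i, B)) then h (.inl fl) else h (.inr (i, B))

/-- Read one digit, append it to tape `d`, and update the flag. -/
noncomputable def readDigit (i : I) (d : Loc) : Frag (Tp I) Cell :=
  ite (on (.inl inp) nonblank)
    (seq (write (.inl fl) (cmp i)) (seq (put (.inr (i, d)) fun h => h (.inl inp))
      (seq (right (.inl inp)) (right (.inr (i, B)))))) abort

/-- Read a binary number less than `s`, where `s - 1` in binary is on tape `B`, and append its
digits to tape `d`. -/
noncomputable def readVal (i : I) (d : Loc) : Frag (Tp I) Cell :=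
  seq (write (.inl fl) fun _ => b true) (seq (loop (on (.inr (i, B)) nonblank) (readDigit i d))
    (seq (rewind (.inr (i, B))) (ite (on (.inl fl) (isBit true)) skip abort)))

/-- The flag records the comparison of the digits `v` that are read with the digits `u` on tape `B`.
-/
lemma Ends.readDigits {le : Bool} {u : List Bool} (hd : d ≠ B)
    (hin : σ (.inl inp) = Tape.mk₂ l (x.map b)) (hB : σ (.inr (i, B)) = Tape.mk₂ l' (u.map b))
    (hfl : σ (.inl fl) = Tape.mk₂ [] (b le :: f)) (hD : σ (.inr (i, d)) = Tape.mk₂ r [])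
    (h : ∀ v x', v.length = u.length → x = v ++ x' → ∀ l₁,
      Q (Function.update (Function.update (Function.update (Function.update σ
        (.inl inp) (Tape.mk₂ l₁ (x'.map b)))
        (.inr (i, B)) (Tape.mk₂ ((u.map b).reverse ++ l') []))
        (.inl fl) (Tape.mk₂ [] (b (DFAInt.leFold le v u) :: f)))
        (.inr (i, d)) (Tape.mk₂ ((v.map b).reverse ++ r) [])))
    (hA : x.length < u.length → A) :
    (loop (on (.inr (i, B)) nonblank) (readDigit i d)).Ends σ (u.length * 10) Q A := by
  induction u generalizing σ l l' r x le with
  | nil =>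
    refine Ends.loop_false (by simp [hB]) ?_
    have := h [] x rfl rfl l
    simp only [List.map_nil, List.reverse_nil, List.nil_append, DFAInt.leFold] at this
    simp only [List.map_nil] at hB
    simpa only [← hin, ← hB, ← hfl, ← hD, Function.update_eq_self] using this
  | cons y u ih =>
    refine (Ends.loop_true (t := 8) (t' := u.length * 10) (by simp [hB])
      (Ends.ite (t := 7) (fun hc => ?_) (fun hc => Ends.abort (hA ?_)))).mono
      (by simp; omega)
    · rcases x with _ | ⟨z, x⟩
      · simp [hin] at hc
      · refine Ends.seq (t := 1) (Ends.write hfl (Ends.seq (t := 1) (Ends.put (l := r) (r := [])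
          (by simp [hD]) (Ends.seq (t := 1) (Ends.right (l := l) (a := b z) (r := x.map b)
            (by simp [hin]) (Ends.right (l := l') (a := b y) (r := u.map b)
            (by simp [hB, hd.symm]) (ih (x := x) (l := b z :: l) (l' := b y :: l') (r := b z :: r)
              (le := if z = y then le else y) (by simp) (by simp) ?_ ?_ ?_ ?_)))))))
        · simp [cmp, hin, hB, hfl]
          split_ifs <;> rfl
        · simp [hin, hd]
        · intro v x' hv hx l₁
          convert h (z :: v) x' (by simp [hv]) (by simp [hx]) l₁ using 1
          funext k
          by_cases h1 : k = .inl inp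
          · subst h1; simp
          by_cases h2 : k = .inr (i, B)
          · subst h2; simp [hd.symm]
          by_cases h3 : k = .inl fl
          · subst h3; simp [DFAInt.leFold]
          by_cases h4 : k = .inr (i, d)
          · subst h4; simp
          simp [h1, h2, h3, h4]
        · intro hx
          exact hA (by simpa using hx)
    · rcases x with _ | ⟨z, x⟩
      · simp
      · simp [hin] at hc

lemma Ends.readVal (hd : d ≠ B) (hs : 1 ≤ s) (hN : s ≤ N)
    (hin : σ (.inl inp) = Tape.mk₂ l (x.map b))
    (hB : σ (.inr (i, B)) = Tape.mk₂ [] ((DFAInt.bits (s - 1).size (s - 1)).map b))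
    (hfl : σ (.inl fl) = Tape.mk₂ [] f) (hD : σ (.inr (i, d)) = Tape.mk₂ r [])
    (h : ∀ n < s, ∀ x', x = DFAInt.bits (s - 1).size n ++ x' → ∀ l₁ f₁,
      Q (Function.update (Function.update (Function.update σ
        (.inl inp) (Tape.mk₂ l₁ (x'.map b)))
        (.inl fl) (Tape.mk₂ [] f₁))
        (.inr (i, d)) (Tape.mk₂ (((DFAInt.bits (s - 1).size n).map b).reverse ++ r) [])))
    (hA : (∀ n < s, ∀ x', x ≠ DFAInt.bits (s - 1).size n ++ x') → A)
    (ht : 13 * N + 20 ≤ t) : (readVal i d).Ends σ t Q A := by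
  refine Ends.mono ?_ ht
  have hw : (s - 1).size ≤ N := (Nat.size_le.2 (s - 1).lt_two_pow_self).trans (by omega)
  refine (Ends.seq (t := 1) (t' := 13 * N + 13) (Ends.write hfl ?_)).mono (by omega)
  refine (Ends.seq (t := 10 * N) (t' := 3 * N + 12) (Ends.mono (Ends.readDigits (x := x) (l := l)
    (l' := []) (r := r) (le := true) (f := f.tail) (u := DFAInt.bits (s - 1).size (s - 1))
    hd (by simp [hin])
    (by simp [hB]) (by simp) (by simp [hD]) (fun v x' hv hx l₁ => ?_) (fun hx => hA ?_))
    (by simp; omega))).mono (by omega)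
  · obtain ⟨n, hn, hv'⟩ := DFAInt.exists_bits_eq v
    rw [DFAInt.length_bits] at hv
    rw [hv] at hv' hn
    subst hv'
    refine (Ends.seq (t := 3 * N + 7) (t' := 1) (Ends.rewind
      (l := ((DFAInt.bits (s - 1).size (s - 1)).map b).reverse) (r := []) (by simp [hd.symm])
      (fun a ha => ne_default_of_mem_map_b (List.mem_reverse.1 ha))
      (Ends.ite (t := 0) (fun hc => Ends.skip ?_) (fun hc => Ends.abort (hA ?_)))
      (by simp; omega))).mono (by omega)
    · simp only [on_heads, ne_eq, reduceCtorEq, not_false_eq_true, Function.update_of_ne,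
        Function.update_self, head_mk₂_cons, isBit_b, decide_eq_true_eq,
        DFAInt.leFold_bits _ _ _ _ hn (Nat.lt_size_self (s - 1)), and_true] at hc
      convert h n (by omega) x' hx l₁ _ using 1
      swap
      · exact b (DFAInt.leFold true (DFAInt.bits (s - 1).size n)
          (DFAInt.bits (s - 1).size (s - 1))) :: f.tail
      funext k
      by_cases h1 : k = .inl inp
      · subst h1; simp
      by_cases h2 : k = .inr (i, B)
      · subst h2; simp [hd.symm, hB]
      by_cases h3 : k = .inl fl
      · subst h3; simp
      by_cases h4 : k = .inr (i, d)
      · subst h4; simp [hd]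
      simp [h1, h2, h3, h4]
    · intro n' hn' x'' hx'
      have : n = n' := DFAInt.bits_injOn hn (hn'.trans_le (by
        have := Nat.lt_size_self (s - 1); omega))
        (List.append_inj_left (hx.symm.trans hx') (by simp))
      subst this
      simp [DFAInt.leFold_bits _ _ _ _ hn (Nat.lt_size_self (s - 1))] at hc
      omega
  · intro n hn x' hx'
    simp [hx'] at hx

/-- Read one bit for each state; the states are counted on tape `U`. -/
noncomputable def readAcc (i : I) : Frag (Tp I) Cell :=
  loop (on (.inr (i, U)) (isBit true)) (ite (on (.inl inp) nonblank)
    (seq (put (.inr (i, Ac)) fun h => h (.inl inp)) (seq (right (.inl inp)) (right (.inr (i, U)))))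
    abort)

lemma Ends.readAcc {n : ℕ} (hin : σ (.inl inp) = Tape.mk₂ l (x.map b))
    (hU : σ (.inr (i, U)) = Tape.mk₂ l' (List.replicate n (b true)))
    (hAc : σ (.inr (i, Ac)) = Tape.mk₂ r [])
    (h : ∀ v x', v.length = n → x = v ++ x' → ∀ l₁,
      Q (Function.update (Function.update (Function.update σ
        (.inl inp) (Tape.mk₂ l₁ (x'.map b)))
        (.inr (i, U)) (Tape.mk₂ (List.replicate n (b true) ++ l') []))
        (.inr (i, Ac)) (Tape.mk₂ ((v.map b).reverse ++ r) [])))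
    (hA : x.length < n → A) (ht : n * 8 ≤ t) : (readAcc i).Ends σ t Q A := by
  refine Ends.mono ?_ ht
  clear ht
  induction n generalizing σ l l' r x with
  | zero =>
    refine Ends.loop_false (by simp [hU]) ?_
    have := h [] x rfl rfl l
    simp only [List.map_nil, List.reverse_nil, List.nil_append, List.replicate_zero] at this
    simp only [List.replicate_zero] at hU
    simpa only [← hin, ← hU, ← hAc, Function.update_eq_self] using this
  | succ n ih =>
    refine (Ends.loop_true (t := 6) (t' := n * 8) (by simp [hU, List.replicate_succ])
      (Ends.ite (t := 5) (fun hc => ?_) (fun hc => Ends.abort (hA ?_)))).mono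
      (by omega)
    · rcases x with _ | ⟨z, x⟩
      · simp [hin] at hc
      · refine Ends.seq (t := 1) (Ends.put hAc (Ends.seq (t := 1)
          (Ends.right (l := l) (a := b z) (r := x.map b)
            (by simp [hin]) (Ends.right (l := l') (a := b true) (r := List.replicate n (b true))
            (by simp [hU, List.replicate_succ]) (ih (x := x) (l := b z :: l) (l' := b true :: l')
              (r := b z :: r) (by simp) (by simp) ?_ ?_ ?_)))))
        · simp [hin]
        · intro v x' hv hx l₁
          convert h (z :: v) x' (by simp [hv]) (by simp [hx]) l₁ using 1
          funext k
          by_cases h1 : k = .inl inp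
          · subst h1; simp
          by_cases h2 : k = .inr (i, U)
          · subst h2; simp [List.replicate_succ']
          by_cases h4 : k = .inr (i, Ac)
          · subst h4; simp
          simp [h1, h2, h4]
        · intro hx
          exact hA (by simpa using hx)
    · rcases x with _ | ⟨z, x⟩
      · simp
      · simp [hin] at hc

end parse

/-! ### Reading transition tables -/

/-- A row of a transition table: whether the state is accepting, and for each letter the binary
representation of the next state. -/
abbrev Row := Bool × List (List Bool)

/-- An entry of a transition table on a tape. -/
def entryCells (v : List Bool) : List Cell := v.map b ++ [sep]

/-- A row of a transition table on a tape. -/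
def rowCells (ρ : Row) : List Cell := row ρ.1 :: ρ.2.flatMap entryCells

/-- A transition table on a tape. -/
def tableCells (T : List Row) : List Cell := T.flatMap rowCells

@[simp] lemma tableCells_nil : tableCells [] = [] := rfl

@[simp] lemma tableCells_cons (ρ : Row) (T : List Row) :
    tableCells (ρ :: T) = rowCells ρ ++ tableCells T := rfl

section parse

variable {I : Type} [DecidableEq I] {σ : Tp I → Tape Cell} {i : I} {d : Loc}
  {Q : (Tp I → Tape Cell) → Prop} {A : Prop} {l l' r r' f : List Cell} {t N R s m w : ℕ}
  {x : List Bool}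

/-- Read one number for each letter; the letters are counted on the tape `mt`. -/
noncomputable def readEntries (i : I) : Frag (Tp I) Cell :=
  loop (on (.inl mt) (isBit true))
    (seq (readVal i Tb) (seq (put (.inr (i, Tb)) fun _ => sep) (right (.inl mt))))

lemma Ends.readEntries {n : ℕ} (hs : 1 ≤ s) (hN : s ≤ N) (hw : (s - 1).size = w)
    (hin : σ (.inl inp) = Tape.mk₂ l (x.map b))
    (hB : σ (.inr (i, B)) = Tape.mk₂ [] ((DFAInt.bits w (s - 1)).map b))
    (hfl : σ (.inl fl) = Tape.mk₂ [] f)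
    (hmt : σ (.inl mt) = Tape.mk₂ l' (List.replicate n (b true)))
    (hD : σ (.inr (i, Tb)) = Tape.mk₂ r [])
    (h : ∀ ns : List ℕ, ns.length = n → (∀ v ∈ ns, v < s) →
      ∀ x', x = ns.flatMap (DFAInt.bits w) ++ x' → ∀ l₁ f₁,
      Q (Function.update (Function.update (Function.update (Function.update σ
        (.inl inp) (Tape.mk₂ l₁ (x'.map b)))
        (.inl fl) (Tape.mk₂ [] f₁))
        (.inl mt) (Tape.mk₂ (List.replicate n (b true) ++ l') []))
        (.inr (i, Tb))
          (Tape.mk₂ (((ns.map (DFAInt.bits w)).flatMap entryCells).reverse ++ r) [])))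
    (hA : (∀ ns : List ℕ, ns.length = n → (∀ v ∈ ns, v < s) →
      ∀ x', x ≠ ns.flatMap (DFAInt.bits w) ++ x') → A)
    (ht : n * (13 * N + 26) ≤ t) : (readEntries i).Ends σ t Q A := by
  refine Ends.mono ?_ ht
  clear ht
  induction n generalizing σ l l' r x f with
  | zero =>
    refine Ends.loop_false (by simp [hmt]) ?_
    have := h [] rfl (by simp) x rfl l f
    simp only [List.map_nil, List.reverse_nil, List.nil_append, List.replicate_zero,
      List.flatMap_nil] at this
    simp only [List.replicate_zero] at hmt
    simpa only [← hin, ← hmt, ← hfl, ← hD, Function.update_eq_self] using this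
  | succ n ih =>
    refine (Ends.loop_true (t := 13 * N + 24) (t' := n * (13 * N + 26))
      (by simp [hmt, List.replicate_succ])
      (Ends.seq (t := 13 * N + 20) (t' := 3) (Ends.readVal (s := s) (d := Tb) (r := r) (N := N)
      (by simp) hs hN hin (hw ▸ hB) hfl hD (fun v hv x₁ hx l₁ f₁ => Ends.seq (t := 1) (t' := 1)
        (Ends.put (Function.update_self ..)
        (Ends.right (l := l') (a := b true) (r := List.replicate n (b true))
        (by simp [hmt, List.replicate_succ])
        (ih (x := x₁) (l := l₁) (f := f₁)
        (l' := b true :: l') (r := sep :: (((DFAInt.bits w v).map b).reverse ++ r))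
        ?_ ?_ ?_ ?_ ?_ ?_ ?_)))) ?_ le_rfl))).mono (by ring_nf; omega)
    · simp
    · simp [hB]
    · simp
    · simp
    · simp [hw]
    · intro ns hn hns x' hx' l₂ f₂
      convert h (v :: ns) (by simp [hn]) (by simpa [hv] using hns) x' (by simp [hx, hx', hw]) l₂ f₂
        using 1
      funext k
      by_cases h1 : k = .inl inp
      · subst h1; simp
      by_cases h2 : k = .inl fl
      · subst h2; simp
      by_cases h3 : k = .inl mt
      · subst h3; simp [List.replicate_succ']
      by_cases h4 : k = .inr (i, Tb)
      · subst h4; simp [entryCells]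
      simp [h1, h2, h3, h4]
    · intro hx'
      refine hA fun ns hn hns x' hx'' => ?_
      rcases ns with _ | ⟨v', ns⟩
      · simp at hn
      · rw [List.flatMap_cons, List.append_assoc] at hx''
        exact hx' ns (by simpa using hn) (fun u hu => hns u (by simp [hu])) x'
          (List.append_inj_right (hx.symm.trans hx'') (by simp [hw]))
    · intro hx'
      refine hA fun ns hn hns x' hx'' => ?_
      rcases ns with _ | ⟨v', ns⟩
      · simp at hn
      · rw [List.flatMap_cons, List.append_assoc, ← hw] at hx''
        exact hx' v' (hns v' (by simp)) _ hx''

/-- Read one number for each letter and go back to the first letter. -/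
noncomputable def readRow (i : I) : Frag (Tp I) Cell := seq (readEntries i) (rewind (.inl mt))

lemma Ends.readRow (hs : 1 ≤ s) (hN : s ≤ N) (hm : m ≤ N) (hw : (s - 1).size = w)
    (hin : σ (.inl inp) = Tape.mk₂ l (x.map b))
    (hB : σ (.inr (i, B)) = Tape.mk₂ [] ((DFAInt.bits w (s - 1)).map b))
    (hfl : σ (.inl fl) = Tape.mk₂ [] f)
    (hmt : σ (.inl mt) = Tape.mk₂ [] (List.replicate m (b true)))
    (hD : σ (.inr (i, Tb)) = Tape.mk₂ r [])
    (h : ∀ ns : List ℕ, ns.length = m → (∀ v ∈ ns, v < s) →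
      ∀ x', x = ns.flatMap (DFAInt.bits w) ++ x' → ∀ l₁ f₁,
      Q (Function.update (Function.update (Function.update σ
        (.inl inp) (Tape.mk₂ l₁ (x'.map b)))
        (.inl fl) (Tape.mk₂ [] f₁))
        (.inr (i, Tb))
          (Tape.mk₂ (((ns.map (DFAInt.bits w)).flatMap entryCells).reverse ++ r) [])))
    (hA : (∀ ns : List ℕ, ns.length = m → (∀ v ∈ ns, v < s) →
      ∀ x', x ≠ ns.flatMap (DFAInt.bits w) ++ x') → A)
    (ht : N * (13 * N + 26) + 3 * N + 12 ≤ t) : (readRow i).Ends σ t Q A := by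
  have hm' : m * (13 * N + 26) ≤ N * (13 * N + 26) := Nat.mul_le_mul_right _ hm
  refine (Ends.seq (t := N * (13 * N + 26)) (t' := 3 * N + 7) (Ends.readEntries (N := N) hs hN hw
    hin hB hfl hmt hD (fun ns hn hns x' hx l₁ f₁ => Ends.rewind
    (l := List.replicate m (b true)) (r := []) (by simp)
    (by simp) ?_ (by simp; omega)) hA hm')).mono (by omega)
  convert h ns hn hns x' hx l₁ f₁ using 1
  funext k
  by_cases h3 : k = .inl mt
  · subst h3; simp [hmt]
  by_cases h4 : k = .inr (i, Tb)
  · subst h4; simp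
  simp [Function.update_apply, h3, h4]

/-- The mark for the beginning of a row. -/
def toRow : Cell → Cell
  | b x => row x
  | c => c

/-- Read the transition table; the states are counted on tape `Ac`. -/
noncomputable def readRows (i : I) : Frag (Tp I) Cell :=
  loop (on (.inr (i, Ac)) nonblank) (seq (put (.inr (i, Tb)) fun h => toRow (h (.inr (i, Ac))))
    (seq (readRow i) (right (.inr (i, Ac)))))

lemma Ends.readRows {ac : List Bool} (hs : 1 ≤ s) (hN : s ≤ N) (hm : m ≤ N) (hw : (s - 1).size = w)
    (hin : σ (.inl inp) = Tape.mk₂ l (x.map b))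
    (hB : σ (.inr (i, B)) = Tape.mk₂ [] ((DFAInt.bits w (s - 1)).map b))
    (hfl : σ (.inl fl) = Tape.mk₂ [] f)
    (hmt : σ (.inl mt) = Tape.mk₂ [] (List.replicate m (b true)))
    (hAc : σ (.inr (i, Ac)) = Tape.mk₂ l' (ac.map b))
    (hD : σ (.inr (i, Tb)) = Tape.mk₂ r [])
    (h : ∀ tb : List (List ℕ), tb.length = ac.length → (∀ ρ ∈ tb, ρ.length = m ∧ ∀ v ∈ ρ, v < s) →
      ∀ x', x = tb.flatMap (List.flatMap (DFAInt.bits w)) ++ x' → ∀ l₁ f₁ l₂,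
      Q (Function.update (Function.update (Function.update (Function.update σ
        (.inl inp) (Tape.mk₂ l₁ (x'.map b)))
        (.inl fl) (Tape.mk₂ [] f₁))
        (.inr (i, Ac)) (Tape.mk₂ l₂ []))
        (.inr (i, Tb)) (Tape.mk₂
          ((tableCells (ac.zip (tb.map (List.map (DFAInt.bits w))))).reverse ++ r) [])))
    (hA : (∀ tb : List (List ℕ), tb.length = ac.length →
      (∀ ρ ∈ tb, ρ.length = m ∧ ∀ v ∈ ρ, v < s) →
      ∀ x', x ≠ tb.flatMap (List.flatMap (DFAInt.bits w)) ++ x') → A)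
    (hR : N * (13 * N + 26) + 3 * N + 12 ≤ R)
    (ht : ac.length * (R + 6) ≤ t) : (readRows i).Ends σ t Q A := by
  refine Ends.mono ?_ ht
  clear ht
  induction ac generalizing σ l l' r x f with
  | nil =>
    refine Ends.loop_false (by simp [hAc]) ?_
    have := h [] rfl (by simp) x rfl l f l'
    simp only [List.map_nil, List.zip_nil_left, List.reverse_nil, List.nil_append,
      tableCells_nil] at this
    simp only [List.map_nil] at hAc
    simpa only [← hin, ← hAc, ← hfl, ← hD, Function.update_eq_self] using this
  | cons y ac ih =>
    refine (Ends.loop_true (t := R + 4) (t' := ac.length * (R + 6))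
      (by simp [hAc])
      (Ends.mono (Ends.seq (t := 1) (t' := R + 2) (Ends.put hD
      (Ends.seq (t := R) (t' := 1) (Ends.readRow (s := s) (N := N) (x := x) (l := l) (f := f)
      (r := row y :: r) hs hN hm hw (by simp [hin]) (by simp [hB]) (by simp [hfl]) (by simp [hmt])
      (by simp [hAc, toRow]) (fun ns hn hns x₁ hx l₁ f₁ => Ends.right (l := l') (a := b y)
        (r := ac.map b) (by simp [hAc])
        (ih (x := x₁) (l := l₁) (f := f₁)
        (l' := b y :: l')
        (r := (rowCells (y, ns.map (DFAInt.bits w))).reverse ++ r)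
        ?_ ?_ ?_ ?_ ?_ ?_ ?_ ?_)) ?_ hR)))) (by omega))).mono (by simp; ring_nf; omega)
    · simp
    · simp [hB]
    · simp
    · simp [hmt]
    · simp
    · simp [rowCells]
    · intro tb hn' htb x' hx' l₂ f₂ l₃
      convert h (ns :: tb) (by simp [hn']) (by simpa [hn] using ⟨hns, htb⟩) x' (by simp [hx, hx'])
        l₂ f₂ l₃ using 1
      funext k
      by_cases h1 : k = .inl inp
      · subst h1; simp
      by_cases h2 : k = .inl fl
      · subst h2; simp
      by_cases h3 : k = .inr (i, Ac)
      · subst h3; simp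
      by_cases h4 : k = .inr (i, Tb)
      · subst h4; simp
      simp [h1, h2, h3, h4]
    · intro hx'
      refine hA fun tb hn' htb x' hx'' => ?_
      rcases tb with _ | ⟨ns', tb⟩
      · simp at hn'
      · rw [List.flatMap_cons, List.append_assoc] at hx''
        refine hx' tb (by simpa using hn') (fun u hu => htb u (by simp [hu])) x'
          (List.append_inj_right (hx.symm.trans hx'') ?_)
        have := htb ns' (by simp)
        simp [List.length_flatMap, hn, this.1]
    · intro hx'
      refine hA fun tb hn' htb x' hx'' => ?_
      rcases tb with _ | ⟨ns', tb⟩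
      · simp at hn'
      · rw [List.flatMap_cons, List.append_assoc] at hx''
        exact hx' ns' (htb ns' (by simp)).1 (htb ns' (by simp)).2 _ hx''

/-- Write the row of a padding state, whose number is on tape `B`: it is not accepting, and all
letters lead back to it. -/
noncomputable def padRow (i : I) : Frag (Tp I) Cell :=
  seq (put (.inr (i, Tb)) fun _ => row false) (seq (loop (on (.inl mt) (isBit true))
    (seq (copy (.inr (i, B)) (.inr (i, Tb)) id)
      (seq (put (.inr (i, Tb)) fun _ => sep) (right (.inl mt)))))
    (rewind (.inl mt)))

lemma Ends.padEntries {n : ℕ} {u : List Bool} (hN : u.length ≤ N)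
    (hB : σ (.inr (i, B)) = Tape.mk₂ [] (u.map b))
    (hmt : σ (.inl mt) = Tape.mk₂ l' (List.replicate n (b true)))
    (hD : σ (.inr (i, Tb)) = Tape.mk₂ r [])
    (h : Q (Function.update (Function.update σ
        (.inl mt) (Tape.mk₂ (List.replicate n (b true) ++ l') []))
        (.inr (i, Tb)) (Tape.mk₂ (((List.replicate n u).flatMap entryCells).reverse ++ r) []))) :
    (loop (on (.inl mt) (isBit true)) (seq (copy (.inr (i, B)) (.inr (i, Tb)) id)
      (seq (put (.inr (i, Tb)) fun _ => sep) (right (.inl mt))))).Ends σ (n * (8 * N + 14))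
      Q A := by
  induction n generalizing σ l' r with
  | zero =>
    refine Ends.loop_false (by simp [hmt]) ?_
    simp only [List.replicate_zero, List.flatMap_nil, List.reverse_nil, List.nil_append] at h hmt
    simpa only [← hmt, ← hD, Function.update_eq_self] using h
  | succ n ih =>
    refine (Ends.loop_true (t := 8 * N + 12) (t' := n * (8 * N + 14))
      (by simp [hmt, List.replicate_succ])
      (Ends.seq (t := 8 * N + 8) (t' := 3) (Ends.copy (r := u.map b) (by simp) hB hD
      (fun a => ne_default_of_mem_map_b) (Ends.seq (t := 1) (t' := 1)
      (Ends.put (Function.update_self ..)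
      (Ends.right (l := l') (a := b true) (r := List.replicate n (b true))
        (by simp [hmt, List.replicate_succ]) (ih (l' := b true :: l')
        (r := (entryCells u).reverse ++ r) (by simp [hB]) (by simp) (by simp [entryCells]) ?_))))
      (by simp; omega)))).mono (by ring_nf; omega)
    convert h using 1
    funext k
    by_cases h3 : k = .inl mt
    · subst h3; simp [List.replicate_succ']
    by_cases h4 : k = .inr (i, Tb)
    · subst h4; simp [List.replicate_succ]
    simp [h3, h4]

lemma Ends.padRow {u : List Bool} (hN : u.length ≤ N) (hm : m ≤ N)
    (hB : σ (.inr (i, B)) = Tape.mk₂ [] (u.map b))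
    (hmt : σ (.inl mt) = Tape.mk₂ [] (List.replicate m (b true)))
    (hD : σ (.inr (i, Tb)) = Tape.mk₂ r [])
    (h : Q (Function.update σ
        (.inr (i, Tb)) (Tape.mk₂ ((rowCells (false, List.replicate m u)).reverse ++ r) [])))
    (ht : N * (13 * N + 26) + 3 * N + 12 ≤ t) : (padRow i).Ends σ t Q A := by
  have hm' : m * (8 * N + 14) ≤ N * (13 * N + 26) := Nat.mul_le_mul hm (by omega)
  refine (Ends.seq (t := 1) (t' := N * (13 * N + 26) + 3 * N + 8) (Ends.put hD
    (Ends.mono (Ends.seq (t' := 3 * N + 7) (Ends.padEntries (N := N) (n := m) (u := u) (l' := [])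
      (r := row false :: r) hN (by simp [hB]) (by simp [hmt]) (by simp)
      (Ends.rewind (l := List.replicate m (b true)) (r := []) (by simp) (by simp) ?_
      (by simp; omega)))) (by omega)))).mono (by omega)
  convert h using 1
  funext k
  by_cases h3 : k = .inl mt
  · subst h3; simp [hmt]
  by_cases h4 : k = .inr (i, Tb)
  · subst h4; simp [rowCells]
  simp [h3, h4]

/-- The rows of the padding states `q, …, q + p - 1`. -/
def padTable (m w q p : ℕ) : List Row :=
  (List.range' q p).map fun q => (false, List.replicate m (DFAInt.bits w q))

/-- Starting with the number on tape `B`, count up to the largest number with as many digits, and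
write a row for each number. -/
noncomputable def padRows (i : I) : Frag (Tp I) Cell :=
  seq (carry (.inr (i, B))) (loop (on (.inr (i, B)) (isBit false))
    (seq (bump (.inr (i, B))) (seq (padRow i) (carry (.inr (i, B))))))

/-- The invariant of the loop in `padRows`: the number on tape `B` is `q`, and the head is behind
the `j` lowest digits of it, which were ones and have been turned into zeros. -/
lemma Ends.padLoop {p q j : ℕ} {rest : List Bool} (hN : w ≤ N) (hm : m ≤ N)
    (hq : q + 1 + p = 2 ^ w) (h1 : DFAInt.bits w q = List.replicate j true ++ rest)
    (h2 : (rest = [] ∧ j = w ∧ q + 1 = 2 ^ w) ∨ ∃ rest', rest = false :: rest' ∧ q + 1 < 2 ^ w ∧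
      DFAInt.bits w (q + 1) = List.replicate j false ++ true :: rest')
    (hB : σ (.inr (i, B)) = Tape.mk₂ (List.replicate j (b false)) (rest.map b))
    (hmt : σ (.inl mt) = Tape.mk₂ [] (List.replicate m (b true)))
    (hD : σ (.inr (i, Tb)) = Tape.mk₂ r [])
    (h : ∀ T, Q (Function.update (Function.update σ
        (.inr (i, B)) T)
        (.inr (i, Tb)) (Tape.mk₂ ((tableCells (padTable m w (q + 1) p)).reverse ++ r) [])))
    (hR : N * (13 * N + 26) + 3 * N + 12 ≤ R) :
    (loop (on (.inr (i, B)) (isBit false)) (seq (Red.bump (.inr (i, B)))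
      (seq (Red.padRow i) (Red.carry (.inr (i, B)))))).Ends σ (p * (R + 6 * N + 14)) Q A := by
  induction p generalizing σ r q j rest with
  | zero =>
    rcases h2 with ⟨rfl, -⟩ | ⟨rest', rfl, h2, -⟩
    · refine Ends.loop_false (by simp [hB]) ?_
      simpa [padTable, ← hD] using h (σ (.inr (i, B)))
    · omega
  | succ p ih =>
    rcases h2 with ⟨rfl, -, h2⟩ | ⟨rest', rfl, h2, h3⟩
    · omega
    · obtain ⟨j', rest, h4, h5⟩ := DFAInt.bits_carry h2
      have hj : j ≤ w := by
        have := congrArg List.length h1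
        simp at this; omega
      have hj' : j' ≤ w := by
        have := congrArg List.length h4
        simp at this; omega
      have h34 : List.replicate j (b false) ++ b true :: rest'.map b =
          List.replicate j' (b true) ++ rest.map b := by
        simpa using congrArg (List.map b) (h3.symm.trans h4)
      refine (Ends.loop_true (t := R + 6 * N + 12) (t' := p * (R + 6 * N + 14)) (by simp [hB])
        (Ends.mono (Ends.seq (t := 3 * N + 9) (t' := R + 3 * N + 1) (Ends.bump hB (by simp)
        (Ends.mono (Ends.seq (t := R) (t' := 3 * N) (Ends.padRow (N := N) (m := m)
          (u := DFAInt.bits w (q + 1)) (r := r)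
          (by simpa using hN) hm (by simp [h3]) (by simp [hmt]) (by simp [hD])
        (Ends.carry (l := []) (n := j') (r := rest.map b) (by simp [h34]) ?_
          (ih (r := (rowCells (false, List.replicate m (DFAInt.bits w (q + 1)))).reverse ++ r)
            (by omega) h4 h5 ?_ ?_ ?_ ?_) (by omega)) hR)) (by omega))
        (by simp; omega))) (by omega))).mono (by ring_nf; omega)
      · rcases h5 with ⟨rfl, -⟩ | ⟨rest', rfl, -⟩ <;> simp
      · simp
      · simp [hmt]
      · simp
      · intro T
        convert h T using 1
        funext k
        by_cases h3 : k = .inr (i, B)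
        · subst h3; simp
        by_cases h4 : k = .inr (i, Tb)
        · subst h4; simp [padTable, List.range'_succ]
        simp [h3, h4]

lemma Ends.padRows {p q : ℕ} (hN : w ≤ N) (hm : m ≤ N)
    (hq : q + 1 + p = 2 ^ w)
    (hB : σ (.inr (i, B)) = Tape.mk₂ [] ((DFAInt.bits w q).map b))
    (hmt : σ (.inl mt) = Tape.mk₂ [] (List.replicate m (b true)))
    (hD : σ (.inr (i, Tb)) = Tape.mk₂ r [])
    (h : ∀ T, Q (Function.update (Function.update σ
        (.inr (i, B)) T)
        (.inr (i, Tb)) (Tape.mk₂ ((tableCells (padTable m w (q + 1) p)).reverse ++ r) [])))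
    (hR : N * (13 * N + 26) + 3 * N + 12 ≤ R) (ht : 3 * N + 1 + p * (R + 6 * N + 14) ≤ t) :
    (padRows i).Ends σ t Q A := by
  obtain ⟨j, rest, h1, h2⟩ := DFAInt.bits_carry (show q < 2 ^ w by omega)
  have hj : j ≤ w := by
    have := congrArg List.length h1
    simp at this; omega
  refine (Ends.seq (t := 3 * N) (Ends.carry (l := []) (n := j) (r := rest.map b)
    (by simp [hB, h1]) ?_ (Ends.padLoop hN hm hq h1 h2 (r := r) ?_ ?_ ?_ ?_ hR) (by omega))).mono ht
  · rcases h2 with ⟨rfl, -⟩ | ⟨rest', rfl, -⟩ <;> simp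
  · simp
  · simp [hmt]
  · simp [hD]
  · intro T
    convert h T using 1
    funext k
    by_cases h3 : k = .inr (i, B)
    · subst h3; simp
    simp [Function.update_apply, h3]

end parse

/-! ### Reading an automaton -/

/-- The data of a deterministic automaton with the states `0, …, s - 1`: the initial state, for
each state whether it is accepting, and the list of the rows of the transition table. -/
structure Aut where
  /-- the number of states -/
  s : ℕ
  /-- the initial state -/
  st : ℕ
  /-- the accepting bits -/
  ac : List Bool
  /-- the transition table -/
  tb : List (List ℕ)

namespace Aut

/-- The data belong to an automaton over an alphabet with `m` letters. -/
structure Valid (m : ℕ) (a : Aut) : Prop where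
  one_le : 1 ≤ a.s
  st_lt : a.st < a.s
  length_ac : a.ac.length = a.s
  length_tb : a.tb.length = a.s
  row : ∀ ρ ∈ a.tb, ρ.length = m ∧ ∀ v ∈ ρ, v < a.s

/-- The number of binary digits of a state. -/
def w (a : Aut) : ℕ := (a.s - 1).size

/-- The bit string for an automaton. -/
def enc (a : Aut) : List Bool :=
  DFAInt.unary a.s ++ (DFAInt.bits a.w a.st ++ (a.ac ++
    a.tb.flatMap (List.flatMap (DFAInt.bits a.w))))

/-- The transition table, with additional rows for all numbers with the same number of digits that
are not states. -/
def table (m : ℕ) (a : Aut) : List Row :=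
  a.ac.zip (a.tb.map (List.map (DFAInt.bits a.w))) ++ padTable m a.w a.s (2 ^ a.w - a.s)

variable {m : ℕ} {a : Aut}

lemma le_two_pow : a.s ≤ 2 ^ a.w := by
  have := Nat.lt_size_self (a.s - 1)
  rw [w]; omega

lemma Valid.two_pow_le (h : a.Valid m) : 2 ^ a.w ≤ 2 * a.s := by
  have := h.one_le
  rw [w]
  rcases Nat.eq_zero_or_pos (a.s - 1) with h0 | h0
  · rw [h0]; simp; omega
  · have h1 : 0 < (a.s - 1).size := Nat.size_pos.2 h0
    have h2 : 2 ^ ((a.s - 1).size - 1) ≤ a.s - 1 := Nat.lt_size.1 (by omega)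
    obtain ⟨k, hk⟩ := Nat.exists_eq_add_of_le' h1
    rw [hk] at h2 ⊢
    rw [pow_succ]
    simp at h2
    omega

lemma w_le : a.w ≤ a.s := (Nat.size_le.2 (a.s - 1).lt_two_pow_self).trans (by omega)

lemma Valid.length_table (h : a.Valid m) : (a.table m).length = 2 ^ a.w := by
  have := a.le_two_pow
  simp [table, padTable, h.length_ac, h.length_tb]
  omega

lemma Valid.mem_table (h : a.Valid m) {ρ : Row} (hρ : ρ ∈ a.table m) :
    ρ.2.length = m ∧ ∀ v ∈ ρ.2, v.length = a.w := by
  rw [table, List.mem_append] at hρ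
  rcases hρ with hρ | hρ
  · have := (List.of_mem_zip (a := ρ.1) (b := ρ.2) hρ).2
    obtain ⟨ns, hns, h2⟩ := List.mem_map.1 this
    rw [← h2]
    refine ⟨by simp [(h.row ns hns).1], fun v hv => ?_⟩
    obtain ⟨n, -, rfl⟩ := List.mem_map.1 hv
    simp
  · obtain ⟨q, -, rfl⟩ := List.mem_map.1 hρ
    refine ⟨by simp, fun v hv => ?_⟩
    rw [List.eq_of_mem_replicate hv]
    simp

end Aut

lemma length_rowCells {ρ : Row} {m w : ℕ} (h : ρ.2.length = m ∧ ∀ v ∈ ρ.2, v.length = w) :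
    (rowCells ρ).length = 1 + m * (w + 1) := by
  rw [rowCells, List.length_cons, List.length_flatMap, add_comm, ← h.1]
  congr 1
  rw [List.map_congr_left (g := fun _ => w + 1) (fun v hv => by simp [entryCells, h.2 v hv])]
  simp

lemma length_tableCells {T : List Row} {m w : ℕ}
    (h : ∀ ρ ∈ T, ρ.2.length = m ∧ ∀ v ∈ ρ.2, v.length = w) :
    (tableCells T).length = T.length * (1 + m * (w + 1)) := by
  rw [tableCells, List.length_flatMap,
    List.map_congr_left (g := fun _ => 1 + m * (w + 1)) (fun ρ hρ => length_rowCells (h ρ hρ))]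
  simp

lemma ne_default_of_mem_tableCells {T : List Row} {c : Cell} (h : c ∈ tableCells T) :
    c ≠ default := by
  obtain ⟨ρ, -, h⟩ := List.mem_flatMap.1 h
  rcases List.mem_cons.1 h with rfl | h
  · simp
  · obtain ⟨v, -, h⟩ := List.mem_flatMap.1 h
    rcases List.mem_append.1 h with h | h
    · exact ne_default_of_mem_map_b h
    · simp_all

section parse

variable {I : Type} [DecidableEq I] {σ : Tp I → Tape Cell} {i : I} {d : Loc}
  {Q : (Tp I → Tape Cell) → Prop} {A : Prop} {l l' r r' f : List Cell} {t N R s m w : ℕ}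
  {x : List Bool}

/-- Read the number of states of an automaton in unary and compute `s - 1` in binary. -/
noncomputable def parseSize (i : I) : Frag (Tp I) Cell :=
  seq (readUnary (.inl inp) (.inr (i, U))) (seq (rewind (.inr (i, U)))
  (seq (ite (on (.inr (i, U)) nonblank) (right (.inr (i, U))) abort)
  (seq (toBinary (.inr (i, U)) (.inr (i, B))) (rewind (.inr (i, U))))))

lemma Ends.parseSize (hx : x.length ≤ N) (hin : σ (.inl inp) = Tape.mk₂ l (x.map b))
    (hloc : ∀ d, σ (.inr (i, d)) = Tape.mk₂ [] [])
    (h : ∀ s x', 1 ≤ s → s ≤ N → x = DFAInt.unary s ++ x' → ∀ l',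
      Q (Function.update (Function.update (Function.update σ
        (.inl inp) (Tape.mk₂ l' (x'.map b)))
        (.inr (i, U)) (Tape.mk₂ [] (List.replicate s (b true))))
        (.inr (i, B)) (Tape.mk₂ [] ((DFAInt.bits (s - 1).size (s - 1)).map b))))
    (hA : (∀ s x', 1 ≤ s → x ≠ DFAInt.unary s ++ x') → A)
    (ht : N * (6 * N + 14) + 11 * N + 25 ≤ t) : (parseSize i).Ends σ t Q A := by
  refine (Ends.seq (t := 5 * N + 3) (t' := N * (6 * N + 14) + 6 * N + 20)
    (Ends.readUnary (by simp) hin (hloc U) ?_ ?_ (by omega))).mono (by omega)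
  · intro s x' hxs l'
    have hs : s ≤ N := by
      have := congrArg List.length hxs
      simp [DFAInt.unary] at this
      omega
    refine (Ends.seq (t := 3 * N + 7) (t' := N * (6 * N + 14) + 3 * N + 11)
      (Ends.rewind (l := List.replicate s (b true)) (r := []) (by simp) (by simp) ?_
        (by simp; omega))).mono (by omega)
    refine (Ends.seq (t := 2) (t' := N * (6 * N + 14) + 3 * N + 8) (Ends.ite (t := 1) (fun hc => ?_)
      fun hc => Ends.abort (hA ?_))).mono (by omega)
    · rcases s with _ | s
      · simp at hc
      refine Ends.right (a := b true) (l := []) (r := List.replicate s (b true))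
        (by rw [Function.update_self, List.reverse_replicate, List.append_nil,
          List.replicate_succ]) ?_
      refine (Ends.seq (t := N * (6 * N + 14)) (t' := 3 * N + 7)
        (Ends.toBinary (q := 0) (n := s) (N := N) (l := [b true]) (by simp) (by simp)
        (by simp [hloc]) ?_ (by omega) (Nat.mul_le_mul_right _ (by omega)))).mono (by omega)
      refine Ends.rewind (l := List.replicate s (b true) ++ [b true]) (r := []) (by simp)
        (fun c hc => by
          simp only [List.mem_append, List.mem_replicate, List.mem_singleton] at hc
          rcases hc with ⟨-, rfl⟩ | rfl <;> simp) ?_ (by simp; omega)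
      convert h (s + 1) x' (by omega) hs hxs l' using 1
      funext k
      by_cases h1 : k = .inl inp
      · subst h1; simp
      by_cases h2 : k = .inr (i, U)
      · subst h2; simp [List.replicate_succ]
      by_cases h3 : k = .inr (i, B)
      · subst h3; simp
      simp [h1, h2, h3]
    · intro s' x'' hs' hx''
      have := (DFAInt.unary_append_inj (hxs.symm.trans hx'')).1
      subst this
      obtain ⟨s, rfl⟩ := Nat.exists_eq_add_of_le' hs'
      rw [on_heads, Function.update_self, List.reverse_replicate, List.append_nil,
        List.replicate_succ] at hc
      simp at hc
  · exact fun h' => hA fun s x' _ => h' s x'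

/-- Read an automaton. -/
noncomputable def parseAut (i : I) : Frag (Tp I) Cell :=
  seq (parseSize i) (seq (readVal i St) (seq (rewind (.inr (i, St))) (seq (readAcc i)
  (seq (rewind (.inr (i, Ac))) (seq (readRows i) (seq (padRows i) (rewind (.inr (i, Tb)))))))))

lemma Ends.parseAut (hx : x.length ≤ N) (hm : m ≤ N)
    (hin : σ (.inl inp) = Tape.mk₂ l (x.map b))
    (hfl : σ (.inl fl) = Tape.mk₂ [] f)
    (hmt : σ (.inl mt) = Tape.mk₂ [] (List.replicate m (b true)))
    (hloc : ∀ d, σ (.inr (i, d)) = Tape.mk₂ [] [])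
    (h : ∀ a : Aut, a.Valid m → ∀ x', x = a.enc ++ x' → ∀ σ' l₁ f₁,
      σ' (.inl inp) = Tape.mk₂ l₁ (x'.map b) → σ' (.inl fl) = Tape.mk₂ [] f₁ →
      σ' (.inr (i, St)) = Tape.mk₂ [] ((DFAInt.bits a.w a.st).map b) →
      σ' (.inr (i, Tb)) = Tape.mk₂ [] (tableCells (a.table m)) →
      (∀ k, k ≠ .inl inp → k ≠ .inl fl → (∀ d, k ≠ .inr (i, d)) → σ' k = σ k) → Q σ')
    (hA : (∀ a : Aut, a.Valid m → ∀ x', x ≠ a.enc ++ x') → A)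
    (ht : 200 * (N + 1) ^ 3 ≤ t) : (parseAut i).Ends σ t Q A := by
  obtain ⟨R, hR⟩ : ∃ R, R = N * (13 * N + 26) + 3 * N + 12 := ⟨_, rfl⟩
  obtain ⟨C, hC⟩ : ∃ C, C = 2 * N * (1 + N * (N + 1)) := ⟨_, rfl⟩
  obtain ⟨S, hS⟩ : ∃ S, S = N * (6 * N + 14) + 11 * N + 25 := ⟨_, rfl⟩
  obtain ⟨T1, hT1⟩ : ∃ T, T = N * (R + 6) := ⟨_, rfl⟩
  obtain ⟨T2, hT2⟩ : ∃ T, T = N * (R + 6 * N + 14) := ⟨_, rfl⟩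
  have htot : S + (13 * N + 20) + (3 * N + 7) + N * 8 + (3 * N + 7) + T1 +
      (3 * N + 1 + T2) + (3 * C + 7) + 7 ≤ t := by
    refine le_trans ?_ ht
    rw [hS, hT1, hT2, hC, hR]
    ring_nf
    nlinarith [sq_nonneg N, Nat.zero_le (N ^ 3)]
  refine (Ends.seq (t := S) (t' := 13 * N + 20 + (3 * N + 7) + N * 8 + (3 * N + 7) + T1 +
    (3 * N + 1 + T2) + (3 * C + 7) + 6) (Ends.parseSize hx hin hloc ?_ ?_ (by omega))).mono
    (by omega)
  swap
  · exact fun h' => hA fun a ha x' hx' => h' a.s _ ha.one_le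
      (by rw [hx', Aut.enc, List.append_assoc])
  intro s x₁ hs hsN hx₁ l₁
  have hwN : (s - 1).size ≤ N := (Nat.size_le.2 (s - 1).lt_two_pow_self).trans (by omega)
  refine (Ends.seq (t := 13 * N + 20) (t' := (3 * N + 7) + N * 8 + (3 * N + 7) + T1 +
    (3 * N + 1 + T2) + (3 * C + 7) + 5) (Ends.readVal (s := s) (N := N) (x := x₁) (l := l₁) (f := f)
    (r := []) (by simp) hs hsN (by simp) (by simp) (by simp [hfl]) (by simp [hloc]) ?_ ?_
    le_rfl)).mono (by omega)
  swap
  · refine fun h' => hA fun a ha x' hx' => ?_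
    rw [Aut.enc, List.append_assoc] at hx'
    obtain ⟨rfl, h2⟩ := DFAInt.unary_append_inj (hx₁.symm.trans hx')
    exact h' a.st ha.st_lt _ (by rw [h2, List.append_assoc]; rfl)
  intro st hst x₂ hx₂ l₂ f₂
  refine (Ends.seq (t := 3 * N + 7) (t' := N * 8 + (3 * N + 7) + T1 +
    (3 * N + 1 + T2) + (3 * C + 7) + 4) (Ends.rewind
    (l := ((DFAInt.bits (s - 1).size st).map b).reverse) (r := []) (by simp)
    (fun c hc => ne_default_of_mem_map_b (List.mem_reverse.1 hc)) ?_ (by simp; omega))).mono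
    (by omega)
  refine (Ends.seq (t := N * 8) (t' := (3 * N + 7) + T1 +
    (3 * N + 1 + T2) + (3 * C + 7) + 3) (Ends.readAcc (x := x₂) (l := l₂) (l' := [])
    (r := []) (n := s) (by simp) (by simp) (by simp [hloc]) ?_ ?_
    (by omega))).mono (by omega)
  swap
  · refine fun h' => hA fun a ha x' hx' => ?_
    rw [Aut.enc, List.append_assoc] at hx'
    obtain ⟨rfl, h2⟩ := DFAInt.unary_append_inj (hx₁.symm.trans hx')
    rw [hx₂, List.append_assoc] at h2
    have h3 := List.append_inj_right h2 (by simp [Aut.w])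
    rw [h3] at h'
    simp [ha.length_ac] at h'
  intro ac x₃ hac hx₃ l₃
  refine (Ends.seq (t := 3 * N + 7) (t' := T1 +
    (3 * N + 1 + T2) + (3 * C + 7) + 2) (Ends.rewind
    (l := (ac.map b).reverse) (r := []) (by simp)
    (fun c hc => ne_default_of_mem_map_b (List.mem_reverse.1 hc)) ?_ (by simp; omega))).mono
    (by omega)
  refine (Ends.seq (t := T1) (t' := (3 * N + 1 + T2) + (3 * C + 7) + 1) (Ends.readRows
    (x := x₃) (l := l₃) (s := s) (N := N) (R := R) (m := m) (f := f₂) (l' := []) (ac := ac)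
    (r := []) hs hsN hm rfl (by simp)
    (by simp) (by simp) (by simp [hmt]) (by simp) (by simp [hloc]) ?_ ?_ (by omega)
    (by rw [hT1]; exact Nat.mul_le_mul_right _ (by omega)))).mono (by omega)
  swap
  · refine fun h' => hA fun a ha x' hx' => ?_
    rw [Aut.enc, List.append_assoc] at hx'
    obtain ⟨rfl, h2⟩ := DFAInt.unary_append_inj (hx₁.symm.trans hx')
    rw [hx₂, List.append_assoc] at h2
    have h3 := List.append_inj_right h2 (by simp [Aut.w])
    rw [hx₃, List.append_assoc] at h3
    have h4 := List.append_inj_right h3 (by simp [hac, ha.length_ac])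
    exact h' a.tb (by rw [ha.length_tb, hac]) ha.row x' h4
  intro tb htb hrow x₄ hx₄ l₄ f₄ l₅
  have ha : Aut.Valid m ⟨s, st, ac, tb⟩ := ⟨hs, hst, hac, htb.trans hac, hrow⟩
  have h1 := Aut.le_two_pow (a := ⟨s, st, ac, tb⟩)
  have h2 := ha.two_pow_le
  simp only [Aut.w] at h1 h2
  have hlen : (tableCells (Aut.table m ⟨s, st, ac, tb⟩)).length ≤ C := by
    rw [length_tableCells (fun ρ hρ => ha.mem_table hρ), ha.length_table, hC]
    refine Nat.mul_le_mul ?_ ?_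
    · simp only [Aut.w]; omega
    · have := Nat.mul_le_mul hm (show (s - 1).size + 1 ≤ N + 1 by omega)
      simp only [Aut.w]; omega
  have hcells : Aut.table m ⟨s, st, ac, tb⟩ = ac.zip (tb.map (List.map
    (DFAInt.bits (s - 1).size))) ++ padTable m (s - 1).size s (2 ^ (s - 1).size - s) := rfl
  refine (Ends.seq (t := 3 * N + 1 + T2) (t' := 3 * C + 7) (Ends.padRows (q := s - 1)
    (p := 2 ^ (s - 1).size - s) (w := (s - 1).size) (m := m) (R := R) (N := N)
    (r := (tableCells (ac.zip (tb.map (List.map (DFAInt.bits (s - 1).size))))).reverse)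
    hwN hm (by omega) (by simp) (by simp [hmt]) (by simp) ?_
    (by omega) (by rw [hT2]; gcongr; omega))).mono (by omega)
  intro T
  refine Ends.rewind (l := (tableCells (Aut.table m ⟨s, st, ac, tb⟩)).reverse) (r := []) ?_
    (fun c hc => ne_default_of_mem_tableCells (List.mem_reverse.1 hc)) ?_
    (by rw [List.length_reverse]; omega)
  · rw [Function.update_self, hcells, Nat.sub_add_cancel hs]
    simp [tableCells]
  refine h ⟨s, st, ac, tb⟩ ha x₄ ?_ _ l₄ f₄ ?_ ?_ ?_ ?_ ?_
  · simp [Aut.enc, Aut.w, hx₁, hx₂, hx₃, hx₄]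
  · simp
  · simp
  · simp [Aut.w]
  · simp
  · intro k h1 h2 h3
    simp [h1, h2, h3]

end parse

/-! ### Reading an instance -/

/-- The encoding of automata is prefix-free: where it ends is determined by the number of states. -/
lemma Aut.enc_append_inj {m : ℕ} {a a' : Aut} (ha : a.Valid m) (ha' : a'.Valid m)
    {r r' : List Bool} (h : a.enc ++ r = a'.enc ++ r') : r = r' := by
  rw [enc, enc, List.append_assoc, List.append_assoc (DFAInt.unary a'.s)] at h
  obtain ⟨h1, h2⟩ := DFAInt.unary_append_inj h
  refine List.append_inj_right h2 ?_
  have key : ∀ a : Aut, a.Valid m →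
      (a.tb.flatMap (List.flatMap (DFAInt.bits a.w))).length = a.s * (m * a.w) := by
    intro a ha
    rw [List.length_flatMap, List.map_congr_left (g := fun _ => m * a.w)
      (fun ρ hρ => by simp [List.length_flatMap, (ha.row ρ hρ).1])]
    simp [ha.length_tb]
  simp only [List.length_append, DFAInt.length_bits]
  rw [key a ha, key a' ha', ha.length_ac, ha'.length_ac, Aut.w, Aut.w, h1]

section parse

variable {I : Type} [DecidableEq I] {σ : Tp I → Tape Cell} {i : I} {d : Loc}
  {Q : (Tp I → Tape Cell) → Prop} {A : Prop} {l l' r r' f : List Cell} {t N m : ℕ}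
  {x : List Bool} {is : List I}

lemma Ends.parseAuts (his : is.Nodup) (hx : x.length ≤ N) (hm : m ≤ N)
    (hin : σ (.inl inp) = Tape.mk₂ l (x.map b))
    (hfl : σ (.inl fl) = Tape.mk₂ [] f)
    (hmt : σ (.inl mt) = Tape.mk₂ [] (List.replicate m (b true)))
    (hloc : ∀ i ∈ is, ∀ d, σ (.inr (i, d)) = Tape.mk₂ [] [])
    (h : ∀ a : I → Aut, (∀ i ∈ is, (a i).Valid m) →
      ∀ x', x = is.flatMap (fun i => (a i).enc) ++ x' → ∀ σ' l₁,
      σ' (.inl inp) = Tape.mk₂ l₁ (x'.map b) →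
      (∀ i ∈ is, σ' (.inr (i, St)) = Tape.mk₂ [] ((DFAInt.bits (a i).w (a i).st).map b)) →
      (∀ i ∈ is, σ' (.inr (i, Tb)) = Tape.mk₂ [] (tableCells ((a i).table m))) →
      (∀ k, k ≠ .inl inp → k ≠ .inl fl → (∀ i ∈ is, ∀ d, k ≠ .inr (i, d)) → σ' k = σ k) → Q σ')
    (hA : (∀ a : I → Aut, (∀ i ∈ is, (a i).Valid m) →
      ∀ x', x ≠ is.flatMap (fun i => (a i).enc) ++ x') → A)
    (ht : is.length * (200 * (N + 1) ^ 3 + 1) ≤ t) : (forEach Red.parseAut is).Ends σ t Q A := by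
  refine Ends.mono ?_ ht
  clear ht
  induction is generalizing σ l x f with
  | nil => exact Ends.skip (h (fun _ => ⟨0, 0, [], []⟩) (by simp) x rfl σ l hin (by simp) (by simp)
      fun _ _ _ _ => rfl)
  | cons i is ih =>
    rw [List.nodup_cons] at his
    refine (Ends.forEach_cons (t := 200 * (N + 1) ^ 3) (t' := is.length * (200 * (N + 1) ^ 3 + 1))
      (Ends.parseAut hx hm hin hfl hmt (hloc i (by simp)) ?_ ?_ le_rfl)).mono
      (by rw [List.length_cons]; ring_nf; omega)
    · intro a ha x₁ hx₁ σ₁ l₁ f₁ h1 h2 h3 h4 h5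
      refine ih (x := x₁) (l := l₁) (f := f₁) his.2 ?_ h1 h2 ?_ ?_ ?_ ?_
      · rw [hx₁, List.length_append] at hx
        omega
      · rw [h5 _ (by simp) (by simp) (by simp), hmt]
      · intro j hj d
        rw [h5 _ (by simp) (by simp), hloc j (by simp [hj])]
        rintro d' h
        simp at h
        exact his.1 (h.1 ▸ hj)
      · intro a' ha' x₂ hx₂ σ₂ l₂ k1 k2 k3 k4
        have hne : ∀ j ∈ is, j ≠ i := fun j hj h => his.1 (h ▸ hj)
        have hmap : is.flatMap (fun j => (Function.update a' i a j).enc) =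
            is.flatMap (fun j => (a' j).enc) := by
          refine List.flatMap_congr fun j hj => ?_
          rw [Function.update_of_ne (hne j hj)]
        refine h (Function.update a' i a) ?_ x₂ ?_ σ₂ l₂ k1 ?_ ?_ ?_
        · intro j hj
          rcases List.mem_cons.1 hj with rfl | hj
          · simpa
          · rw [Function.update_of_ne (hne j hj)]; exact ha' j hj
        · rw [List.flatMap_cons, Function.update_self, hmap, hx₁, hx₂, List.append_assoc]
        · intro j hj
          rcases List.mem_cons.1 hj with rfl | hj
          · rw [Function.update_self, k4 _ (by simp) (by simp), h3]
            intro j' hj' d' h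
            simp at h
            exact hne j' hj' h.1.symm
          · rw [Function.update_of_ne (hne j hj)]; exact k2 j hj
        · intro j hj
          rcases List.mem_cons.1 hj with rfl | hj
          · rw [Function.update_self, k4 _ (by simp) (by simp), h4]
            intro j' hj' d' h
            simp at h
            exact hne j' hj' h.1.symm
          · rw [Function.update_of_ne (hne j hj)]; exact k3 j hj
        · intro k e1 e2 e3
          rw [k4 k e1 e2 (fun j hj => e3 j (by simp [hj])), h5 k e1 e2 (e3 i (by simp))]
      · intro h'
        refine hA fun a' ha' x' hx' => ?_
        rw [List.flatMap_cons, List.append_assoc] at hx'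
        exact h' a' (fun j hj => ha' j (by simp [hj])) x'
          (Aut.enc_append_inj ha (ha' i (by simp)) (hx₁.symm.trans hx'))
    · intro h'
      refine hA fun a' ha' x' hx' => ?_
      rw [List.flatMap_cons, List.append_assoc] at hx'
      exact h' (a' i) (ha' i (by simp)) _ hx'

/-- Read the whole input. -/
noncomputable def parse (is : List I) : Frag (Tp I) Cell :=
  seq (readUnary (.inl inp) (.inl mt)) (seq (rewind (.inl mt)) (seq (forEach parseAut is)
    (ite (on (.inl inp) nonblank) abort skip)))

/-- The tapes after the input has been read: they hold the data of the automata `a i`. -/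
structure Parsed (is : List I) (m : ℕ) (a : I → Aut) (σ : Tp I → Tape Cell) : Prop where
  mt : σ (.inl mt) = Tape.mk₂ [] (List.replicate m (b true))
  st : ∀ i ∈ is, σ (.inr (i, St)) = Tape.mk₂ [] ((DFAInt.bits (a i).w (a i).st).map b)
  tb : ∀ i ∈ is, σ (.inr (i, Tb)) = Tape.mk₂ [] (tableCells ((a i).table m))
  out : σ (.inl out) = Tape.mk₂ [] []

/-- The input `x` is an instance with the alphabet `0, …, m - 1` and the automata `a i`. -/
def Instance (is : List I) (x : List Bool) (m : ℕ) (a : I → Aut) : Prop :=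
  (∀ i ∈ is, (a i).Valid m) ∧ x = DFAInt.unary m ++ is.flatMap (fun i => (a i).enc)

/-- The fragment aborts exactly if the input is not an instance. -/
lemma Ends.parse (his : is.Nodup) (hin : σ (.inl inp) = Tape.mk₂ [] (x.map b))
    (hσ : ∀ k, k ≠ .inl inp → σ k = Tape.mk₂ [] [])
    (ht : (is.length + 1) * (200 * (x.length + 1) ^ 3 + 1) ≤ t) :
    (parse is).Ends σ t (fun σ' => ∃ m a, Instance is x m a ∧ Parsed is m a σ')
      (¬ ∃ m a, Instance is x m a) := by
  have h8 : 8 * x.length + 14 ≤ 200 * (x.length + 1) ^ 3 := by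
    ring_nf
    nlinarith [Nat.zero_le (x.length ^ 3), Nat.zero_le (x.length ^ 2)]
  refine (Ends.seq (t := 5 * x.length + 3) (t' := 3 * x.length + 7 + 2 +
    is.length * (200 * (x.length + 1) ^ 3 + 1) + 1)
    (Ends.readUnary (by simp) hin (hσ _ (by simp)) ?_
    ?_ le_rfl)).mono (by rw [add_mul] at ht; omega)
  swap
  · rintro h ⟨m, a, -, hx⟩
    exact h m _ hx
  intro m x₁ hx₁ l₁
  have hm : m ≤ x.length := by
    simp [hx₁, DFAInt.unary]
  refine (Ends.seq (t := 3 * x.length + 7)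
      (t' := 1 + is.length * (200 * (x.length + 1) ^ 3 + 1) + 1)
    (Ends.rewind (l := List.replicate m (b true)) (r := []) (by simp) (by simp) ?_
    (by simp; omega))).mono (by omega)
  refine (Ends.seq (t := is.length * (200 * (x.length + 1) ^ 3 + 1)) (t' := 1)
    (Ends.parseAuts (m := m) (x := x₁) (l := l₁) (f := []) (N := x.length) his (by rw [hx₁]; simp)
    hm (by simp) (by simp [hσ]) (by simp) (by simp [hσ]) ?_ ?_ le_rfl)).mono (by omega)
  · intro a ha x₂ hx₂ σ₂ l₂ h1 h2 h3 h4
    refine Ends.ite (t := 0) (fun hc => Ends.abort ?_) (fun hc => Ends.skip ?_)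
    · rintro ⟨m', a', ha', hx'⟩
      obtain ⟨rfl, h5⟩ := DFAInt.unary_append_inj (hx₁.symm.trans hx')
      rw [hx₂] at h5
      have key : ∀ js : List I, (∀ j ∈ js, j ∈ is) → js.flatMap (fun i => (a i).enc) ++ x₂ =
          js.flatMap (fun i => (a' i).enc) → x₂ = [] := by
        intro js hjs h
        induction js with
        | nil => simpa using h
        | cons j js ih =>
          rw [List.flatMap_cons, List.flatMap_cons, List.append_assoc] at h
          exact ih (fun k hk => hjs k (by simp [hk]))
            (Aut.enc_append_inj (ha j (hjs j (by simp))) (ha' j (hjs j (by simp))) h)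
      have := key is (fun _ h => h) h5
      subst this
      simp [h1] at hc
    · have hx2 : x₂ = [] := by
        rcases x₂ with _ | ⟨y, x₂⟩
        · rfl
        · simp [h1] at hc
      refine ⟨m, a, ⟨ha, by rw [hx₁, hx₂, hx2, List.append_nil]⟩, ⟨?_, h2, h3, ?_⟩⟩
      · rw [h4 _ (by simp) (by simp) (by simp)]
        simp
      · rw [h4 _ (by simp) (by simp) (by simp)]
        simp [hσ]
  · rintro h ⟨m', a', ha', hx'⟩
    obtain ⟨rfl, h5⟩ := DFAInt.unary_append_inj (hx₁.symm.trans hx')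
    exact h a' ha' [] (by simpa using h5)

end parse

/-! ### Nested loops over the tables of the automata -/

section output

variable {I : Type} [DecidableEq I] {σ : Tp I → Tape Cell} {i : I}
  {Q : (Tp I → Tape Cell) → Prop} {A : Prop} {l l' r r' s : List Cell} {t C m : ℕ}
  {is : List I} {o : List Bool}

/-- The symbol marks the beginning of a row. -/
def isRow : Cell → Bool
  | row _ => true
  | _ => false

/-- The symbol lies inside a row. -/
def inRow : Cell → Bool
  | b _ => true
  | sep => true
  | _ => false

/-- The symbol is a bit. -/
def isB : Cell → Bool
  | b _ => true
  | _ => false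

/-- The symbol marks the beginning of a row for an accepting state. -/
def isAcc : Cell → Bool
  | row x => x
  | _ => false

/-- The tapes while the output is written.  The part of the table that is left of the head is
`(p i).1`, the part to the right is `(p i).2`, and `o` is the output up to now. -/
structure Pos (m : ℕ) (st : I → List Bool) (p : I → List Row × List Row) (o : List Bool)
    (σ : Tp I → Tape Cell) : Prop where
  mt : σ (.inl mt) = Tape.mk₂ [] (List.replicate m (b true))
  st : ∀ i, σ (.inr (i, St)) = Tape.mk₂ [] ((st i).map b)
  tb : ∀ i, σ (.inr (i, Tb)) = Tape.mk₂ (tableCells (p i).1).reverse (tableCells (p i).2)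
  out : σ (.inl out) = Tape.mk₂ (o.map b).reverse []

/-- The fragment `F` appends `f c` to the output and changes nothing else, whenever the heads are on
the rows `c i` of the tables `ρ i`, where the head is on the first row if `i ∈ S`. -/
def Emits (m : ℕ) (st : I → List Bool) (ρ : I → List Row) (F : Frag (Tp I) Cell) (S : List I)
    (t : ℕ) (f : (I → Row) → List Bool) : Prop :=
  ∀ σ p o c, (∀ i ∈ S, p i = ([], ρ i)) → (∀ i, (p i).1 ++ (p i).2 = ρ i) →
    (∀ i, (p i).2.head? = some (c i)) → Pos m st p o σ → F.Ends σ t (Pos m st p (o ++ f c)) False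

/-- Run `F` for each row of the table of the automaton `i`. -/
noncomputable def forRows (i : I) (F : Frag (Tp I) Cell) : Frag (Tp I) Cell :=
  seq (loop (on (.inr (i, Tb)) isRow) (seq F (seq (right (.inr (i, Tb)))
    (skipSeg inRow (.inr (i, Tb)))))) (rewind (.inr (i, Tb)))

variable {st : I → List Bool} {ρ : I → List Row} {F : Frag (Tp I) Cell} {S : List I}
  {f : (I → Row) → List Bool} {p : I → List Row × List Row} {c : I → Row}

omit [DecidableEq I] in
lemma Pos.ext_fun {p' : I → List Row × List Row} {o' : List Bool} (h : Pos m st p o σ) (hp : p = p')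
    (ho : o = o') : Pos m st p' o' σ := hp ▸ ho ▸ h

lemma inRow_of_mem {T : List (List Bool)} {a : Cell} (h : a ∈ T.flatMap entryCells) :
    inRow a = true := by
  obtain ⟨v, -, h⟩ := List.mem_flatMap.1 h
  rcases List.mem_append.1 h with h | h
  · obtain ⟨x, -, rfl⟩ := List.mem_map.1 h
    rfl
  · rw [List.mem_singleton.1 h]; rfl

lemma inRow_head_tableCells (T : List Row) :
    inRow ((tableCells T).head?.getD default) = false := by
  rcases T with _ | ⟨ρ, T⟩ <;> rfl

/-- The loop of `forRows`, started with the rows `todo` still to be treated. -/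
lemma Emits.rows (h : Emits m st ρ F S t f) (hi : i ∉ S) {todo : List Row}
    (hC : (tableCells (ρ i)).length ≤ C)
    (hS : ∀ i ∈ S, p i = ([], ρ i)) (hp : ∀ i, (p i).1 ++ (p i).2 = ρ i)
    (hc : ∀ j ≠ i, (p j).2.head? = some (c j)) (hP : Pos m st p o σ) (ht : (p i).2 = todo) :
    (loop (on (.inr (i, Tb)) isRow) (seq F (seq (right (.inr (i, Tb)))
      (skipSeg inRow (.inr (i, Tb)))))).Ends σ (todo.length * (t + 3 * C + 5))
      (Pos m st (Function.update p i (ρ i, []))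
        (o ++ todo.flatMap fun r => f (Function.update c i r))) False := by
  induction todo generalizing σ p o with
  | nil =>
    refine Ends.loop_false (by rw [on_heads, hP.tb i, ht]; rfl) ?_
    refine hP.ext_fun ?_ (by simp)
    rw [← hp i, ht, List.append_nil, ← ht]
    simp
  | cons r todo ih =>
    have hlen : ((r.2).flatMap entryCells).length ≤ C := by
      rw [← hp i, ht] at hC
      simp [tableCells, rowCells] at hC ⊢
      omega
    refine (Ends.loop_true (t := t + 3 * C + 3) (t' := todo.length * (t + 3 * C + 5))
      (by rw [on_heads, hP.tb i, ht]; rfl) ((Ends.seq (t := t) (t' := 3 * C + 2)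
      ((h σ p o (Function.update c i r) hS hp (fun j => ?_) hP).imp le_rfl (fun σ' hσ' => ?_)
        id)).mono (by omega))).mono (by rw [List.length_cons]; ring_nf; omega)
    · by_cases hj : j = i
      · subst hj; simp [ht]
      · rw [hc j hj, Function.update_of_ne hj]
    · refine Ends.mono (Ends.seq (t := 1) (t' := 3 * C) (Ends.right (a := row r.1)
        (l := (tableCells (p i).1).reverse) (r := r.2.flatMap entryCells ++ tableCells todo) ?_
        (Ends.skipSeg (l := row r.1 :: (tableCells (p i).1).reverse) (s := r.2.flatMap entryCells)
          (r := tableCells todo) (by simp) (fun _ => inRow_of_mem) (inRow_head_tableCells _) ?_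
          (by omega)))) (by omega)
      · rw [hσ'.tb i, ht]; rfl
      · refine (ih (p := Function.update p i ((p i).1 ++ [r], todo))
          (o := o ++ f (Function.update c i r))
          ?_ ?_ ?_ ?_ (by simp)).imp le_rfl (fun σ'' hσ'' => ?_) id
        · intro j hj
          rw [Function.update_of_ne (by rintro rfl; exact hi hj), hS j hj]
        · intro j
          by_cases hj : j = i
          · subst hj; simp [← hp j, ht]
          · rw [Function.update_of_ne hj, hp]
        · intro j hj
          rw [Function.update_of_ne hj, hc j hj]
        · constructor
          · simp [hσ'.mt]
          · simp [hσ'.st]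
          · intro j
            by_cases hj : j = i
            · subst hj; simp [tableCells, rowCells]
            · simp [hj, hσ'.tb]
          · simp [hσ'.out]
        · exact hσ''.ext_fun (by simp) (by simp)

lemma Emits.forRows (h : Emits m st ρ F S t f) (hi : i ∉ S)
    (hC : (tableCells (ρ i)).length ≤ C) :
    Emits m st ρ (forRows i F) (i :: S) ((ρ i).length * (t + 3 * C + 5) + 3 * C + 8)
      (fun c => (ρ i).flatMap fun r => f (Function.update c i r)) := by
  intro σ p o c hS hp hc hP
  have hpi := hS i (by simp)
  refine (Ends.seq (t := (ρ i).length * (t + 3 * C + 5)) (t' := 3 * C + 7) ((h.rows hi hC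
    (fun j hj => hS j (by simp [hj])) hp (fun j _ => hc j) hP (todo := ρ i) (by rw [hpi])).imp
    le_rfl (fun σ' hσ' => ?_) id)).mono (by omega)
  refine Ends.rewind (l := (tableCells (ρ i)).reverse) (r := []) (by simp [hσ'.tb]) ?_ ?_
    (by rw [List.length_reverse]; omega)
  · intro a ha
    exact ne_default_of_mem_tableCells (List.mem_reverse.1 ha)
  · constructor
    · simp [hσ'.mt]
    · simp [hσ'.st]
    · intro j
      by_cases hj : j = i
      · subst hj; simp [hpi]
      · simp [hj, hσ'.tb]
    · simp [hσ'.out]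

/-- Nested loops over the rows of the tables of the automata in a list. -/
noncomputable def forAll : List I → Frag (Tp I) Cell → Frag (Tp I) Cell
  | [], F => F
  | i :: is, F => forAll is (forRows i F)

/-- The output of nested loops. -/
def emit (ρ : I → List Row) : List I → ((I → Row) → List Bool) → (I → Row) → List Bool
  | [], f => f
  | i :: is, f => emit ρ is fun c => (ρ i).flatMap fun r => f (Function.update c i r)

/-- A bound for the time of `n` nested loops with at most `P` rounds. -/
def loopTime (P C : ℕ) : ℕ → ℕ → ℕ
  | 0, t => t
  | n + 1, t => loopTime P C n (P * (t + 3 * C + 5) + 3 * C + 8)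

/-- The summand `3 * C + 13` absorbs the overhead of a round, so that each loop only multiplies the
bound by `P + 3`. -/
lemma loopTime_le (P C n t : ℕ) : loopTime P C n t + 3 * C + 13 ≤
    (P + 3) ^ n * (t + 3 * C + 13) := by
  induction n generalizing t with
  | zero => simp [loopTime]
  | succ n ih =>
    rw [loopTime]
    refine (ih _).trans ?_
    rw [pow_succ, mul_assoc]
    refine Nat.mul_le_mul_left _ ?_
    ring_nf
    nlinarith [Nat.zero_le (P * C), Nat.zero_le (P * t)]

omit [DecidableEq I] in
lemma Emits.mono {t' : ℕ} (h : Emits m st ρ F S t f) (ht : t ≤ t') : Emits m st ρ F S t' f :=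
  fun σ p o c hS hp hc hP => (h σ p o c hS hp hc hP).mono ht

/-- Nested loops run `F` once for every combination of rows, in lexicographic order, where the rows
for the first automaton in the list change fastest. -/
lemma Emits.forAll {P : ℕ} (h : Emits m st ρ F S t f) (his : is.Nodup) (hd : ∀ i ∈ is, i ∉ S)
    (hC : ∀ i, (tableCells (ρ i)).length ≤ C) (hP : ∀ i, (ρ i).length ≤ P) :
    Emits m st ρ (forAll is F) (is.reverse ++ S) (loopTime P C is.length t) (emit ρ is f) := by
  induction is generalizing F S t f with
  | nil => exact h
  | cons i is ih =>
    rw [List.nodup_cons] at his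
    have := ih ((h.forRows (hd i (by simp)) (hC i)).mono
      (t' := P * (t + 3 * C + 5) + 3 * C + 8)
      (by have := Nat.mul_le_mul_right (t + 3 * C + 5) (hP i); omega)) his.2 (fun j hj hj' => by
      rcases List.mem_cons.1 hj' with rfl | hj'
      · exact his.1 hj
      · exact hd j (by simp [hj]) hj')
    rw [List.reverse_cons, List.append_assoc]
    exact this

end output

section output

variable {I : Type} [DecidableEq I] {σ : Tp I → Tape Cell} {i : I}
  {Q : (Tp I → Tape Cell) → Prop} {A : Prop} {l l' r r' s : List Cell} {t C m n N : ℕ}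
  {is : List I} {o : List Bool} {st : I → List Bool} {ρ : I → List Row} {F : Frag (Tp I) Cell}
  {S : List I} {p : I → List Row × List Row} {c : I → Row}

/-! ### Writing bits and rows of a product -/

/-- Run fragments for the members of a list that only change one table tape each and append
something to the output. -/
lemma Ends.forEach_tapes {G : I → Frag (Tp I) Cell} {X Y : I → Tape Cell} {e : I → List Bool}
    (hG : ∀ i ∈ is, ∀ σ o, σ (.inr (i, Tb)) = X i → σ (.inl out) = Tape.mk₂ (o.map b).reverse [] →
      (G i).Ends σ t (fun σ' => σ' = Function.update (Function.update σ (.inr (i, Tb)) (Y i))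
        (.inl out) (Tape.mk₂ ((o ++ e i).map b).reverse [])) False)
    (his : is.Nodup) (hX : ∀ i ∈ is, σ (.inr (i, Tb)) = X i)
    (ho : σ (.inl out) = Tape.mk₂ (o.map b).reverse [])
    (hQ : ∀ σ', (∀ i ∈ is, σ' (.inr (i, Tb)) = Y i) →
      σ' (.inl out) = Tape.mk₂ ((o ++ is.flatMap e).map b).reverse [] →
      (∀ k, k ≠ .inl out → (∀ i ∈ is, k ≠ .inr (i, Tb)) → σ' k = σ k) → Q σ')
    {t' : ℕ} (ht : is.length * (t + 1) ≤ t') : (forEach G is).Ends σ t' Q A := by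
  refine Ends.mono ?_ ht
  clear ht
  induction is generalizing σ o with
  | nil => exact Ends.skip (hQ σ (by simp) (by simp [ho]) fun _ _ _ => rfl)
  | cons i is ih =>
    rw [List.nodup_cons] at his
    have hne : ∀ j ∈ is, j ≠ i := fun j hj h => his.1 (h ▸ hj)
    refine (Ends.forEach_cons (t := t) (t' := is.length * (t + 1)) ((hG i (by simp) σ o
      (hX i (by simp)) ho).imp le_rfl ?_ False.elim)).mono
      (by rw [List.length_cons]; ring_nf; omega)
    rintro σ₁ rfl
    refine ih (o := o ++ e i) (fun j hj => hG j (by simp [hj])) his.2 (fun j hj => ?_) (by simp) ?_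
    · simp [hne j hj, hX j (by simp [hj])]
    · intro σ₂ h1 h2 h3
      refine hQ σ₂ ?_ (by simpa using h2) ?_
      · intro j hj
        rcases List.mem_cons.1 hj with rfl | hj
        · rw [h3 _ (by simp) (fun i hi h => hne i hi (by simpa using h.symm))]
          simp
        · exact h1 j hj
      · intro k hk hk'
        rw [h3 k hk fun j hj => hk' j (by simp [hj])]
        simp [hk, hk' i (by simp)]

lemma Pos.put {x : Bool} (h : Pos m st p o σ) : Pos m st p (o ++ [x])
    (Function.update σ (.inl Com.out) (Tape.mk₂ (b x :: (o.map b).reverse) [])) := by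
  constructor
  · simp [h.mt]
  · simp [h.st]
  · simp [h.tb]
  · simp

/-- Write whether all states given by the heads are accepting. -/
def putAcc (is : List I) : Frag (Tp I) Cell :=
  put (.inl out) fun h => b (is.all fun i => isAcc (h (.inr (i, Tb))))

lemma emits_putAcc : Emits m st ρ (putAcc is) S 1 (fun c => [is.all fun i => (c i).1]) := by
  intro σ p o c _ _ hc hP
  refine Ends.put hP.out ?_
  have : (fun i => isAcc (heads σ (.inr (i, Tb)))) = fun i => (c i).1 := by
    funext i
    have := hc i
    rw [heads_apply, hP.tb i]
    rcases hpi : (p i).2 with _ | ⟨r, T⟩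
    · simp [hpi] at this
    · rw [hpi, List.head?_cons, Option.some.injEq] at this
      rw [← this]
      rfl
  rw [this]
  exact hP.put

/-- Copy the entry at the head of table `i` to the output. -/
def putEntry (i : I) : Frag (Tp I) Cell :=
  seq (copySeg isB (.inr (i, Tb)) (.inl out) id) (right (.inr (i, Tb)))

/-- The first entries of some rows, then the second ones, and so on. -/
def columns : ℕ → List (List (List Bool)) → List Bool
  | 0, _ => []
  | n + 1, T => T.flatMap (fun v => v.headD []) ++ columns n (T.map List.tail)

/-- Write the row of the product automaton for the states given by the heads, which are at the first
entries of the rows. -/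
def putEntries (is : List I) : Frag (Tp I) Cell :=
  loop (on (.inl mt) (isBit true)) (seq (forEach putEntry is) (right (.inl mt)))

lemma Ends.putEntry {v : List Bool} (hX : σ (.inr (i, Tb)) = Tape.mk₂ l (entryCells v ++ r))
    (ho : σ (.inl out) = Tape.mk₂ (o.map b).reverse []) (hv : v.length ≤ N) :
    (putEntry i).Ends σ (5 * N + 2) (fun σ' => σ' = Function.update (Function.update σ
      (.inr (i, Tb)) (Tape.mk₂ ((entryCells v).reverse ++ l) r))
        (.inl out) (Tape.mk₂ ((o ++ v).map b).reverse [])) False := by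
  refine Ends.seq (t := 5 * N) (t' := 1) (Ends.copySeg (l := l) (s := v.map b) (r := sep :: r)
    (by simp) (by simp [hX, entryCells]) ho ?_ rfl (Ends.right (a := sep)
    (l := (v.map b).reverse ++ l) (r := r) (by simp) ?_) (by simpa using hv))
  · intro a ha
    obtain ⟨x, -, rfl⟩ := List.mem_map.1 ha
    rfl
  · funext k
    by_cases hk : k = .inl out
    · subst hk; simp
    by_cases hk' : k = .inr (i, Tb)
    · subst hk'; simp [entryCells]
    simp [hk, hk']

lemma Ends.putEntries {L Z : I → List Cell} {v : I → List (List Bool)} (his : is.Nodup)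
    (hv : ∀ i ∈ is, (v i).length = n) (hN : ∀ i ∈ is, ∀ u ∈ v i, u.length ≤ N)
    (hmt : σ (.inl mt) = Tape.mk₂ l (List.replicate n (b true)))
    (hX : ∀ i ∈ is, σ (.inr (i, Tb)) = Tape.mk₂ (L i) ((v i).flatMap entryCells ++ Z i))
    (ho : σ (.inl out) = Tape.mk₂ (o.map b).reverse [])
    (hQ : ∀ σ', (∀ i ∈ is, σ' (.inr (i, Tb)) =
        Tape.mk₂ (((v i).flatMap entryCells).reverse ++ L i) (Z i)) →
      σ' (.inl out) = Tape.mk₂ ((o ++ columns n (is.map v)).map b).reverse [] →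
      σ' (.inl mt) = Tape.mk₂ (List.replicate n (b true) ++ l) [] →
      (∀ k, k ≠ .inl out → k ≠ .inl mt → (∀ i ∈ is, k ≠ .inr (i, Tb)) → σ' k = σ k) → Q σ') :
    (putEntries is).Ends σ (n * (is.length * (5 * N + 3) + 4)) Q A := by
  induction n generalizing σ o l L v with
  | zero =>
    refine Ends.loop_false (by simp [hmt]) (hQ σ ?_ (by simp [ho, columns]) (by simp [hmt])
      fun _ _ _ _ => rfl)
    intro i hi
    rw [hX i hi, List.length_eq_zero_iff.1 (hv i hi)]
    rfl
  | succ n ih =>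
    have hcons : ∀ i ∈ is, v i = (v i).headD [] :: (v i).tail := fun i hi => by
      rcases h : v i with _ | ⟨x, u⟩
      · have := hv i hi
        simp [h] at this
      · rfl
    refine (Ends.loop_true (t := is.length * (5 * N + 3) + 2)
      (t' := n * (is.length * (5 * N + 3) + 4)) (by simp [hmt, List.replicate_succ])
      (Ends.seq (t := is.length * (5 * N + 3)) (t' := 1)
      (Ends.forEach_tapes (t := 5 * N + 2) (o := o)
      (X := fun i => Tape.mk₂ (L i) (entryCells ((v i).headD []) ++
        ((v i).tail.flatMap entryCells ++ Z i)))
      (Y := fun i => Tape.mk₂ ((entryCells ((v i).headD [])).reverse ++ L i)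
        ((v i).tail.flatMap entryCells ++ Z i)) (e := fun i => (v i).headD [])
      (fun i hi σ o h1 h2 => Ends.putEntry h1 h2 (hN i hi _ (by rw [hcons i hi]; simp))) his
      (fun i hi => by rw [hX i hi]; nth_rw 1 [hcons i hi]; simp) ho (fun σ₁ h1 h2 h3 => ?_)
      le_rfl))).mono (by ring_nf; omega)
    refine Ends.right (a := b true) (l := l) (r := List.replicate n (b true)) ?_
      (ih (o := o ++ is.flatMap fun i => (v i).headD []) (l := b true :: l)
      (L := fun i => (entryCells ((v i).headD [])).reverse ++ L i)
      (v := fun i => (v i).tail) (fun i hi => by simp [hv i hi])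
      (fun i hi u hu => hN i hi u (List.mem_of_mem_tail hu)) ?_ ?_ ?_ ?_)
    · rw [h3 _ (by simp) (by simp), hmt, List.replicate_succ]
    · simp
    · intro i hi
      simp [h1 i hi]
    · simp [h2]
    · intro σ₂ k1 k2 k3 k4
      refine hQ σ₂ ?_ ?_ ?_ ?_
      · intro i hi
        rw [k1 i hi]
        nth_rw 3 [hcons i hi]
        simp
      · rw [k2, columns]
        simp [List.flatMap_map, Function.comp_def]
      · rw [k3, List.replicate_succ']; simp
      · intro k e1 e2 e3
        rw [k4 k e1 e2 e3, Function.update_of_ne e2, h3 k e1 e3]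

/-- The symbol does not mark the beginning of a row. -/
def notRow (a : Cell) : Bool := !isRow a

/-- Go back to the beginning of the row whose end is left of the head. -/
def backRow (i : I) : Frag (Tp I) Cell :=
  seq (left (.inr (i, Tb))) (backSeg notRow (.inr (i, Tb)))

lemma Ends.backRow {x : Bool} (hX : σ (.inr (i, Tb)) = Tape.mk₂ (s.reverse ++ row x :: l) r)
    (hs : ∀ a ∈ s, notRow a = true) (hC : s.length ≤ C)
    (hQ : Q (Function.update σ (.inr (i, Tb)) (Tape.mk₂ l (row x :: s ++ r)))) :
    (backRow i).Ends σ (3 * C + 5) Q A := by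
  rcases s.eq_nil_or_concat' with rfl | ⟨s, a, rfl⟩
  · refine (Ends.seq (t := 1) (t' := 3 * C + 3) (Ends.left (a := row x) (l := l) (r := r)
      (by simpa using hX) (Ends.loop_false ?_ (by simpa using hQ)))).mono (by omega)
    simp [notRow, isRow]
  · refine (Ends.seq (t := 1) (t' := 3 * C + 3) (Ends.left (a := a) (l := s.reverse ++ row x :: l)
      (r := r) (by simpa using hX) (Ends.backSeg (s := s) (a := row x) (b := a) (l := l) (r := r)
      (Function.update_self ..) (fun c hc => hs c (by simp [hc])) (hs a (by simp)) rfl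
      (by simpa using hQ) (by simp at hC; omega)))).mono (by omega)

/-- Write the row of the product automaton for the states given by the heads. -/
noncomputable def putRow (is : List I) : Frag (Tp I) Cell :=
  seq (forEach (fun i => right (.inr (i, Tb))) is) (seq (putEntries is) (seq (rewind (.inl mt))
    (forEach backRow is)))

lemma notRow_of_mem {T : List (List Bool)} {a : Cell} (h : a ∈ T.flatMap entryCells) :
    notRow a = true := by
  have := inRow_of_mem h
  cases a <;> simp_all [inRow, notRow, isRow]

/-- A row of a product is obtained by writing, for each letter, the entries of the rows of the
factors one after the other. -/
lemma emits_putRow (his : is.Nodup) (hρ : ∀ i, ∀ r ∈ ρ i, r.2.length = m ∧ ∀ u ∈ r.2, u.length ≤ N)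
    (hC : ∀ i, (tableCells (ρ i)).length ≤ C) :
    Emits m st ρ (putRow is) S
      (is.length * (3 * C + 8) + m * (is.length * (5 * N + 3) + 4) + 3 * m + 10)
      (fun c => columns m (is.map fun i => (c i).2)) := by
  intro σ p o c _ hp hc hP
  have hcons : ∀ i, (p i).2 = c i :: (p i).2.tail := fun i => by
    have := hc i
    rcases hpi : (p i).2 with _ | ⟨r, T⟩
    · simp [hpi] at this
    · rw [hpi, List.head?_cons, Option.some.injEq] at this
      simp [this]
  have hmem : ∀ i, c i ∈ ρ i := fun i => by rw [← hp i, hcons i]; simp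
  have hlen : ∀ i, ((c i).2.flatMap entryCells).length ≤ C := fun i => by
    have := hC i
    rw [← hp i, hcons i] at this
    simp [tableCells, rowCells] at this ⊢
    omega
  refine (Ends.seq (t := is.length * 2)
      (t' := m * (is.length * (5 * N + 3) + 4) + 1 + (3 * m + 7) + 1 +
    is.length * (3 * C + 6)) (Ends.forEach_tapes (t := 1) (o := o)
    (X := fun i => Tape.mk₂ (tableCells (p i).1).reverse (row (c i).1 ::
    ((c i).2.flatMap entryCells ++
      tableCells (p i).2.tail)))
    (Y := fun i => Tape.mk₂ (row (c i).1 :: (tableCells (p i).1).reverse)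
      ((c i).2.flatMap entryCells ++ tableCells (p i).2.tail)) (e := fun _ => [])
    (fun i hi σ o h1 h2 => Ends.right h1 ?_) his ?_ hP.out ?_ le_rfl)).mono (by ring_nf; omega)
  · have := Function.update_eq_self (Sum.inl out) (Function.update σ (.inr (i, Tb))
      (Tape.mk₂ (row (c i).1 :: (tableCells (p i).1).reverse)
      ((c i).2.flatMap entryCells ++ tableCells (p i).2.tail)))
    rw [Function.update_of_ne (by simp), h2] at this
    simpa using this.symm
  · intro i hi
    rw [hP.tb i]
    conv_lhs => rw [hcons i]
    simp [rowCells]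
  intro σ₁ h1 h2 h3
  simp only [List.append_nil, List.flatMap_eq_nil_iff.2 (fun _ _ => rfl)] at h2
  refine (Ends.seq (t := m * (is.length * (5 * N + 3) + 4)) (t' := 3 * m + 7 + 1 +
    is.length * (3 * C + 6)) (Ends.putEntries (l := []) (n := m) (v := fun i => (c i).2)
    (N := N) (o := o)
    his (fun i _ => (hρ i _ (hmem i)).1) (fun i _ => (hρ i _ (hmem i)).2) ?_ h1 h2 ?_)).mono
    (by omega)
  · rw [h3 _ (by simp) (by simp), hP.mt]
  intro σ₂ k1 k2 k3 k4
  refine Ends.seq (t := 3 * m + 7) (t' := is.length * (3 * C + 6)) (Ends.rewind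
    (l := List.replicate m (b true)) (r := []) (by simpa using k3) (by simp) ?_ (by simp))
  refine Ends.forEach_tapes (t := 3 * C + 5) (o := o ++ columns m (is.map fun i => (c i).2))
    (X := fun i => Tape.mk₂ (((c i).2.flatMap entryCells).reverse ++
      row (c i).1 :: (tableCells (p i).1).reverse) (tableCells (p i).2.tail))
    (Y := fun i => Tape.mk₂ (tableCells (p i).1).reverse (tableCells (p i).2)) (e := fun _ => [])
    (fun i hi σ o h1 h2 => Ends.backRow h1 (fun _ => notRow_of_mem) (hlen i) ?_) his ?_
    (by simp [k2])
    ?_ le_rfl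
  · have := Function.update_eq_self (Sum.inl out) (Function.update σ (.inr (i, Tb))
      (Tape.mk₂ (tableCells (p i).1).reverse (tableCells (p i).2)))
    rw [Function.update_of_ne (by simp), h2] at this
    nth_rw 2 [hcons i] at this
    simpa [rowCells] using this.symm
  · intro i hi
    simp [k1 i hi]
  intro σ₃ e1 e2 e3
  simp only [List.append_nil, List.flatMap_eq_nil_iff.2 (fun _ _ => rfl)] at e2
  constructor
  · rw [e3 _ (by simp) (by simp)]
    simp
  · intro i
    rw [e3 _ (by simp) (by simp), Function.update_of_ne (by simp),
        k4 _ (by simp) (by simp) (by simp),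
      h3 _ (by simp) (by simp), hP.st]
  · intro i
    by_cases hi : i ∈ is
    · exact e1 i hi
    · have : ∀ j ∈ is, (Sum.inr (i, Tb) : Tp I) ≠ .inr (j, Tb) := by
        intro j hj h
        simp at h
        exact hi (h ▸ hj)
      rw [e3 _ (by simp) this, Function.update_of_ne (by simp), k4 _ (by simp) (by simp) this,
        h3 _ (by simp) this, hP.tb]
  · exact e2

end output

/-! ### Instances and the problem -/

namespace Aut

/-- The next state. -/
def step (a : Aut) (q x : ℕ) : ℕ := (a.tb.getD q []).getD x 0

/-- The automaton accepts the word `u`. -/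
def Accepts (a : Aut) (u : List ℕ) : Prop := a.ac.getD (u.foldl a.step a.st) false = true

open scoped Classical in
/-- The data of an automaton. -/
noncomputable def ofDFA {m s : ℕ} (D : DFA (Fin m) (Fin s)) : Aut where
  s := s
  st := D.start
  ac := List.ofFn fun q => decide (q ∈ D.accept)
  tb := List.ofFn fun q => List.ofFn fun x => (D.step q x : ℕ)

variable {m s : ℕ} {a a' : Aut}

lemma enc_ofDFA (D : DFA (Fin m) (Fin s)) : (ofDFA D).enc = DFAInt.encodeDFA D := by
  simp [enc, ofDFA, DFAInt.encodeDFA, w, List.flatMap_def, List.map_ofFn, Function.comp_def]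

lemma valid_ofDFA (D : DFA (Fin m) (Fin s)) : (ofDFA D).Valid m where
  one_le := by have := D.start.2; simp only [ofDFA]; omega
  st_lt := D.start.2
  length_ac := by simp [ofDFA]
  length_tb := by simp [ofDFA]
  row ρ hρ := by
    obtain ⟨q, rfl⟩ := List.mem_ofFn.1 hρ
    refine ⟨by simp, fun v hv => ?_⟩
    obtain ⟨x, rfl⟩ := List.mem_ofFn.1 hv
    exact (D.step q x).2

lemma foldl_ofDFA (D : DFA (Fin m) (Fin s)) (q : Fin s) (u : List (Fin m)) :
    (u.map Fin.val).foldl (ofDFA D).step q = D.evalFrom q u := by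
  induction u generalizing q with
  | nil => rfl
  | cons x u ih =>
    rw [List.map_cons, List.foldl_cons, DFA.evalFrom_cons, ← ih]
    congr 1
    simp [step, ofDFA]

lemma accepts_ofDFA (D : DFA (Fin m) (Fin s)) (u : List (Fin m)) :
    (ofDFA D).Accepts (u.map Fin.val) ↔ u ∈ D.accepts := by
  have : (ofDFA D).st = D.start := rfl
  rw [Accepts, this, foldl_ofDFA, DFA.mem_accepts]
  simp [ofDFA, DFA.eval]

/-- Valid data come from an automaton. -/
lemma exists_ofDFA_eq (h : a.Valid m) : ∃ D : DFA (Fin m) (Fin a.s), ofDFA D = a := by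
  have hq : ∀ q : Fin a.s, (q : ℕ) < a.tb.length := fun q => by rw [h.length_tb]; exact q.2
  have hρ : ∀ q : Fin a.s, ∀ x : Fin m, (x : ℕ) < (a.tb[(q : ℕ)]'(hq q)).length := fun q x => by
    rw [(h.row _ (List.getElem_mem (hq q))).1]; exact x.2
  refine ⟨⟨fun q x => ⟨(a.tb[(q : ℕ)]'(hq q))[(x : ℕ)]'(hρ q x),
      (h.row _ (List.getElem_mem (hq q))).2 _
    (List.getElem_mem _)⟩, ⟨a.st, h.st_lt⟩, {q | a.ac.getD q false = true}⟩, ?_⟩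
  rcases a with ⟨s, st, ac, tb⟩
  simp only [ofDFA, Aut.mk.injEq, true_and]
  refine ⟨?_, ?_⟩
  · refine List.ext_getElem (by simpa using h.length_ac.symm) fun n h1 h2 => ?_
    simp [h2]
  · refine List.ext_getElem (by simpa using h.length_tb.symm) fun n h1 h2 => ?_
    refine List.ext_getElem (by simpa using (h.row _ (List.getElem_mem h2)).1.symm)
        fun k h3 h4 => ?_
    simp

lemma _root_.List.flatMap_inj_of_length {α β : Type*} {f : α → List β} {n : ℕ} {l l' : List α}
    (hl : l.length = l'.length) (hf : ∀ x ∈ l, (f x).length = n) (hf' : ∀ x ∈ l', (f x).length = n)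
    (hinj : ∀ x ∈ l, ∀ y ∈ l', f x = f y → x = y) (h : l.flatMap f = l'.flatMap f) : l = l' := by
  induction l generalizing l' with
  | nil => exact (List.length_eq_zero_iff.1 hl.symm).symm
  | cons x l ih =>
    rcases l' with _ | ⟨y, l'⟩
    · simp at hl
    · rw [List.flatMap_cons, List.flatMap_cons] at h
      obtain ⟨h1, h2⟩ := List.append_inj h ((hf x (by simp)).trans (hf' y (by simp)).symm)
      rw [hinj x (by simp) y (by simp) h1, ih (by simpa using hl) (fun z hz => hf z (by simp [hz]))
        (fun z hz => hf' z (by simp [hz]))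
        (fun z hz z' hz' => hinj z (by simp [hz]) z' (by simp [hz'])) h2]

lemma enc_inj (ha : a.Valid m) (ha' : a'.Valid m) (h : a.enc = a'.enc) : a = a' := by
  rw [enc, enc] at h
  obtain ⟨h1, h⟩ := DFAInt.unary_append_inj h
  have hw : a.w = a'.w := by rw [w, w, h1]
  rw [hw] at h
  obtain ⟨h2, h⟩ := List.append_inj h (by simp)
  obtain ⟨h3, h4⟩ := List.append_inj h (by rw [ha.length_ac, ha'.length_ac, h1])
  have hlt : ∀ n < a.s, n < 2 ^ a'.w := fun n hn => hn.trans_le (hw ▸ a.le_two_pow)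
  have hlt' : ∀ n < a'.s, n < 2 ^ a'.w := fun n hn => hn.trans_le a'.le_two_pow
  have h5 : a.tb = a'.tb := by
    refine List.flatMap_inj_of_length (n := m * a'.w) (by rw [ha.length_tb, ha'.length_tb, h1])
      (fun ρ hρ => by simp [List.length_flatMap, (ha.row ρ hρ).1])
      (fun ρ hρ => by simp [List.length_flatMap, (ha'.row ρ hρ).1]) ?_ h4
    intro ρ hρ ρ' hρ' h
    refine List.flatMap_inj_of_length (n := a'.w) ((ha.row ρ hρ).1.trans (ha'.row ρ' hρ').1.symm)
      (by simp) (by simp) ?_ h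
    intro x hx y hy
    exact DFAInt.bits_injOn (hlt x ((ha.row ρ hρ).2 x hx)) (hlt' y ((ha'.row ρ' hρ').2 y hy))
  have h6 := DFAInt.bits_injOn (hlt _ ha.st_lt) (hlt' _ ha'.st_lt) h2
  rcases a with ⟨s, st, ac, tb⟩
  rcases a' with ⟨s', st', ac', tb'⟩
  simp_all

lemma flatMap_enc_inj {l l' : List Aut} (hl : l.length = l'.length) (h1 : ∀ a ∈ l, a.Valid m)
    (h2 : ∀ a ∈ l', a.Valid m) (h : l.flatMap enc = l'.flatMap enc) : l = l' := by
  induction l generalizing l' with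
  | nil => exact (List.length_eq_zero_iff.1 hl.symm).symm
  | cons x l ih =>
    rcases l' with _ | ⟨y, l'⟩
    · simp at hl
    · rw [List.flatMap_cons, List.flatMap_cons] at h
      have h3 := enc_append_inj (h1 x (by simp)) (h2 y (by simp)) h
      rw [h3, List.append_cancel_right_eq] at h
      rw [enc_inj (h1 x (by simp)) (h2 y (by simp)) h, ih (by simpa using hl)
        (fun z hz => h1 z (by simp [hz])) (fun z hz => h2 z (by simp [hz])) h3]

end Aut

variable {I : Type} {is : List I} {x : List Bool} {m : ℕ} {a : I → Aut} {A : Set ℕ}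

/-- The encoding of an instance in terms of the data of its automata. -/
lemma encode_eq {k : ℕ} (s : Fin k → ℕ) (D : (i : Fin k) → DFA (Fin m) (Fin (s i))) :
    DFAInt.encode s D = DFAInt.unary m ++ (List.ofFn fun i => Aut.ofDFA (D i)).flatMap Aut.enc := by
  simp [DFAInt.encode, List.flatMap_def, List.map_ofFn, Function.comp_def, Aut.enc_ofDFA]

/-- Whether an instance is solvable, in terms of the data of its automata. -/
lemma Instance.mem_kDFAInt (h : Instance is x m a) : x ∈ kDFAInt A is.length ↔
    m ∈ A ∧ ∃ u : List ℕ, (∀ v ∈ u, v < m) ∧ ∀ i ∈ is, (a i).Accepts u := by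
  obtain ⟨hv, hx⟩ := h
  have hmap : is.flatMap (fun i => (a i).enc) = (is.map a).flatMap Aut.enc := by
    rw [List.flatMap_map]
  constructor
  · rintro ⟨m', hm', s, D, hx', w, hw⟩
    rw [encode_eq] at hx'
    obtain ⟨rfl, h⟩ := DFAInt.unary_append_inj (hx.symm.trans hx')
    rw [hmap] at h
    have h := Aut.flatMap_enc_inj (m := m) (by simp) (by simpa using hv) (fun b hb => by
      obtain ⟨i, rfl⟩ := List.mem_ofFn.1 hb
      exact Aut.valid_ofDFA _) h
    refine ⟨hm', w.map Fin.val, by simp, fun i hi => ?_⟩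
    have : a i ∈ is.map a := List.mem_map_of_mem hi
    rw [h] at this
    obtain ⟨j, hj⟩ := List.mem_ofFn.1 this
    rw [← hj]
    exact (Aut.accepts_ofDFA _ _).2 (hw j)
  · rintro ⟨hm, u, hu, hacc⟩
    choose D hD using fun j : Fin is.length => Aut.exists_ofDFA_eq (hv _ (List.get_mem is j))
    obtain ⟨w, rfl⟩ : ∃ w : List (Fin m), u = w.map Fin.val :=
      ⟨u.attach.map fun v => ⟨v.1, hu _ v.2⟩, by simp [Function.comp_def]⟩
    refine ⟨m, hm, _, D, ?_, w, fun j => ?_⟩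
    · rw [encode_eq, hx, hmap]
      congr 2
      refine List.ext_getElem (by simp) fun n h1 h2 => ?_
      simp [hD]
    · rw [← Aut.accepts_ofDFA, hD]
      exact hacc _ (List.get_mem is j)

/-- The words of the language encode instances. -/
lemma exists_instance [DecidableEq I] (his : is.Nodup) (h : x ∈ kDFAInt A is.length) :
    ∃ m a, Instance is x m a := by
  obtain ⟨m, -, s, D, rfl, -⟩ := h
  set f : I → Aut := fun i => if h : is.idxOf i < is.length then Aut.ofDFA (D ⟨is.idxOf i, h⟩) else
    ⟨0, 0, [], []⟩ with hf
  refine ⟨m, f, ?_, ?_⟩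
  · intro i hi
    rw [hf]
    beta_reduce
    rw [dif_pos (List.idxOf_lt_length_iff.2 hi)]
    exact Aut.valid_ofDFA _
  · have hmap : is.flatMap (fun i => (f i).enc) = (is.map f).flatMap Aut.enc := by
      rw [List.flatMap_map]
    rw [encode_eq, hmap]
    congr 2
    refine List.ext_getElem (by simp) fun n h1 h2 => ?_
    have hn : n < is.length := by simpa using h1
    simp only [List.getElem_ofFn, List.getElem_map, hf, his.idxOf_getElem n hn, hn, dif_pos]
    exact congrArg (fun j => Aut.ofDFA (D j)) (Fin.ext (his.idxOf_getElem n hn).symm)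

/-! ### Product automata -/

/-- An automaton whose states are all the numbers with `w` binary digits. -/
structure PAut where
  /-- the number of digits -/
  w : ℕ
  /-- the initial state -/
  st : ℕ
  /-- whether a state is accepting -/
  acc : ℕ → Bool
  /-- the next state -/
  step : ℕ → ℕ → ℕ

namespace PAut

/-- The transitions over the letters `0, …, m - 1` do not leave the set of states. -/
structure Valid (m : ℕ) (P : PAut) : Prop where
  st_lt : P.st < 2 ^ P.w
  step_lt : ∀ q < 2 ^ P.w, ∀ x < m, P.step q x < 2 ^ P.w

/-- The row of a state in the transition table. -/
def row (m : ℕ) (P : PAut) (q : ℕ) : Row :=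
  (P.acc q, (List.range m).map fun x => DFAInt.bits P.w (P.step q x))

/-- The automaton with a single state, which is accepting. -/
def one : PAut := ⟨0, 0, fun _ => true, fun _ _ => 0⟩

/-- The product of two automata.  The binary representation of a state is the concatenation of the
binary representations of the components. -/
def prod (P P' : PAut) : PAut where
  w := P.w + P'.w
  st := P.st + 2 ^ P.w * P'.st
  acc q := P.acc (q % 2 ^ P.w) && P'.acc (q / 2 ^ P.w)
  step q x := P.step (q % 2 ^ P.w) x + 2 ^ P.w * P'.step (q / 2 ^ P.w) x

/-- The product of a list of automata. -/
def prodL (l : List PAut) : PAut := l.foldr prod one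

/-- The automaton accepts the word `u`. -/
def Accepts (P : PAut) (u : List ℕ) : Prop := P.acc (u.foldl P.step P.st) = true

/-- The data of an automaton whose states are the numbers with `P.w` digits. -/
def toAut (m : ℕ) (P : PAut) : Aut where
  s := 2 ^ P.w
  st := P.st
  ac := (List.range (2 ^ P.w)).map P.acc
  tb := (List.range (2 ^ P.w)).map fun q => (List.range m).map (P.step q)

variable {m : ℕ} {P P' : PAut} {l : List PAut} {u : List ℕ}

lemma add_mul_lt {a b v w : ℕ} (ha : a < 2 ^ v) (hb : b < 2 ^ w) : a + 2 ^ v * b < 2 ^ (v + w) := by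
  rw [pow_add]
  calc a + 2 ^ v * b < 2 ^ v + 2 ^ v * b := by omega
    _ = 2 ^ v * (b + 1) := by ring
    _ ≤ 2 ^ v * 2 ^ w := Nat.mul_le_mul_left _ hb

lemma div_lt {q v w : ℕ} (h : q < 2 ^ (v + w)) : q / 2 ^ v < 2 ^ w := by
  rw [pow_add] at h
  exact Nat.div_lt_of_lt_mul h

lemma mod_lt (q v : ℕ) : q % 2 ^ v < 2 ^ v := Nat.mod_lt _ (by positivity)

lemma add_mul_mod {a b v : ℕ} (ha : a < 2 ^ v) : (a + 2 ^ v * b) % 2 ^ v = a := by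
  rw [Nat.add_mul_mod_self_left, Nat.mod_eq_of_lt ha]

lemma add_mul_div {a b v : ℕ} (ha : a < 2 ^ v) : (a + 2 ^ v * b) / 2 ^ v = b := by
  rw [Nat.add_mul_div_left _ _ (by positivity), Nat.div_eq_of_lt ha, zero_add]

lemma valid_one : one.Valid m := ⟨by simp [one], by simp [one]⟩

lemma Valid.prod (h : P.Valid m) (h' : P'.Valid m) : (P.prod P').Valid m where
  st_lt := add_mul_lt h.st_lt h'.st_lt
  step_lt _ hq x hx := add_mul_lt (h.step_lt _ (mod_lt _ _) x hx) (h'.step_lt _ (div_lt hq) x hx)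

lemma valid_prodL (h : ∀ P ∈ l, P.Valid m) : (prodL l).Valid m := by
  induction l with
  | nil => exact valid_one
  | cons P l ih => exact (h P (by simp)).prod (ih fun P' hP' => h P' (by simp [hP']))

lemma Valid.foldl_lt (h : P.Valid m) {q : ℕ} (hq : q < 2 ^ P.w) (hu : ∀ x ∈ u, x < m) :
    u.foldl P.step q < 2 ^ P.w := by
  induction u generalizing q with
  | nil => exact hq
  | cons x u ih =>
    exact ih (h.step_lt q hq x (hu x (by simp))) fun y hy => hu y (by simp [hy])

/-- The components of a product run independently. -/
lemma foldl_prod (h : P.Valid m) {q q' : ℕ} (hq : q < 2 ^ P.w) (hu : ∀ x ∈ u, x < m) :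
    u.foldl (P.prod P').step (q + 2 ^ P.w * q') =
      u.foldl P.step q + 2 ^ P.w * u.foldl P'.step q' := by
  induction u generalizing q q' with
  | nil => rfl
  | cons x u ih =>
    rw [List.foldl_cons, List.foldl_cons, List.foldl_cons,
      ← ih (h.step_lt q hq x (hu x (by simp))) fun y hy => hu y (by simp [hy])]
    simp only [prod, add_mul_mod hq, add_mul_div hq]

lemma accepts_prod (h : P.Valid m) (hu : ∀ x ∈ u, x < m) :
    (P.prod P').Accepts u ↔ P.Accepts u ∧ P'.Accepts u := by
  have h1 := foldl_prod (P' := P') (q' := P'.st) h h.st_lt hu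
  have h2 := h.foldl_lt h.st_lt hu
  rw [Accepts, show (P.prod P').st = P.st + 2 ^ P.w * P'.st from rfl, h1]
  simp only [prod, add_mul_mod h2, add_mul_div h2, Bool.and_eq_true]
  rfl

/-- The product of a list of automata accepts the words that all of them accept. -/
lemma accepts_prodL (h : ∀ P ∈ l, P.Valid m) (hu : ∀ x ∈ u, x < m) :
    (prodL l).Accepts u ↔ ∀ P ∈ l, P.Accepts u := by
  induction l with
  | nil => simp [prodL, one, Accepts]
  | cons P l ih =>
    rw [prodL, List.foldr_cons, accepts_prod (h P (by simp)) hu, List.forall_mem_cons]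
    exact and_congr_right fun _ => ih fun P' hP' => h P' (by simp [hP'])

lemma valid_toAut (h : P.Valid m) : (P.toAut m).Valid m where
  one_le := Nat.one_le_two_pow
  st_lt := h.st_lt
  length_ac := by simp [toAut]
  length_tb := by simp [toAut]
  row ρ hρ := by
    obtain ⟨q, hq, rfl⟩ := List.mem_map.1 hρ
    refine ⟨by simp, fun v hv => ?_⟩
    obtain ⟨x, hx, rfl⟩ := List.mem_map.1 hv
    exact h.step_lt q (List.mem_range.1 hq) x (List.mem_range.1 hx)

lemma accepts_toAut (h : P.Valid m) (hu : ∀ x ∈ u, x < m) :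
    (P.toAut m).Accepts u ↔ P.Accepts u := by
  have key : ∀ q < 2 ^ P.w, u.foldl (P.toAut m).step q = u.foldl P.step q := by
    intro q hq
    induction u generalizing q with
    | nil => rfl
    | cons x u ih =>
      have hx := hu x (by simp)
      rw [List.foldl_cons, List.foldl_cons,
        show (P.toAut m).step q x = P.step q x by simp [Aut.step, toAut, hq, hx]]
      exact ih (fun y hy => hu y (by simp [hy])) _ (h.step_lt q hq x hx)
  have hlt := h.foldl_lt h.st_lt hu
  rw [Aut.Accepts, show (P.toAut m).st = P.st from rfl, key _ h.st_lt, Accepts]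
  simp [toAut, hlt]

lemma w_toAut : (P.toAut m).w = P.w := by
  rw [Aut.w, show (P.toAut m).s = 2 ^ P.w from rfl]
  rcases hw : P.w with _ | w
  · rfl
  · have h2 : 2 ^ (w + 1) = 2 * 2 ^ w := by rw [pow_succ, mul_comm]
    have h1 : 1 ≤ 2 ^ w := Nat.one_le_two_pow
    exact DFAInt.size_of_two_pow_le (by omega) (by omega)

lemma enc_toAut : (P.toAut m).enc = DFAInt.unary (2 ^ P.w) ++ (DFAInt.bits P.w P.st ++
    ((List.range (2 ^ P.w)).map P.acc ++ (List.range (2 ^ P.w)).flatMap fun q =>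
      (List.range m).flatMap fun x => DFAInt.bits P.w (P.step q x))) := by
  rw [Aut.enc, w_toAut]
  simp [toAut, List.flatMap_map]

lemma length_enc_toAut : (P.toAut m).enc.length =
    2 ^ P.w + 1 + (P.w + (2 ^ P.w + 2 ^ P.w * (m * P.w))) := by
  rw [enc_toAut]
  simp [DFAInt.unary, List.length_flatMap]
  ring

end PAut

namespace Aut

/-- An automaton with additional states, so that all numbers with `a.w` digits are states; the new
states are not accepting, and all letters lead from a new state to itself. -/
def pad (a : Aut) : PAut where
  w := a.w
  st := a.st
  acc q := a.ac.getD q false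
  step q x := if q < a.s then a.step q x else q

variable {m : ℕ} {a : Aut} {u : List ℕ}

lemma Valid.step_lt (h : a.Valid m) {q x : ℕ} (hq : q < a.s) (hx : x < m) : a.step q x < a.s := by
  have h1 : q < a.tb.length := by rwa [h.length_tb]
  have h2 := h.row _ (List.getElem_mem h1)
  have h3 : x < a.tb[q].length := by rw [h2.1]; exact hx
  have h4 : a.step q x = a.tb[q][x] := by
    rw [step, List.getD_eq_getElem _ _ h1, List.getD_eq_getElem _ _ h3]
  rw [h4]
  exact h2.2 _ (List.getElem_mem _)

lemma Valid.pad (h : a.Valid m) : a.pad.Valid m where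
  st_lt := h.st_lt.trans_le a.le_two_pow
  step_lt q hq x hx := by
    simp only [Aut.pad]
    split_ifs with h1
    · exact (h.step_lt h1 hx).trans_le a.le_two_pow
    · exact hq

lemma accepts_pad (h : a.Valid m) (hu : ∀ x ∈ u, x < m) : a.pad.Accepts u ↔ a.Accepts u := by
  have key : ∀ q < a.s, u.foldl a.pad.step q = u.foldl a.step q := by
    intro q hq
    induction u generalizing q with
    | nil => rfl
    | cons x u ih =>
      rw [List.foldl_cons, List.foldl_cons,
        show a.pad.step q x = a.step q x by simp [pad, hq]]
      exact ih (fun y hy => hu y (by simp [hy])) _ (h.step_lt hq (hu x (by simp)))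
  rw [PAut.Accepts, Accepts, show a.pad.st = a.st from rfl, key _ h.st_lt]
  rfl

/-- The table that is stored on a tape is the table of the padded automaton. -/
lemma table_eq (h : a.Valid m) : a.table m = (List.range (2 ^ a.w)).map (a.pad.row m) := by
  have hs := a.le_two_pow
  obtain ⟨p, hp⟩ := Nat.exists_eq_add_of_le hs
  rw [table, hp, List.range_add, List.map_append, Nat.add_sub_cancel_left]
  congr 1
  · refine List.ext_getElem (by simp [h.length_ac, h.length_tb]) fun q h1 h2 => ?_
    have hq : q < a.s := by simpa using h2
    have h3 : q < a.tb.length := by rwa [h.length_tb]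
    have h4 : q < a.ac.length := by rwa [h.length_ac]
    simp only [List.getElem_zip, List.getElem_map, List.getElem_range, PAut.row]
    refine Prod.ext ?_ ?_
    · simp [pad, h4]
    · refine List.ext_getElem (by simp [(h.row _ (List.getElem_mem h3)).1]) fun x h5 h6 => ?_
      have h7 : x < a.tb[q].length := by simpa using h5
      simp [pad, hq, step, h3, h7]
  · rw [padTable, List.range'_eq_map_range, List.map_map, List.map_map]
    refine List.map_congr_left fun q hq => ?_
    simp only [Function.comp, PAut.row]
    refine Prod.ext ?_ ?_
    · simp [pad, h.length_ac]
    · refine List.ext_getElem (by simp) fun x h5 h6 => ?_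
      simp [pad]

end Aut

/-! ### The output of the nested loops -/

lemma _root_.List.flatMap_range_mul {α : Type*} (f : ℕ → List α) (b a : ℕ) :
    (List.range (b * a)).flatMap f =
      (List.range a).flatMap fun y => (List.range b).flatMap fun x => f (x + b * y) := by
  induction a with
  | zero => simp
  | succ a ih =>
    rw [Nat.mul_succ, List.range_add, List.flatMap_append, ih, List.range_succ, List.flatMap_append,
      List.flatMap_map]
    simp [add_comm]

section emit

variable {I : Type} [DecidableEq I] {ρ : I → List Row} {is : List I} {P : I → PAut} {m : ℕ}
  {f : (I → Row) → List Bool} {c : I → Row}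

/-- The rows of the components of the state `q` of the product of the automata in a list. -/
def assign (m : ℕ) (P : I → PAut) : List I → ℕ → (I → Row) → I → Row
  | [], _, c => c
  | i :: is, q, c => Function.update (assign m P is (q / 2 ^ (P i).w) c) i
      ((P i).row m (q % 2 ^ (P i).w))

/-- Nested loops over the rows of the factors are a loop over the states of the product, in
numerical order. -/
lemma emit_eq (hρ : ∀ i ∈ is, ρ i = (List.range (2 ^ (P i).w)).map ((P i).row m)) :
    emit ρ is f c = (List.range (2 ^ (PAut.prodL (is.map P)).w)).flatMap fun q =>
      f (assign m P is q c) := by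
  induction is generalizing f with
  | nil => simp [emit, PAut.prodL, PAut.one, assign]
  | cons i is ih =>
    have hw : (PAut.prodL ((i :: is).map P)).w = (P i).w + (PAut.prodL (is.map P)).w := rfl
    rw [emit, ih fun j hj => hρ j (by simp [hj]), hw, pow_add, List.flatMap_range_mul]
    refine List.flatMap_congr fun y _ => ?_
    rw [hρ i (by simp), List.flatMap_map]
    refine List.flatMap_congr fun x hx => ?_
    rw [assign, PAut.add_mul_mod (List.mem_range.1 hx), PAut.add_mul_div (List.mem_range.1 hx)]

lemma assign_of_mem_tail {i j : I} (h : i ∉ is) (hj : j ∈ is) (q : ℕ) :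
    assign m P (i :: is) q c j = assign m P is (q / 2 ^ (P i).w) c j := by
  rw [assign, Function.update_of_ne (by rintro rfl; exact h hj)]

lemma all_assign (his : is.Nodup) (q : ℕ) : is.all (fun i => (assign m P is q c i).1) =
    (PAut.prodL (is.map P)).acc q := by
  induction is generalizing q with
  | nil => rfl
  | cons i is ih =>
    rw [List.nodup_cons] at his
    rw [List.all_cons, List.map_cons, PAut.prodL, List.foldr_cons, PAut.prod]
    congr 1
    · simp [assign, PAut.row]
    · rw [← PAut.prodL, ← ih his.2, Bool.eq_iff_iff, List.all_eq_true, List.all_eq_true]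
      refine forall₂_congr fun j hj => ?_
      rw [assign_of_mem_tail his.1 hj]

lemma columns_map_range (n : ℕ) (H : List (ℕ → List Bool)) :
    columns n (H.map fun h => (List.range n).map h) =
      (List.range n).flatMap fun x => H.flatMap fun h => h x := by
  induction n generalizing H with
  | zero => rfl
  | succ n ih =>
    rw [columns, List.range_succ_eq_map, List.flatMap_cons, List.flatMap_map, List.flatMap_map,
      List.map_map]
    congr 1
    have := ih (H.map fun h x => h (x + 1))
    simpa [Function.comp_def, List.flatMap_map] using this

lemma columns_assign (his : is.Nodup) (hP : ∀ i ∈ is, (P i).Valid m) {q : ℕ}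
    (hq : q < 2 ^ (PAut.prodL (is.map P)).w) :
    columns m (is.map fun i => (assign m P is q c i).2) = (List.range m).flatMap fun x =>
      DFAInt.bits (PAut.prodL (is.map P)).w ((PAut.prodL (is.map P)).step q x) := by
  obtain ⟨H, hH1, hH2⟩ : ∃ H : List (ℕ → List Bool),
      (is.map fun i => (assign m P is q c i).2) = H.map (fun h => (List.range m).map h) ∧
      ∀ x < m, (H.flatMap fun h => h x) =
        DFAInt.bits (PAut.prodL (is.map P)).w ((PAut.prodL (is.map P)).step q x) := by
    induction is generalizing q with
    | nil => exact ⟨[], rfl, fun x _ => rfl⟩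
    | cons i is ih =>
      rw [List.nodup_cons] at his
      obtain ⟨H, h1, h2⟩ := ih his.2 (fun j hj => hP j (by simp [hj])) (PAut.div_lt hq)
      refine ⟨(fun x => DFAInt.bits (P i).w ((P i).step (q % 2 ^ (P i).w) x)) :: H, ?_, ?_⟩
      · rw [List.map_cons, List.map_cons, ← h1]
        congr 1
        · simp [assign, PAut.row]
        · refine List.map_congr_left fun j hj => ?_
          rw [assign_of_mem_tail his.1 hj]
      · intro x hx
        rw [List.flatMap_cons, h2 x hx]
        exact (DFAInt.bits_add _ _ _ _ ((hP i (by simp)).step_lt _ (PAut.mod_lt _ _) x hx)).symm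
  rw [hH1, columns_map_range]
  exact List.flatMap_congr fun x hx => hH2 x (List.mem_range.1 hx)

end emit

/-! ### Writing a product -/

section group

variable {I : Type} [DecidableEq I] {m t t' C P N : ℕ} {is S : List I} {st : I → List Bool}
  {ρ : I → List Row} {F G : Frag (Tp I) Cell} {f f' : (I → Row) → List Bool} {a : I → Aut}

omit [DecidableEq I] in
lemma Emits.seq (h : Emits m st ρ F S t f) (h' : Emits m st ρ G S t' f') :
    Emits m st ρ (seq F G) S (t + 1 + t') (fun c => f c ++ f' c) := by
  intro σ p o c hS hp hc hP
  refine Ends.seq ((h σ p o c hS hp hc hP).imp le_rfl (fun σ₁ h₁ => ?_) id)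
  rw [← List.append_assoc]
  exact h' σ₁ p _ c hS hp hc h₁

omit [DecidableEq I] in
lemma Emits.congr (h : Emits m st ρ F S t f) (hf : ∀ c, f c = f' c) : Emits m st ρ F S t f' :=
  funext hf ▸ h

omit [DecidableEq I] in
lemma emits_skip : Emits m st ρ skip S t (fun _ => []) :=
  fun _ _ _ _ _ _ _ hP => Ends.skip (by rwa [List.append_nil])

omit [DecidableEq I] in
lemma Emits.forEach {J : Type} {js : List J} {G : J → Frag (Tp I) Cell}
    {e : J → (I → Row) → List Bool} (h : ∀ j ∈ js, Emits m st ρ (G j) S t (e j)) :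
    Emits m st ρ (forEach G js) S (js.length * (t + 1)) (fun c => js.flatMap fun j => e j c) := by
  induction js with
  | nil => exact emits_skip
  | cons i js ih =>
    exact ((h i (by simp)).seq (ih fun j hj => h j (by simp [hj]))).mono
      (by rw [List.length_cons]; ring_nf; omega)

lemma emits_put {x : Bool} : Emits m st ρ (put (.inl out) fun _ => b x) S 1 (fun _ => [x]) :=
  fun _ _ _ _ _ _ _ hP => Ends.put hP.out hP.put

lemma emits_copy {i : I} (h : (st i).length ≤ N) :
    Emits m st ρ (copy (.inr (i, St)) (.inl out) id) S (8 * N + 8) (fun _ => st i) := by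
  intro σ p o c _ _ _ hP
  refine Ends.copy (by simp) (hP.st i) hP.out (fun a ha => ?_) ?_ (by simpa using h)
  · obtain ⟨x, -, rfl⟩ := List.mem_map.1 ha
    exact nofun
  constructor
  · simp [hP.mt]
  · simp [hP.st]
  · simp [hP.tb]
  · simp

/-- Write the product of the automata in a list. -/
noncomputable def putProd (is : List I) : Frag (Tp I) Cell :=
  seq (forAll is (put (.inl out) fun _ => b true)) (seq (put (.inl out) fun _ => b false)
    (seq (forEach (fun i => copy (.inr (i, St)) (.inl out) id) is)
      (seq (forAll is (putAcc is)) (forAll is (putRow is)))))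

/-- A bound for the time of `putProd`. -/
def prodTime (P C N m g : ℕ) : ℕ :=
  loopTime P C g 1 + 1 + (1 + 1 + (g * (8 * N + 9) + 1 + (loopTime P C g 1 + 1 +
    loopTime P C g (g * (3 * C + 8) + m * (g * (5 * N + 3) + 4) + 3 * m + 10))))

lemma bits_prodL {l : List PAut} (h : ∀ P ∈ l, P.Valid m) :
    DFAInt.bits (PAut.prodL l).w (PAut.prodL l).st = l.flatMap fun P => DFAInt.bits P.w P.st := by
  induction l with
  | nil => rfl
  | cons P l ih =>
    rw [List.flatMap_cons, ← ih fun P' hP' => h P' (by simp [hP'])]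
    exact DFAInt.bits_add _ _ _ _ (h P (by simp)).st_lt

/-- The product of the automata `a i` for the members `i` of a list. -/
def prodAut (m : ℕ) (a : I → Aut) (is : List I) : Aut :=
  (PAut.prodL (is.map fun i => (a i).pad)).toAut m

/-- The nested loops write the encoding of the product automaton: a one for each state, then the
initial state, then an accepting bit for each state, then a row of the table for each state. -/
lemma emits_putProd (his : is.Nodup) (ha : ∀ i, (a i).Valid m)
    (hst : ∀ i, st i = DFAInt.bits (a i).w (a i).st) (hρ : ∀ i, ρ i = (a i).table m)
    (hN : ∀ i, (a i).w ≤ N) (hP : ∀ i, 2 ^ (a i).w ≤ P)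
    (hC : ∀ i, (tableCells (ρ i)).length ≤ C) :
    Emits m st ρ (putProd is) is.reverse (prodTime P C N m is.length)
      (fun _ => (prodAut m a is).enc) := by
  have hρ' : ∀ i ∈ is, ρ i = (List.range (2 ^ (a i).pad.w)).map ((a i).pad.row m) :=
    fun i _ => (hρ i).trans (Aut.table_eq (ha i))
  have hlen : ∀ i, (ρ i).length ≤ P := fun i => by
    rw [hρ i, Aut.table_eq (ha i)]
    simpa using hP i
  have hpad : ∀ i ∈ is, (a i).pad.Valid m := fun i _ => (ha i).pad
  have hall : ∀ {F f t}, Emits m st ρ F [] t f → Emits m st ρ (forAll is F) is.reverse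
      (loopTime P C is.length t) (fun c => emit ρ is f c) := fun h => by
    have := h.forAll his (by simp) hC hlen
    rwa [List.append_nil] at this
  have key := (hall (emits_put (x := true))).seq ((emits_put (x := false)).seq
      ((Emits.forEach (js := is)
    (fun i _ => emits_copy (N := N) (by rw [hst i]; simpa using hN i))).seq
    ((hall (emits_putAcc (is := is))).seq (hall (emits_putRow (N := N) (C := C) his
    (fun i r hr => by
      rw [hρ i, Aut.table_eq (ha i)] at hr
      obtain ⟨q, -, rfl⟩ := List.mem_map.1 hr
      refine ⟨by simp [PAut.row], fun u hu => ?_⟩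
      obtain ⟨x, -, rfl⟩ := List.mem_map.1 hu
      rw [DFAInt.length_bits]
      exact hN i) hC)))))
  refine key.congr fun c => ?_
  · symm
    rw [prodAut, PAut.enc_toAut, bits_prodL (by simpa using hpad)]
    simp only [emit_eq hρ']
    set w := (PAut.prodL (is.map fun i => (a i).pad)).w
    rw [DFAInt.unary, List.append_assoc]
    congr 1
    · rw [← List.map_eq_flatMap]; simp
    congr 1
    congr 1
    · rw [List.flatMap_map]
      exact List.flatMap_congr fun i _ => (hst i).symm
    congr 1
    · simp_rw [all_assign his]
      simp [← List.map_eq_flatMap]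
    · exact List.flatMap_congr fun q hq => (columns_assign his hpad (List.mem_range.1 hq)).symm

end group

/-! ### The reduction and its running time -/

section reduce

variable {I : Type} [DecidableEq I] {m t g : ℕ} {is S S' : List I} {st : I → List Bool}
  {ρ : I → List Row} {F : Frag (Tp I) Cell} {f : (I → Row) → List Bool} {a : I → Aut}
  {gs : List (List I)} {x : List Bool} {σ : Tp I → Tape Cell}

omit [DecidableEq I] in
lemma Emits.subset (h : Emits m st ρ F S t f) (hS : S ⊆ S') : Emits m st ρ F S' t f :=
  fun σ p o c hp => h σ p o c fun i hi => hp i (hS hi)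

/-- The reduction: replace each list of automata in `gs` by the product of the automata. -/
noncomputable def reduce (gs : List (List I)) : Frag (Tp I) Cell :=
  seq (parse gs.flatten) (seq (copy (.inl mt) (.inl out) id) (seq (put (.inl out) fun _ => b false)
    (seq (forEach putProd gs) (rewind (.inl out)))))

/-- The output of the reduction. -/
def output (gs : List (List I)) (m : ℕ) (a : I → Aut) : List Bool :=
  DFAInt.unary m ++ gs.flatMap fun is => (prodAut m a is).enc

omit [DecidableEq I] in
lemma Instance.le_length (h : Instance is x m a) : m ≤ x.length := by
  rw [h.2]; simp [DFAInt.unary]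

omit [DecidableEq I] in
lemma Instance.s_le_length (h : Instance is x m a) {i : I} (hi : i ∈ is) : (a i).s ≤ x.length := by
  have h1 : (a i).s ≤ (a i).enc.length := by simp [Aut.enc, DFAInt.unary]
  have h2 : (a i).enc.length ≤ (is.flatMap fun i => (a i).enc).length :=
    (List.sublist_flatten_of_mem (List.mem_map_of_mem (f := fun i => (a i).enc) hi)).length_le
  rw [h.2, List.length_append]
  omega

/-- A bound for the size of a table for an automaton in an instance of length `n`. -/
def tableBound (n : ℕ) : ℕ := 2 * n * (1 + n * (n + 1))

omit [DecidableEq I] in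
lemma Instance.length_tableCells_le (h : Instance is x m a) {i : I} (hi : i ∈ is) :
    (tableCells ((a i).table m)).length ≤ tableBound x.length := by
  have hv := h.1 i hi
  have hs := h.s_le_length hi
  have hm := h.le_length
  have h1 := hv.two_pow_le
  rw [length_tableCells (m := m) (w := (a i).w) fun ρ hρ => hv.mem_table hρ, hv.length_table,
    tableBound]
  have hw : (a i).w ≤ x.length := Aut.w_le.trans hs
  gcongr
  omega

/-- A bound for the time of the reduction when the output has length `l`. -/
def reduceTime (k g n l : ℕ) : ℕ :=
  (k * g + 1) * (200 * (n + 1) ^ 3 + 1) + (8 * n + 8) +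
  k * (prodTime (2 * n) (tableBound n) n n g + 1) +
    (3 * l + 12)

lemma loopTime_mono {P C n t t' : ℕ} (h : t ≤ t') : loopTime P C n t ≤ loopTime P C n t' := by
  induction n generalizing t t' with
  | zero => exact h
  | succ n ih => exact ih (by gcongr)

lemma prodTime_mono {P C N m m' g : ℕ} (h : m ≤ m') : prodTime P C N m g ≤ prodTime P C N m' g := by
  have := loopTime_mono (P := P) (C := C) (n := g)
    (t := g * (3 * C + 8) + m * (g * (5 * N + 3) + 4) + 3 * m + 10)
    (t' := g * (3 * C + 8) + m' * (g * (5 * N + 3) + 4) + 3 * m' + 10) (by gcongr)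
  rw [prodTime, prodTime]
  omega

/-- The reduction aborts if the input is not an instance, and writes the products otherwise. -/
lemma Ends.reduce (hgs : gs.flatten.Nodup) (hI : ∀ i, i ∈ gs.flatten)
    (hg : ∀ is ∈ gs, is.length = g)
    (hin : σ (.inl inp) = Tape.mk₂ [] (x.map b)) (hσ : ∀ k, k ≠ .inl inp → σ k = Tape.mk₂ [] [])
    (ht : ∀ m a, Instance gs.flatten x m a →
      reduceTime gs.length g x.length (output gs m a).length ≤ t)
    (ht' : reduceTime gs.length g x.length 0 ≤ t) :
    (reduce gs).Ends σ t (fun σ' => ∃ m a, Instance gs.flatten x m a ∧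
      σ' (.inl out) = Tape.mk₂ [] ((output gs m a).map b))
      (¬ ∃ m a, Instance gs.flatten x m a) := by
  have hlen : gs.flatten.length = gs.length * g := by
    rw [List.length_flatten, List.map_congr_left hg]
    simp
  obtain ⟨n, hn, e, σ₁, h1, h2⟩ := Ends.parse (x := x) hgs hin hσ le_rfl
  rw [hlen] at hn
  cases e
  · refine ⟨n, le_trans ?_ ht', false, σ₁, h1.seq_abort rfl, by simpa using h2⟩
    rw [reduceTime]
    omega
  obtain ⟨m, a, hx, hP⟩ := by simpa using h2
  have hm := hx.le_length
  have h3 : ((Red.parse gs.flatten).Ends σ n (fun σ' => σ' = σ₁)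
      (¬ ∃ m a, Instance gs.flatten x m a)) :=
    ⟨n, le_rfl, true, σ₁, h1, by simp⟩
  refine Ends.mono (Ends.seq (t' := 8 * m + 8 + 1 + (1 + 1 + (gs.length *
    (prodTime (2 * x.length) (tableBound x.length) x.length m g + 1) + 1 +
      (3 * (output gs m a).length + 7)))) (h3.imp le_rfl ?_ id)) ?_
  swap
  · refine le_trans ?_ (ht m a hx)
    have := Nat.mul_le_mul_left gs.length (Nat.add_le_add_right (prodTime_mono (P := 2 * x.length)
      (C := tableBound x.length) (N := x.length) (g := g) hm) 1)
    rw [reduceTime]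
    omega
  rintro σ₁ rfl
  refine Ends.seq (Ends.copy (by simp) hP.mt hP.out ?_ ?_ (by simp))
  · intro c hc
    rw [List.eq_of_mem_replicate hc]
    exact nofun
  refine Ends.seq (Ends.put (Function.update_self ..) ?_)
  have hT : ∀ i, ∃ r, ((a i).table m).head? = some r := fun i => by
    have := (hx.1 i (hI i)).length_table
    rcases h : (a i).table m with _ | ⟨r, T⟩
    · rw [h] at this
      exact absurd this.symm (by simp)
    · exact ⟨r, rfl⟩
  choose c hc using hT
  have hpos : Pos m (fun i => DFAInt.bits (a i).w (a i).st) (fun i => ([], (a i).table m))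
      (DFAInt.unary m) (Function.update (Function.update σ₁ (.inl out)
        (Tape.mk₂ (((List.replicate m (b true)).map id).reverse ++ []) [])) (.inl out)
        (Tape.mk₂ (b false :: (((List.replicate m (b true)).map id).reverse ++ [])) [])) := by
    constructor
    · simp [hP.mt]
    · intro i; simp [hP.st i (hI i)]
    · intro i; simp [hP.tb i (hI i), tableCells]
    · simp [DFAInt.unary]
  have key := Emits.forEach (m := m) (st := fun i => DFAInt.bits (a i).w (a i).st)
    (ρ := fun i => (a i).table m) (js := gs) (S := gs.flatten)
    (G := putProd) (e := fun is _ => (prodAut m a is).enc)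
    (t := prodTime (2 * x.length) (tableBound x.length) x.length m g) fun is his => by
      rw [← hg is his]
      refine (emits_putProd (N := x.length) (P := 2 * x.length) (C := tableBound x.length)
        (List.Sublist.nodup (List.sublist_flatten_of_mem his) hgs) (fun i => hx.1 i (hI i))
        (fun _ => rfl) (fun _ => rfl) (fun i => Aut.w_le.trans (hx.s_le_length (hI i)))
        (fun i => ?_)
        (fun i => hx.length_tableCells_le (hI i))).subset fun i _ => hI i
      have h1 := (hx.1 i (hI i)).two_pow_le
      have h2 := hx.s_le_length (hI i)
      omega
  refine Ends.seq ((key _ _ _ c (by simp) (by simp) hc hpos).imp le_rfl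
      (fun σ₂ hσ₂ => ?_) False.elim)
  refine Ends.rewind (l := ((output gs m a).map b).reverse) (r := []) hσ₂.out ?_ ?_ (by simp)
  · intro c hc
    obtain ⟨x, -, rfl⟩ := List.mem_map.1 (List.mem_reverse.1 hc)
    exact nofun
  · exact ⟨m, a, hx, by simp⟩

end reduce

/-! ### Correctness of the reduction and size of the output -/

section bounds

variable {I : Type} {m g n k l L : ℕ} {is : List I} {a : I → Aut} {gs : List (List I)}
  {x : List Bool} {A : Set ℕ}

lemma Instance.output (h : Instance gs.flatten x m a) :
    Instance gs (output gs m a) m (prodAut m a) := by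
  refine ⟨fun is his => PAut.valid_toAut (PAut.valid_prodL fun P hP => ?_), rfl⟩
  obtain ⟨i, hi, rfl⟩ := List.mem_map.1 hP
  exact (h.1 i (List.mem_flatten_of_mem his hi)).pad

lemma accepts_prodAut (h : ∀ i ∈ is, (a i).Valid m) {u : List ℕ} (hu : ∀ v ∈ u, v < m) :
    (prodAut m a is).Accepts u ↔ ∀ i ∈ is, (a i).Accepts u := by
  have hP : ∀ P ∈ is.map fun i => (a i).pad, P.Valid m := fun P hP => by
    obtain ⟨i, hi, rfl⟩ := List.mem_map.1 hP
    exact (h i hi).pad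
  rw [prodAut, PAut.accepts_toAut (PAut.valid_prodL hP) hu, PAut.accepts_prodL hP hu,
    List.forall_mem_map]
  exact forall₂_congr fun i hi => Aut.accepts_pad (h i hi) hu

/-- The reduction preserves solvability. -/
lemma Instance.output_mem_iff (h : Instance gs.flatten x m a) :
    Red.output gs m a ∈ kDFAInt A gs.length ↔ x ∈ kDFAInt A gs.flatten.length := by
  rw [h.output.mem_kDFAInt, h.mem_kDFAInt]
  refine and_congr_right fun _ => exists_congr fun u => and_congr_right fun hu => ?_
  rw [List.forall_mem_flatten]
  exact forall₂_congr fun is his =>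
    accepts_prodAut (fun i hi => h.1 i (List.mem_flatten_of_mem his hi)) hu

lemma two_pow_w_prodL_le {l : List PAut} {B : ℕ} (h : ∀ P ∈ l, 2 ^ P.w ≤ B) :
    2 ^ (PAut.prodL l).w ≤ B ^ l.length := by
  induction l with
  | nil => exact le_rfl
  | cons P l ih =>
    rw [show (PAut.prodL (P :: l)).w = P.w + (PAut.prodL l).w from rfl, pow_add, List.length_cons,
      pow_succ']
    exact Nat.mul_le_mul (h P (by simp)) (ih fun P' hP' => h P' (by simp [hP']))

lemma w_prodL_le {l : List PAut} {B : ℕ} (h : ∀ P ∈ l, P.w ≤ B) :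
    (PAut.prodL l).w ≤ l.length * B := by
  induction l with
  | nil => exact Nat.zero_le _
  | cons P l ih =>
    rw [show (PAut.prodL (P :: l)).w = P.w + (PAut.prodL l).w from rfl, List.length_cons]
    have h1 := h P (by simp)
    have h2 := ih fun P' hP' => h P' (by simp [hP'])
    rw [add_mul]
    omega

lemma Instance.length_enc_prodAut_le (h : Instance gs.flatten x m a) (his : is ∈ gs) :
    (prodAut m a is).enc.length ≤
      2 ^ is.length * (2 * is.length + 3) * (x.length + 1) ^ (is.length + 2) := by
  set N := x.length + 1 with hN
  set g := is.length with hg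
  have hmem : ∀ i ∈ is, i ∈ gs.flatten := fun i hi => List.mem_flatten_of_mem his hi
  have h1 : 2 ^ (PAut.prodL (is.map fun i => (a i).pad)).w ≤ 2 ^ g * N ^ g := by
    rw [← mul_pow]
    refine (two_pow_w_prodL_le (B := 2 * N) fun P hP => ?_).trans_eq (by rw [List.length_map])
    obtain ⟨i, hi, rfl⟩ := List.mem_map.1 hP
    have h1 := (h.1 i (hmem i hi)).two_pow_le
    have h2 := h.s_le_length (hmem i hi)
    change 2 ^ (a i).w ≤ _
    omega
  have h2 : (PAut.prodL (is.map fun i => (a i).pad)).w ≤ g * N := by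
    refine (w_prodL_le (B := N) fun P hP => ?_).trans_eq (by rw [List.length_map])
    obtain ⟨i, hi, rfl⟩ := List.mem_map.1 hP
    have h2 := h.s_le_length (hmem i hi)
    exact (Aut.w_le.trans h2).trans (by omega)
  have h3 : m ≤ N := h.le_length.trans (by omega)
  rw [prodAut, PAut.length_enc_toAut]
  generalize (PAut.prodL (is.map fun i => (a i).pad)).w = W at h1 h2
  have h4 : 2 ^ W * (m * W) ≤ 2 ^ g * N ^ g * (N * (g * N)) := by gcongr
  have h5 : 1 ≤ 2 ^ g := Nat.one_le_two_pow
  have h6 : 1 ≤ N := by omega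
  have h7 : N ^ g ≤ N ^ (g + 2) := Nat.pow_le_pow_right h6 (by omega)
  have h8 : N ≤ N ^ (g + 2) := Nat.le_self_pow (by omega) N
  have h9 : 2 ^ g * N ^ g ≤ 2 ^ g * N ^ (g + 2) := Nat.mul_le_mul_left _ h7
  have h10 : N ^ (g + 2) ≤ 2 ^ g * N ^ (g + 2) := Nat.le_mul_of_pos_left _ h5
  have h11 : g * N ≤ g * (2 ^ g * N ^ (g + 2)) := Nat.mul_le_mul_left _ (h8.trans h10)
  have h12 : 2 ^ g * N ^ g * (N * (g * N)) = g * (2 ^ g * N ^ (g + 2)) := by ring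
  have h13 : 2 ^ g * (2 * g + 3) * N ^ (g + 2) = 2 * (g * (2 ^ g * N ^ (g + 2))) +
    3 * (2 ^ g * N ^ (g + 2)) := by ring
  omega

lemma _root_.List.length_flatMap_le {α β : Type*} {f : α → List β} {B : ℕ} {l : List α}
    (h : ∀ y ∈ l, (f y).length ≤ B) : (l.flatMap f).length ≤ l.length * B := by
  induction l with
  | nil => simp
  | cons y l ih =>
    have h1 := h y (by simp)
    have h2 := ih fun z hz => h z (by simp [hz])
    rw [List.flatMap_cons, List.length_append, List.length_cons, add_mul]
    omega

/-- The output of the reduction has length `O(n^(g + 2))`. -/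
lemma Instance.length_output_le (h : Instance gs.flatten x m a) (hg : ∀ is ∈ gs, is.length = g) :
    (Red.output gs m a).length ≤
      (gs.length + 1) * (2 ^ g * (2 * g + 3)) * (x.length + 1) ^ (g + 2) := by
  have h1 := List.length_flatMap_le (l := gs) (f := fun is => (prodAut m a is).enc)
    (B := 2 ^ g * (2 * g + 3) * (x.length + 1) ^ (g + 2)) fun is his => by
      have := h.length_enc_prodAut_le his
      rwa [hg is his] at this
  have h2 := h.le_length
  have h3 : x.length + 1 ≤ (x.length + 1) ^ (g + 2) := Nat.le_self_pow (by omega) _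
  have h4 : (x.length + 1) ^ (g + 2) ≤ 2 ^ g * (2 * g + 3) * (x.length + 1) ^ (g + 2) :=
    Nat.le_mul_of_pos_left _ (by positivity)
  rw [Red.output, List.length_append, mul_assoc, add_mul, one_mul, DFAInt.unary]
  simp only [List.length_append, List.length_replicate, List.length_singleton]
  omega

/-- The reduction takes time `O(n^(g + 3))`. -/
lemma exists_reduceTime_le (k g L : ℕ) : ∃ K, ∀ n l, l ≤ L * (n + 1) ^ (g + 2) →
    reduceTime k g n l ≤ K * (n + 1) ^ (g + 3) := by
  refine ⟨(k * g + 1) * 201 + 28 + k * (3 ^ g * (22 * g + 76) + 17 * g + 6) + 3 * L,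
      fun n l hl => ?_⟩
  set N := n + 1 with hN
  set E := N ^ (g + 3) with hE
  have h1 : 1 ≤ N := by omega
  have hNE : N ^ 3 ≤ E := Nat.pow_le_pow_right h1 (by omega)
  have hN3 : N ≤ N ^ 3 := Nat.le_self_pow (by omega) N
  have hC : tableBound n ≤ 2 * N ^ 3 := by
    rw [tableBound, hN]
    ring_nf
    omega
  have hloop : ∀ D t, t ≤ D * N ^ 3 →
      loopTime (2 * n) (tableBound n) g t ≤ 3 ^ g * (D + 19) * E := by
    intro D t ht
    calc loopTime (2 * n) (tableBound n) g t
        ≤ (2 * n + 3) ^ g * (t + 3 * tableBound n + 13) :=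
          (by omega : _ ≤ loopTime (2 * n) (tableBound n) g t + 3 * tableBound n + 13).trans
            (loopTime_le _ _ _ _)
      _ ≤ (3 * N) ^ g * ((D + 19) * N ^ 3) := by
          gcongr
          · omega
          · rw [add_mul]; omega
      _ = 3 ^ g * (D + 19) * E := by rw [hE, mul_pow]; ring
  have hl1 := hloop 1 1 (by omega)
  have hl2 := hloop (22 * g + 17)
      (g * (3 * tableBound n + 8) + n * (g * (5 * n + 3) + 4) + 3 * n + 10) <| by
    have e1 : g * (3 * tableBound n + 8) ≤ g * (14 * N ^ 3) := Nat.mul_le_mul_left _ (by omega)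
    have e2 : n * (g * (5 * n + 3) + 4) ≤ N * (g * (8 * N) + 4 * N) :=
      Nat.mul_le_mul (by omega) (Nat.add_le_add (Nat.mul_le_mul_left _ (by omega)) (by omega))
    have e3 : N * (g * (8 * N) + 4 * N) ≤ (8 * g + 4) * N ^ 3 := by
      have : N ^ 2 ≤ N ^ 3 := Nat.pow_le_pow_right h1 (by omega)
      calc N * (g * (8 * N) + 4 * N) = (8 * g + 4) * N ^ 2 := by ring
        _ ≤ _ := Nat.mul_le_mul_left _ this
    have e4 : (22 * g + 17) * N ^ 3 = g * (14 * N ^ 3) + (8 * g + 4) * N ^ 3 + 13 * N ^ 3 := by ring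
    omega
  have hprod : prodTime (2 * n) (tableBound n) n n g + 1 ≤
      (3 ^ g * (22 * g + 76) + 17 * g + 6) * E := by
    have e1 : g * (8 * n + 9) ≤ g * (17 * E) := Nat.mul_le_mul_left _ (by omega)
    have e2 : (3 ^ g * (22 * g + 76) + 17 * g + 6) * E =
        3 ^ g * (1 + 19) * E + 3 ^ g * (1 + 19) * E +
      3 ^ g * (22 * g + 17 + 19) * E + g * (17 * E) + 6 * E := by ring
    rw [prodTime]
    omega
  have hk : k * (prodTime (2 * n) (tableBound n) n n g + 1) ≤
      k * (3 ^ g * (22 * g + 76) + 17 * g + 6) * E := by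
    rw [mul_assoc]
    exact Nat.mul_le_mul_left _ hprod
  have hp : (k * g + 1) * (200 * N ^ 3 + 1) ≤ (k * g + 1) * 201 * E := by
    rw [mul_assoc]
    exact Nat.mul_le_mul_left _ (by omega)
  have hL : l ≤ L * E := hl.trans (Nat.mul_le_mul_left _ (Nat.pow_le_pow_right h1 (by omega)))
  have : ((k * g + 1) * 201 + 28 + k * (3 ^ g * (22 * g + 76) + 17 * g + 6) + 3 * L) * E =
    (k * g + 1) * 201 * E + 28 * E + k * (3 ^ g * (22 * g + 76) + 17 * g + 6) * E + 3 * (L * E) :=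
    by ring
  rw [this, reduceTime, ← hN]
  omega

end bounds

end Red

/-! ### Running a machine on the output of the reduction -/

namespace Frag

open Turing (Tape)

variable {ι₁ Γ₁ ι Γ : Type} [Inhabited Γ₁] [Inhabited Γ]

lemma Ends.lift {F : Frag ι₁ Γ₁} {e : ι₁ → ι} {er : ι → Option ι₁} {enc : Turing.PointedMap Γ₁ Γ}
    {dec : Γ → Γ₁} (he : ∀ i j, er j = some i ↔ j = e i) (hd : ∀ a, dec (enc a) = a)
    {t : ℕ} {τ : ι₁ → Tape Γ₁} {σ : ι → Tape Γ} {Q : (ι₁ → Tape Γ₁) → Prop}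
    {Q' : (ι → Tape Γ) → Prop} {A A' : Prop} (h : F.Ends τ t Q A)
    (hσ : ∀ i, σ (e i) = (τ i).map enc)
    (hQ : ∀ τ' σ', Q τ' → (∀ i, σ' (e i) = (τ' i).map enc) →
    (∀ j, er j = none → σ' j = σ j) → Q' σ')
    (hA : A → A') : (F.lift e er enc dec).Ends σ t Q' A' := by
  obtain ⟨n, hn, b, τ', h1, h2⟩ := h
  obtain ⟨σ', h3, h4, h5⟩ := h1.lift he hd hσ
  refine ⟨n, hn, b, σ', h3, ?_⟩
  cases b
  · exact hA (by simpa using h2)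
  · exact hQ τ' σ' (by simpa using h2) h4 h5

lemma Ends.ofMachine {M : MultiTM} {L : Language Bool} {T : ℕ → ℕ} (h : M.DecidesInTime L T)
    (x : List Bool) : (ofMachine M).Ends (M.init x).tape (T x.length) (fun _ => x ∈ L) (x ∉ L) := by
  obtain ⟨n, hn, b, σ', h1, h2⟩ := ofMachine_halts (h x).1
  refine ⟨n, hn, b, σ', h1, ?_⟩
  rw [(h x).2] at h2
  cases b
  · simpa using h2
  · simpa using h2

/-- A fragment that exits on the words of `L` and aborts on the other words is a machine for `L`. -/
lemma decidesInTime_toMachine [Finite ι] [DecidableEq ι] [Finite Γ] {F : Frag ι Γ} {inp : ι}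
    {bit : Bool → Γ} {h1 : Function.Injective bit} {h2 : ∀ b, bit b ≠ default} {L : Language Bool}
    {T : ℕ → ℕ} (h : ∀ x : List Bool, F.Ends
      (fun i => Tape.mk₁ (if i = inp then x.map bit else []))
      (T x.length) (fun _ => x ∈ L) (x ∉ L)) :
    (F.toMachine inp bit h1 h2).DecidesInTime L (fun n => T n + 1) := by
  intro x
  obtain ⟨n, hn, b, σ', h3, h4⟩ := h x
  have h5 := toMachine_run (inp := inp) (h1 := h1) (h2 := h2) h3 (t := T x.length + 1) (by omega)
  refine ⟨h5.1, h5.2.trans ?_⟩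
  cases b
  · simpa using h4
  · simpa using h4

end Frag

namespace Red

open Cell Com Loc Frag Turing

section solve

variable {I : Type} [DecidableEq I] {g : ℕ} {gs : List (List I)} {A : Set ℕ} (M : MultiTM)

/-- The symbols of the reduction, as symbols of the combined machine. -/
def encCell : PointedMap Cell (Cell × M.Γ) := ⟨fun c => (c, default), rfl⟩

/-- The symbols of the machine `M`, as symbols of the combined machine. -/
def encSym : PointedMap M.Γ (Cell × M.Γ) := ⟨fun c => (default, c), rfl⟩

/-- The input symbol of `M` for a bit of the output of the reduction. -/
def transfer : Cell × M.Γ → Cell × M.Γ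
  | (b x, _) => (default, M.bit x)
  | _ => default

/-- Run the reduction, hand its output over to `M` and run `M`. -/
noncomputable def solve (gs : List (List I)) : Frag (Tp I ⊕ M.ι) (Cell × M.Γ) :=
  seq ((reduce gs).lift .inl Sum.getLeft? (encCell M) Prod.fst)
    (seq (copy (.inl (.inl out)) (.inr M.inp) (transfer M)) (seq (rewind (.inr M.inp))
      ((ofMachine M).lift .inr Sum.getRight? (encSym M) Prod.snd)))

variable {M} {T : ℕ → ℕ} {L : ℕ}

lemma map_mk₁ {Γ Γ' : Type} [Inhabited Γ] [Inhabited Γ'] (f : PointedMap Γ Γ') (s : List Γ) :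
    (Tape.mk₁ s).map f = Tape.mk₁ (s.map f) := Tape.map_mk₁ f s

/-- The combined machine decides the problem for all automata together if `M` decides it for the
products; `l` is a bound for the length of the output of the reduction. -/
lemma Ends.solve (hT : Monotone T) (hM : M.DecidesInTime (kDFAInt A gs.length) T)
    (hgs : gs.flatten.Nodup) (hI : ∀ i, i ∈ gs.flatten) (hg : ∀ is ∈ gs, is.length = g)
    {x : List Bool} {l : ℕ} (hl : ∀ m a, Instance gs.flatten x m a → (output gs m a).length ≤ l) :
    (solve M gs).Ends (fun i => Tape.mk₁ (if i = .inl (.inl inp) then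
      x.map (fun y => encCell M (b y)) else []))
      (reduceTime gs.length g x.length l + 11 * l + 18 + T l)
      (fun _ => x ∈ kDFAInt A gs.flatten.length)
      (x ∉ kDFAInt A gs.flatten.length) := by
  have hmono : ∀ l', l' ≤ l →
      reduceTime gs.length g x.length l' ≤ reduceTime gs.length g x.length l :=
    fun l' h => by rw [reduceTime, reduceTime]; omega
  refine Ends.mono (Ends.seq (t := reduceTime gs.length g x.length l)
    (t' := 8 * l + 8 + 1 + (3 * l + 7 + 1 + T l)) ?_) (by omega)
  refine Ends.lift (τ := fun i => Tape.mk₁ (if i = .inl inp then x.map b else [])) (by simp)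
    (fun _ => rfl) (Ends.reduce (x := x) hgs hI hg (by simp; rfl)
      (fun k hk => by rw [if_neg hk]; rfl) (fun m a h => hmono _ (hl m a h))
      (hmono _ (Nat.zero_le _)))
    (fun i => ?_) ?_ (fun h hx => h (exists_instance hgs hx))
  · rw [map_mk₁]
    by_cases hi : i = .inl inp
    · simp [hi, Function.comp_def]
    · simp [hi]
  rintro τ σ ⟨m, a, hx, hout⟩ h1 h2
  set y := output gs m a with hy
  have hly := hl m a hx
  have h3 : σ (.inl (.inl out)) = Tape.mk₂ [] (y.map fun z => encCell M (b z)) := by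
    rw [h1, hout]
    exact (map_mk₁ _ _).trans (by simp; rfl)
  have h4 : ∀ j, σ (.inr j) = Tape.mk₂ [] [] := fun j => by
    rw [h2 _ (by simp), if_neg (by simp)]
    rfl
  refine Ends.mono (Ends.seq (t := 8 * l + 8) (t' := 3 * l + 7 + 1 + T l)
    (Ends.copy (by simp) h3 (h4 _) ?_ ?_ (by simpa using hly))) (by omega)
  · intro c hc
    obtain ⟨z, -, rfl⟩ := List.mem_map.1 hc
    exact fun h => by simpa [encCell] using congrArg Prod.fst h
  have htr : (y.map fun z => encCell M (b z)).map (transfer M) = (y.map M.bit).map (encSym M) := by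
    simp [transfer, encCell, encSym]
  rw [htr, List.append_nil]
  refine Ends.mono (Ends.seq (t := 3 * l + 7) (t' := T l)
    (Ends.rewind (l := ((y.map M.bit).map (encSym M)).reverse) (r := []) (by simp) ?_ ?_
      (by simpa using hly))) (by omega)
  · intro c hc h
    obtain ⟨z', hz', rfl⟩ := List.mem_map.1 (List.mem_reverse.1 hc)
    obtain ⟨z, -, rfl⟩ := List.mem_map.1 hz'
    exact M.bit_ne_blank z (congrArg Prod.snd h)
  have key := Ends.ofMachine hM y
  refine Ends.lift (by simp [eq_comm]) (fun _ => rfl) (key.mono (hT hly)) (fun i => ?_)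
    (fun _ _ h _ _ => hx.output_mem_iff.1 h) (fun h h' => h (hx.output_mem_iff.2 h'))
  rw [MultiTM.init, map_mk₁]
  by_cases hi : i = M.inp
  · subst hi; simp; rfl
  · simp [hi, h4]; rfl

/-- From a machine for as many automata as there are groups, one obtains a machine for all automata.
-/
lemma exists_decidesInTime [Finite I] (hT : Monotone T)
    (hM : M.DecidesInTime (kDFAInt A gs.length) T)
    (hgs : gs.flatten.Nodup) (hI : ∀ i, i ∈ gs.flatten) (hg : ∀ is ∈ gs, is.length = g) :
    ∃ (M' : MultiTM) (K L : ℕ), M'.DecidesInTime (kDFAInt A gs.flatten.length)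
      (fun n => K * (n + 1) ^ (g + 3) + T (L * (n + 1) ^ (g + 2))) := by
  obtain ⟨K, hK⟩ := exists_reduceTime_le gs.length g
    ((gs.length + 1) * (2 ^ g * (2 * g + 3)))
  set L := (gs.length + 1) * (2 ^ g * (2 * g + 3)) with hL
  have hbit : Function.Injective fun y => encCell M (b y) := fun y z h => by
    simpa [encCell] using congrArg Prod.fst h
  refine ⟨(solve M gs).toMachine (.inl (.inl inp)) (fun y => encCell M (b y)) hbit
    (fun y h => by simpa [encCell] using congrArg Prod.fst h), K + 11 * L + 19, L, ?_⟩
  have : (fun n => (K + 11 * L + 19) * (n + 1) ^ (g + 3) + T (L * (n + 1) ^ (g + 2))) =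
    fun n => (fun n => (K + 11 * L + 19) * (n + 1) ^ (g + 3) +
    T (L * (n + 1) ^ (g + 2)) - 1) n + 1 := by
    funext n
    have : 0 < (K + 11 * L + 19) * (n + 1) ^ (g + 3) := by positivity
    beta_reduce
    omega
  rw [this]
  refine decidesInTime_toMachine fun x => ?_
  refine (Ends.solve hT hM hgs hI hg (x := x) (l := L * (x.length + 1) ^ (g + 2))
    fun m a h => h.length_output_le hg).mono ?_
  have h1 := hK x.length _ le_rfl
  have h2 : (x.length + 1) ^ (g + 2) ≤ (x.length + 1) ^ (g + 3) :=
    Nat.pow_le_pow_right (by omega) (by omega)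
  have h3 := Nat.mul_le_mul_left L h2
  have h4 : 1 ≤ (x.length + 1) ^ (g + 3) := Nat.one_le_pow _ _ (by omega)
  have h5 : (K + 11 * L + 19) * (x.length + 1) ^ (g + 3) = K * (x.length + 1) ^ (g + 3) +
    11 * (L * (x.length + 1) ^ (g + 3)) + 19 * (x.length + 1) ^ (g + 3) := by ring
  omega

end solve

end Red

/-! ### Machines that cannot read their whole input -/

namespace MultiTM

open Turing (Tape)

variable {M : MultiTM} {L : Language Bool} {T T' : ℕ → ℕ}

lemma run_add (C : M.Cfg) (s t : ℕ) : M.run (s + t) C = M.run t (M.run s C) := by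
  rw [run, run, run, add_comm, Function.iterate_add_apply]

lemma run_eq_of_halted {C : M.Cfg} {s t : ℕ} (hs : M.step (M.run s C) = none) (h : s ≤ t) :
    M.run t C = M.run s C := by
  obtain ⟨r, rfl⟩ := Nat.exists_eq_add_of_le h
  rw [run_add, Frag.run_of_step_none hs]

lemma DecidesInTime.mono (h : M.DecidesInTime L T) (hT : ∀ n, T n ≤ T' n) :
    M.DecidesInTime L T' := fun x => by
  rw [run_eq_of_halted (h x).1 (hT _)]
  exact h x

/-- The contents of two tapes are the same up to distance `r` from the head. -/
def Agree {Γ : Type} [Inhabited Γ] (r : ℕ) (S S' : Tape Γ) : Prop :=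
  ∀ i : ℤ, |i| ≤ r → S.nth i = S'.nth i

lemma Agree.act {Γ : Type} [Inhabited Γ] {r : ℕ} {S S' : Tape Γ} (h : Agree (r + 1) S S')
    (a : Γ × Option Turing.Dir) : Agree r (act S a) (act S' a) := by
  have hw : ∀ i : ℤ, |i| ≤ r + 1 → (S.write a.1).nth i = (S'.write a.1).nth i := fun i hi => by
    rw [Tape.write_nth, Tape.write_nth, h i (by exact_mod_cast hi)]
  intro i hi
  rw [abs_le] at hi
  rcases a with ⟨a, _ | _ | _⟩
  · exact hw i (abs_le.2 (by omega))
  · simp only [MultiTM.act, Tape.move_left_nth]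
    exact hw _ (abs_le.2 (by omega))
  · simp only [MultiTM.act, Tape.move_right_nth]
    exact hw _ (abs_le.2 (by omega))

/-- In `t` steps, a machine sees only the cells up to distance `t` from the heads. -/
lemma run_agree {t : ℕ} {C C' : M.Cfg} (hs : C.state = C'.state)
    (ht : ∀ i, Agree t (C.tape i) (C'.tape i)) :
    (M.run t C).state = (M.run t C').state ∧
      (M.step (M.run t C) = none ↔ M.step (M.run t C') = none) := by
  have hd : ∀ {t : ℕ} {C C' : M.Cfg}, C.state = C'.state → (∀ i, Agree t (C.tape i) (C'.tape i)) →
      M.δ C.state (fun i => (C.tape i).head) = M.δ C'.state (fun i => (C'.tape i).head) := by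
    intro t C C' hs ht
    rw [hs]
    congr 1
    funext i
    exact ht i 0 (by simp)
  induction t generalizing C C' with
  | zero =>
    refine ⟨hs, ?_⟩
    simp only [run, Function.iterate_zero, id, step, Option.map_eq_none_iff, hd hs ht]
  | succ t ih =>
    rw [Frag.run_succ, Frag.run_succ]
    refine ih ?_ ?_
    · rw [step, step, ← hd hs ht]
      cases M.δ C.state (fun i => (C.tape i).head)
      · exact hs
      · rfl
    · rw [step, step, ← hd hs ht]
      cases M.δ C.state (fun i => (C.tape i).head)
      · exact fun i j hj => ht i j (hj.trans (by simp))
      · exact fun i => (ht i).act _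

/-- If a machine halts on the input `y` before it reaches the end of `y`, then it cannot
distinguish `y` from its continuations. -/
lemma DecidesInTime.mem_append_iff (h : M.DecidesInTime L T) {y : List Bool}
    (hy : T y.length < y.length)
    (z : List Bool) : y ++ z ∈ L ↔ y ∈ L := by
  have key : ∀ i, Agree (T y.length) ((M.init (y ++ z)).tape i) ((M.init y).tape i) := by
    intro i j hj
    by_cases hi : i = M.inp
    · simp only [init, hi, if_true]
      rcases j with j | j
      · have hj' : j < y.length := by simp at hj; omega
        rcases j with _ | j
        · rcases y with _ | ⟨y₀, y⟩
          · simp at hj'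
          · rfl
        · rcases y with _ | ⟨y₀, y⟩
          · simp at hj'
          · simp at hj'
            simp [Tape.mk₁, Tape.mk₂, Tape.mk', Tape.nth, List.getI_eq_getElem?_getD, hj',
              List.getElem?_append_left]
      · rfl
    · simp [init, hi]
  obtain ⟨h1, h2⟩ := run_agree (M := M) (t := T y.length) (C := M.init (y ++ z)) (C' := M.init y)
      rfl key
  have h3 := h2.2 (h y).1
  rw [← (h y).2, ← h1, ← (h (y ++ z)).2]
  rcases le_total (T y.length) (T (y ++ z).length) with hle | hle
  · rw [run_eq_of_halted h3 hle]
  · rw [run_eq_of_halted (h (y ++ z)).1 hle]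

end MultiTM

/-- A language is not decidable in less than linear time if arbitrarily long words
outside of the language have continuations in the language. -/
lemma notMem_DTIME_of_prefix {L : Language Bool} {t : ℕ → ℝ}
    (ht : t =o[atTop] fun n => (n : ℝ))
    (h : ∃ᶠ n in atTop, ∃ y z : List Bool, y.length = n ∧ y ∉ L ∧ y ++ z ∈ L) : L ∉ DTIME t := by
  rintro ⟨M, T, hT, hM⟩
  have h1 : ∀ᶠ n : ℕ in atTop, T n < n := by
    filter_upwards [(hT.trans_isLittleO ht).def (c := 1 / 2) (by norm_num), eventually_gt_atTop 0]
      with n hn hn0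
    rw [Real.norm_natCast, Real.norm_natCast] at hn
    have : (0 : ℝ) < n := by exact_mod_cast hn0
    exact_mod_cast (by linarith : (T n : ℝ) < n)
  obtain ⟨n, ⟨y, z, rfl, hy, hz⟩, hn⟩ := (h.and_eventually h1).exists
  exact hy ((hM.mem_append_iff hn z).1 hz)

/-- The case of one automaton: the word `1ᵐ01ᴺ` is not an instance, but a prefix of an instance with
`m` letters and `N + 1` states. -/
lemma kDFAInt_one_notMem_DTIME {A : Set ℕ} (hA : A.Nonempty) {ε : ℝ} (hε : 0 < ε) :
    kDFAInt A 1 ∉ DTIME (fun n => (n : ℝ) ^ (1 - ε)) := by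
  obtain ⟨m, hm⟩ := hA
  refine notMem_DTIME_of_prefix ?_ ?_
  · refine (isLittleO_iff_tendsto' ?_).2 ?_
    · filter_upwards [eventually_gt_atTop 0] with n hn h
      exact absurd h (by positivity)
    · refine ((tendsto_rpow_neg_atTop hε).comp tendsto_natCast_atTop_atTop).congr' ?_
      filter_upwards [eventually_gt_atTop 0] with n hn
      have hn' : (0 : ℝ) < n := by exact_mod_cast hn
      rw [Function.comp_apply, Real.rpow_sub hn', Real.rpow_one, Real.rpow_neg hn'.le]
      field_simp
  · refine frequently_atTop.2 fun N => ⟨m + 1 + N, by omega,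
      DFAInt.unary m ++ List.replicate N true, ?_⟩
    set D : DFA (Fin m) (Fin (N + 1)) := ⟨fun q _ => q, 0, Set.univ⟩
    have hx : DFAInt.encode (k := 1) (fun _ => N + 1) (fun _ => D) ∈ kDFAInt A 1 :=
      ⟨m, hm, _, _, rfl, [], fun _ => Set.mem_univ _⟩
    obtain ⟨z, hz⟩ : ∃ z, DFAInt.encode (k := 1) (fun _ => N + 1) (fun _ => D) =
        DFAInt.unary m ++ List.replicate N true ++ z := by
      simp only [DFAInt.encode, DFAInt.encodeDFA, DFAInt.unary, List.replicate_succ']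
      exact ⟨_, by simp; rfl⟩
    refine ⟨z, by simp [DFAInt.unary]; omega, ?_, hz ▸ hx⟩
    -- After the size of the alphabet, an instance continues with the number of states in unary, so
    -- it contains a second zero.
    rintro ⟨m', -, s, D', h, -⟩
    rw [DFAInt.encode] at h
    obtain ⟨rfl, h⟩ := DFAInt.unary_append_inj h
    simp only [List.ofFn_succ, List.ofFn_zero, List.flatten_cons, List.flatten_nil, List.append_nil,
      DFAInt.encodeDFA, List.append_assoc] at h
    exact DFAInt.replicate_ne_unary _ _ _ h

/-! ### The exponents -/

/-- Merging groups of `g` automata: from a machine for `k` automata one obtains a machine for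
`k * g` automata. -/
lemma exists_decidesInTime_mul {A : Set ℕ} {k : ℕ} (g : ℕ) {M : MultiTM} {T : ℕ → ℕ}
    (hT : Monotone T) (hM : M.DecidesInTime (kDFAInt A k) T) :
    ∃ (M' : MultiTM) (K L : ℕ), M'.DecidesInTime (kDFAInt A (k * g))
      (fun n => K * (n + 1) ^ (g + 3) + T (L * (n + 1) ^ (g + 2))) := by
  let gs : List (List (Fin k × Fin g)) :=
    (List.finRange k).map fun i => (List.finRange g).map fun j => (i, j)
  have hgs : gs.flatten = List.finRange k ×ˢ List.finRange g := rfl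
  have hlen : gs.length = k := by simp [gs]
  have hlen' : gs.flatten.length = k * g := by rw [hgs, List.length_product]; simp
  rw [← hlen] at hM
  have := Red.exists_decidesInTime (gs := gs) (g := g) hT hM
    (hgs ▸ (List.nodup_finRange k).product (List.nodup_finRange g))
    (fun i => by rw [hgs, List.mem_product]; simp)
    (fun is his => by obtain ⟨i, -, rfl⟩ := List.mem_map.1 his; simp)
  rwa [hlen'] at this

/-- A time bound in `O(n^p)` may be replaced by a monotone one that is bounded by a multiple of
`(n + 1)^p` for all `n`; the shift makes the bound positive at `n = 0`. -/
lemma exists_monotone_le_rpow {T : ℕ → ℕ} {p : ℝ} (hp : 0 ≤ p)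
    (hT : (fun n => (T n : ℝ)) =O[atTop] fun n : ℕ => (n : ℝ) ^ p) :
    ∃ (T' : ℕ → ℕ) (C : ℝ), Monotone T' ∧ (∀ n, T n ≤ T' n) ∧ 0 ≤ C ∧
      ∀ n, (T' n : ℝ) ≤ C * ((n : ℝ) + 1) ^ p := by
  obtain ⟨C, hC⟩ := hT.bound
  obtain ⟨N, hN⟩ := eventually_atTop.1 hC
  have hle : ∀ n, (T n : ℝ) ≤
      (|C| + ∑ j ∈ Finset.range N, (T j : ℝ)) * ((n : ℝ) + 1) ^ p := fun n => by
    have h1 : 1 ≤ ((n : ℝ) + 1) ^ p := Real.one_le_rpow (by simp) hp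
    have h2 : (n : ℝ) ^ p ≤ ((n : ℝ) + 1) ^ p := Real.rpow_le_rpow (by positivity) (by simp) hp
    have h3 : 0 ≤ ∑ j ∈ Finset.range N, (T j : ℝ) := by positivity
    rcases le_or_gt N n with h | h
    · have := hN n h
      rw [Real.norm_natCast, Real.norm_of_nonneg (by positivity)] at this
      calc (T n : ℝ) ≤ C * (n : ℝ) ^ p := this
        _ ≤ |C| * ((n : ℝ) + 1) ^ p := by gcongr; exact le_abs_self C
        _ ≤ _ := by gcongr; linarith
    · have : (T n : ℝ) ≤ ∑ j ∈ Finset.range N, (T j : ℝ) :=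
        Finset.single_le_sum (f := fun j => (T j : ℝ)) (fun _ _ => by positivity)
          (Finset.mem_range.2 h)
      nlinarith [abs_nonneg C]
  refine ⟨fun n => (Finset.range (n + 1)).sup T, |C| + ∑ j ∈ Finset.range N, (T j : ℝ),
      fun n n' h => Finset.sup_mono
    (Finset.range_mono (by omega)), fun n => Finset.le_sup (Finset.self_mem_range_succ n),
    by positivity, fun n => ?_⟩
  obtain ⟨j, hj, hj'⟩ := Finset.exists_mem_eq_sup (Finset.range (n + 1)) (by simp) T
  beta_reduce
  rw [hj']
  refine (hle j).trans ?_
  have : (j : ℝ) ≤ n := by exact_mod_cast Nat.lt_succ_iff.1 (Finset.mem_range.1 hj)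
  gcongr

/-- If `k`-DFA-INT can be solved in time `O(n^p)`, then `k * g`-DFA-INT can be solved in time
`O(n^q)` for `q = max (g + 3) ((g + 2) * p)`. -/
lemma kDFAInt_mul_mem_DTIME {A : Set ℕ} {k g : ℕ} {p q : ℝ} (hp : 0 ≤ p) (hq : (g : ℝ) + 3 ≤ q)
    (hq' : ((g : ℝ) + 2) * p ≤ q) (h : kDFAInt A k ∈ DTIME fun n => (n : ℝ) ^ p) :
    kDFAInt A (k * g) ∈ DTIME fun n => (n : ℝ) ^ q := by
  obtain ⟨M, T, hT, hM⟩ := h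
  obtain ⟨T', C, hmono, hTT', hC, hT'⟩ := exists_monotone_le_rpow hp hT
  obtain ⟨M', K, L, hM'⟩ := exists_decidesInTime_mul g hmono (hM.mono hTT')
  refine ⟨M', _, ?_, hM'⟩
  refine IsBigO.of_bound ((K + C * ((L : ℝ) + 1) ^ p) * 2 ^ q) ?_
  filter_upwards [eventually_ge_atTop 1] with n hn
  have hn' : (1 : ℝ) ≤ n := by exact_mod_cast hn
  have h1 : (1 : ℝ) ≤ (n : ℝ) + 1 := by linarith
  have hq0 : 0 ≤ q := by have : (0 : ℝ) ≤ g := by positivity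
                         linarith
  rw [Real.norm_natCast, Real.norm_of_nonneg (by positivity)]
  have e1 : ((n : ℝ) + 1) ^ (g + 3) ≤ ((n : ℝ) + 1) ^ q := by
    rw [← Real.rpow_natCast]
    exact Real.rpow_le_rpow_of_exponent_le h1 (by push_cast; exact hq)
  have e2 : (T' (L * (n + 1) ^ (g + 2)) : ℝ) ≤ C * ((L : ℝ) + 1) ^ p * ((n : ℝ) + 1) ^ q := by
    have h2 : (1 : ℝ) ≤ ((n : ℝ) + 1) ^ (g + 2) := one_le_pow₀ h1
    have h3 : ((L * (n + 1) ^ (g + 2) : ℕ) : ℝ) + 1 ≤ ((L : ℝ) + 1) * ((n : ℝ) + 1) ^ (g + 2) := by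
      push_cast
      nlinarith
    calc (T' (L * (n + 1) ^ (g + 2)) : ℝ)
        ≤ C * (((L * (n + 1) ^ (g + 2) : ℕ) : ℝ) + 1) ^ p := hT' _
      _ ≤ C * (((L : ℝ) + 1) * ((n : ℝ) + 1) ^ (g + 2)) ^ p := by gcongr
      _ = C * ((L : ℝ) + 1) ^ p * ((n : ℝ) + 1) ^ (((g : ℝ) + 2) * p) := by
          rw [Real.mul_rpow (by positivity) (by positivity), ← Real.rpow_natCast,
            ← Real.rpow_mul (by positivity), mul_assoc]
          push_cast
          rfl
      _ ≤ _ := by gcongr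
  have e3 : ((n : ℝ) + 1) ^ q ≤ 2 ^ q * (n : ℝ) ^ q := by
    rw [← Real.mul_rpow (by norm_num) (by positivity)]
    exact Real.rpow_le_rpow (by positivity) (by linarith) hq0
  push_cast
  calc (K : ℝ) * ((n : ℝ) + 1) ^ (g + 3) + T' (L * (n + 1) ^ (g + 2))
      ≤ K * ((n : ℝ) + 1) ^ q + C * ((L : ℝ) + 1) ^ p * ((n : ℝ) + 1) ^ q := by gcongr
    _ = (K + C * ((L : ℝ) + 1) ^ p) * ((n : ℝ) + 1) ^ q := by ring
    _ ≤ (K + C * ((L : ℝ) + 1) ^ p) * (2 ^ q * (n : ℝ) ^ q) := by gcongr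
    _ = _ := by ring

lemma DTIME_rpow_mono {p q : ℝ} (h : p ≤ q) :
    DTIME (fun n => (n : ℝ) ^ p) ⊆ DTIME fun n => (n : ℝ) ^ q := by
  rintro L ⟨M, T, hT, hM⟩
  refine ⟨M, T, hT.trans (IsBigO.of_bound 1 ?_), hM⟩
  filter_upwards [eventually_ge_atTop 1] with n hn
  have hn' : (1 : ℝ) ≤ n := by exact_mod_cast hn
  rw [Real.norm_of_nonneg (by positivity), Real.norm_of_nonneg (by positivity), one_mul]
  exact Real.rpow_le_rpow_of_exponent_le hn' h

/-- The empty language is decided in constant time, by a machine without transitions. -/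
lemma empty_mem_DTIME {L : Language Bool} (hL : ∀ x, x ∉ L) (t : ℕ → ℝ) : L ∈ DTIME t := by
  refine ⟨{
      ι := Unit
      inp := ()
      Γ := Option Bool
      bit := some
      bit_injective := Option.some_injective _
      bit_ne_blank := Option.some_ne_none
      Q := Unit
      start := ()
      accept := ∅
      δ := fun _ _ => none },
    fun _ => 0, ?_, fun x => ⟨rfl, ?_⟩⟩
  · simpa using isBigO_zero t atTop
  · simp [hL]

theorem mainTheorem9 (c : ℕ) (A : Set ℕ)
    (h : ∀ k : ℕ, 1 ≤ k → ∀ ε : ℝ, 0 < ε →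
      kDFAInt A (k + c) ∉ DTIME (fun n => (n : ℝ) ^ ((k : ℝ) - ε))) :
    ∀ k : ℕ, 1 ≤ k → ∀ ε : ℝ, 0 < ε →
      kDFAInt A k ∉ DTIME (fun n => (n : ℝ) ^ ((k : ℝ) - ε)) := by
  intro k hk ε hε
  rcases A.eq_empty_or_nonempty with rfl | hA
  · refine absurd (empty_mem_DTIME ?_ _) (h 1 le_rfl 1 one_pos)
    rintro x ⟨m, hm, -⟩
    exact hm
  rcases hk.eq_or_lt with rfl | hk
  · simpa using kDFAInt_one_notMem_DTIME hA hε
  intro hmem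
  have hk2 : (2 : ℝ) ≤ k := by exact_mod_cast hk
  -- With `δ ≤ 1` in place of `ε`, the exponent `k - δ` is positive.
  set δ := min ε 1 with hδ
  have hδ0 : 0 < δ := lt_min hε one_pos
  have hδ1 : δ ≤ 1 := min_le_right _ _
  replace hmem := DTIME_rpow_mono (sub_le_sub_left (min_le_left ε 1) (k : ℝ)) hmem
  rw [← hδ] at hmem
  -- The exponent `(g + 2) * (k - δ)` is at most `k * g - c - 1` because `g * δ ≥ 2 * k + c + 1`.
  obtain ⟨g, hg⟩ := exists_nat_ge ((2 * k + c + 1) / δ + (c + 4))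
  have hg1 : (2 * k + c + 1 : ℝ) ≤ g * δ := by
    rw [← div_le_iff₀ hδ0]
    linarith [(by positivity : (0 : ℝ) ≤ c)]
  have hg2 : (c : ℝ) + 4 ≤ g := by
    linarith [(by positivity : (0 : ℝ) ≤ (2 * k + c + 1) / δ)]
  have hg3 : (c : ℝ) + 1 ≤ k * g := by nlinarith [(by positivity : (0 : ℝ) ≤ c)]
  have hg4 : c + 1 ≤ k * g := by exact_mod_cast hg3
  have hkg : k * g - c + c = k * g := by omega
  refine h (k * g - c) (by omega) 1 one_pos ?_
  rw [hkg, Nat.cast_sub (by omega), Nat.cast_mul]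
  refine kDFAInt_mul_mem_DTIME (by linarith) ?_ ?_ hmem
  · nlinarith
  · nlinarith
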